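/- Let $p$ be a prime and $G=\mathrm{GSp}_4$ the similitude group of the symplectic matrix with antidiagonal entries $1,1,-1,-1$. Let $K=G(\mathbf{Z}_p)$, and let $\mathrm{Kl}(p)\subset K$ be the Klingen parahoric subgroup, i.e. the preimage of the group of matrices of shape $\begin{pmatrix}*&*&*&*\\0&*&*&*\\0&*&*&*\\0&0&0&*\end{pmatrix}$ in $G(\mathbf{Z}/p)$. Let $\psi$ be an additive character of $\mathbf{Q}_p$ trivial on $\mathbf{Z}_p$ but not on $p^{-1}\mathbf{Z}_p$, and let $\pi$ be a generic irreducible smooth complex representation of $G(\mathbf{Q}_p)$ with nonzero $K$-invariants, realised in its Whittaker model $\mathcal{W}(\pi)$ with respect to the character $n\mapsto\psi(n_{12}+n_{23})$ of the upper-triangular unipotent subgroup; $G(\mathbf{Q}_p)$ acts on $\mathcal{W}(\pi)$ by right translation. Let $w^{\mathrm{sph}}\in\mathcal{W}(\pi)^K$ be the spherical Whittaker function with $w^{\mathrm{sph}}(1)=1$. Let $r_1\ge r_2\ge 0$ be integers, and let $(\alpha,\beta,\gamma,\delta)$, ordered so that $\alpha\delta=\beta\gamma$, be the Hecke parameters,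 i.e. $p^{(r_1+r_2+3)/2}$ times the (spin) Satake parameters of $\pi$. Explicitly, the spherical Hecke algebra acts on $\pi^K$ through the same character as on the spherical vector of the normalised induction from the Borel subgroup of $\mathrm{diag}(x,y,zy^{-1},zx^{-1})\mapsto\chi_1(x)\chi_2(y)\rho(z)$, where $\chi_1,\chi_2,\rho$ are the unramified characters of $\mathbf{Q}_p^\times$ with $\chi_1(p)=\gamma/\alpha$, $\chi_2(p)=\beta/\alpha$, $\rho(p)=p^{-(r_1+r_2+3)/2}\alpha$. Let $U_{2,\mathrm{Kl}}=p^{r_1}\,[\mathrm{Kl}(p)\,\mathrm{diag}(p^2,p,p,1)\,\mathrm{Kl}(p)]$ acting on $\mathcal{W}(\pi)^{\mathrm{Kl}(p)}$. Assume $\alpha+\gamma\neq 0$. Then there is a unique $w^{\mathrm{Kl}}_{\alpha\beta}\in\mathcal{W}(\pi)^{\mathrm{Kl}(p)}$ with $$U_{2,\mathrm{Kl}}\,w^{\mathrm{Kl}}_{\alpha\beta}=\frac{\alpha\beta}{p^{r_2+1}}\,w^{\mathrm{Kl}}_{\alpha\beta},\qquad w^{\mathrm{Kl}}_{\alpha\beta}(1)=1,$$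 and its trace to spherical level is $$\sum_{k\in K/\mathrm{Kl}(p)}k\cdot w^{\mathrm{Kl}}_{\alpha\beta}=p^3\left(1-\frac{\gamma}{p\beta}\right)\left(1-\frac{\delta}{p\alpha}\right)\left(1-\frac{\delta}{p\beta}\right)w^{\mathrm{sph}}.$$ -/

import Mathlib

open Matrix

namespace KlingenTrace

/-- The symplectic matrix with antidiagonal entries `1, 1, -1, -1`. -/
def J (R : Type*) [CommRing R] : Matrix (Fin 4) (Fin 4) R :=
  !![0, 0, 0, 1; 0, 0, 1, 0; 0, -1, 0, 0; -1, 0, 0, 0]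

/-- The similitude group `GSp₄(R)` of `J`. -/
def GSp4 (R : Type*) [CommRing R] : Subgroup (GL (Fin 4) R) where
  carrier := {g | ∃ c : Rˣ, (g.val)ᵀ * J R * g.val = (c : R) • J R}
  one_mem' := ⟨1, by simp⟩
  mul_mem' := by
    rintro g h ⟨c, hc⟩ ⟨d, hd⟩
    refine ⟨c * d, ?_⟩
    calc ((g * h).val)ᵀ * J R * (g * h).val
        = (h.val)ᵀ * ((g.val)ᵀ * J R * g.val) * h.val := by
          simp only [Units.val_mul, Matrix.transpose_mul, Matrix.mul_assoc]
      _ = ((c * d : Rˣ) : R) • J R := by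
          rw [hc, Matrix.mul_smul, Matrix.smul_mul, hd, smul_smul, Units.val_mul]
  inv_mem' := by
    rintro g ⟨c, hc⟩
    refine ⟨c⁻¹, ?_⟩
    have hg : g.val * (g⁻¹).val = 1 := by rw [← Units.val_mul]; simp
    have hgt : ((g⁻¹).val)ᵀ * (g.val)ᵀ = 1 := by
      rw [← Matrix.transpose_mul, hg, Matrix.transpose_one]
    have key : J R = (c : R) • (((g⁻¹).val)ᵀ * J R * (g⁻¹).val) := by
      calc J R = (((g⁻¹).val)ᵀ * (g.val)ᵀ) * J R * (g.val * (g⁻¹).val) := by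
            rw [hg, hgt]; simp
        _ = ((g⁻¹).val)ᵀ * ((g.val)ᵀ * J R * g.val) * (g⁻¹).val := by
            simp only [Matrix.mul_assoc]
        _ = _ := by rw [hc, Matrix.mul_smul, Matrix.smul_mul]
    conv_rhs => rw [key]
    rw [smul_smul, Units.inv_mul, one_smul]

/-- The underlying matrix of an element of `GSp₄(R)`. -/
def mat {R : Type*} [CommRing R] (g : GSp4 R) : Matrix (Fin 4) (Fin 4) R := g.1.val

theorem mat_mul {R : Type*} [CommRing R] (g h : GSp4 R) : mat (g * h) = mat g * mat h := rfl

theorem mat_one {R : Type*} [CommRing R] : mat (1 : GSp4 R) = 1 := rfl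

theorem J_map {R S : Type*} [CommRing R] [CommRing S] (f : R →+* S) : (J R).map f = J S := by
  ext i j
  fin_cases i <;> fin_cases j <;> simp [J]

/-- Functoriality `GSp₄(R) → GSp₄(S)` along a ring homomorphism. -/
def GSp4.map {R S : Type*} [CommRing R] [CommRing S] (f : R →+* S) : GSp4 R →* GSp4 S :=
  ((Matrix.GeneralLinearGroup.map f).comp (GSp4 R).subtype).codRestrict (GSp4 S) (by
    rintro ⟨g, c, hc⟩
    refine ⟨Units.map f.toMonoidHom c, ?_⟩
    have h := congrArg (fun M : Matrix (Fin 4) (Fin 4) R => M.map f) hc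
    simp only [Matrix.map_mul, Matrix.transpose_map, J_map] at h
    have h2 : ((c : R) • J R).map f = (f c) • J S := by
      rw [← J_map f]; ext i j; simp
    rw [h2] at h
    exact h)

/-- The inverse of `g` is, up to the similitude factor, `-J gᵀ J`. -/
theorem mat_inv {R : Type*} [CommRing R] (g : GSp4 R) :
    ∃ c : R, mat g⁻¹ = c • (-(J R * (mat g)ᵀ * J R)) := by
  obtain ⟨c, hc⟩ := g.2
  refine ⟨((c⁻¹ : Rˣ) : R), ?_⟩
  have hJ : J R * J R = -1 := by
    ext i j
    fin_cases i <;> fin_cases j <;> simp [J, Matrix.mul_apply, Fin.sum_univ_four]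
  have hl : (((c⁻¹ : Rˣ) : R) • (-(J R * (mat g)ᵀ * J R))) * mat g = 1 := by
    have h1 : J R * (mat g)ᵀ * J R * mat g = J R * ((g.1.val)ᵀ * J R * g.1.val) := by
      simp only [mat, Matrix.mul_assoc]
    rw [Matrix.smul_mul, Matrix.neg_mul, h1, hc, Matrix.mul_smul, hJ, smul_neg, smul_neg, smul_neg,
      neg_neg, smul_smul, Units.inv_mul, one_smul]
  have hr : mat g * mat g⁻¹ = 1 := by rw [← mat_mul, mul_inv_cancel, mat_one]
  exact (left_inv_eq_right_inv hl hr).symm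

/-- The Klingen parabolic subgroup, of shape
`(* * * *; 0 * * *; 0 * * *; 0 0 0 *)`. -/
def klingenParabolic (R : Type*) [CommRing R] : Subgroup (GSp4 R) where
  carrier := {g | mat g 1 0 = 0 ∧ mat g 2 0 = 0 ∧ mat g 3 0 = 0 ∧ mat g 3 1 = 0 ∧ mat g 3 2 = 0}
  one_mem' := by simp [mat_one]
  mul_mem' := by
    rintro g h ⟨a1, a2, a3, a4, a5⟩ ⟨b1, b2, b3, b4, b5⟩
    simp [mat_mul, Matrix.mul_apply, Fin.sum_univ_four, a1, a2, a3, a4, a5, b1, b2, b3, b4, b5]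
  inv_mem' := by
    rintro g ⟨a1, a2, a3, a4, a5⟩
    obtain ⟨c, hc⟩ := mat_inv g
    have e : ∀ i j, mat g⁻¹ i j = c * -(∑ l, (∑ k, J R i k * mat g l k) * J R l j) := by
      intro i j
      rw [hc]
      simp only [Matrix.smul_apply, Matrix.neg_apply, Matrix.mul_apply, Matrix.transpose_apply,
        smul_eq_mul]
    refine ⟨?_, ?_, ?_, ?_, ?_⟩ <;> rw [e] <;>
      simp [J, Fin.sum_univ_four, a1, a2, a3, a4, a5]

/-- The upper-triangular Borel subgroup, as a condition on elements. -/
def InBorel {R : Type*} [CommRing R] (b : GSp4 R) : Prop :=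
  ∀ i j : Fin 4, j < i → mat b i j = 0

/-- The unipotent radical of the Borel subgroup, as a condition on elements. -/
def InUnipotent {R : Type*} [CommRing R] (n : GSp4 R) : Prop :=
  InBorel n ∧ ∀ i : Fin 4, mat n i i = 1

section Local

variable (p : ℕ) [Fact p.Prime]

/-- `G = GSp₄(ℚ_p)`. -/
abbrev G : Type := GSp4 ℚ_[p]

/-- The hyperspecial maximal compact subgroup `GSp₄(ℤ_p)` of `GSp₄(ℚ_p)`. -/
noncomputable def K : Subgroup (G p) := (GSp4.map (algebraMap ℤ_[p] ℚ_[p])).range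

/-- The Klingen parahoric `Kl(p)`: the preimage in `GSp₄(ℤ_p)` of the Klingen parabolic subgroup
of `GSp₄(ℤ/p)`. -/
noncomputable def Kl : Subgroup (G p) :=
  ((klingenParabolic (ZMod p)).comap (GSp4.map (PadicInt.toZMod (p := p)))).map
    (GSp4.map (algebraMap ℤ_[p] ℚ_[p]))

theorem p_ne_zero : (p : ℚ_[p]) ≠ 0 := by
  exact_mod_cast (Fact.out : p.Prime).ne_zero

/-- The element `diag(p², p, p, 1)`. -/
noncomputable def tKl : G p :=
  ⟨Matrix.GeneralLinearGroup.mkOfDetNeZero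
      (Matrix.diagonal ![(p : ℚ_[p]) ^ 2, (p : ℚ_[p]), (p : ℚ_[p]), 1]) (by
        simp [Matrix.det_diagonal, Fin.prod_univ_four, p_ne_zero p]),
    ⟨Units.mk0 ((p : ℚ_[p]) ^ 2) (pow_ne_zero _ (p_ne_zero p)), by
      ext i j
      fin_cases i <;> fin_cases j <;>
        simp [Matrix.GeneralLinearGroup.mkOfDetNeZero, J, Matrix.mul_apply,
          Matrix.diagonal, pow_two]⟩⟩

variable {p}

/-- Right translation: `(g · w)(x) = w(x g)`. -/
noncomputable def translate (g : G p) (w : G p → ℂ) : G p → ℂ := fun x => w (x * g)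

/-- `w` is invariant under right translation by `H`. -/
def IsInvariant (H : Subgroup (G p)) (w : G p → ℂ) : Prop := ∀ h ∈ H, translate h w = w

/-- The double coset operator `[H g H'] : w ↦ ∑ x · w`, with `x` running over representatives of
the cosets `x H' ⊆ H g H'`; these cosets form the `H`-orbit of `g H'` in `G / H'`. It is meant for
`H'`-invariant `w`, for which the choice of representatives does not matter. -/
noncomputable def doubleCosetOp (H H' : Subgroup (G p)) (g : G p) (w : G p → ℂ) : G p → ℂ :=
  fun x => ∑ᶠ c ∈ MulAction.orbit H (g : G p ⧸ H'), translate (Quotient.out c) w x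

/-- The trace from level `Kl(p)` to level `GSp₄(ℤ_p)`, `w ↦ ∑ k · w` over `k ∈ GSp₄(ℤ_p) / Kl(p)`:
the `GSp₄(ℤ_p)`-orbit of the base point of `G / Kl(p)` is `GSp₄(ℤ_p) / Kl(p)`. -/
noncomputable def trace (w : G p → ℂ) : G p → ℂ := doubleCosetOp (K p) (Kl p) 1 w

/-- The operator `U_{2,Kl} = p^{r₁} [Kl(p) diag(p², p, p, 1) Kl(p)]`. -/
noncomputable def U2Kl (r₁ : ℕ) (w : G p → ℂ) : G p → ℂ :=
  (p : ℂ) ^ r₁ • doubleCosetOp (Kl p) (Kl p) (tKl p) w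

/-- An additive character of `ℚ_p` is unramified if it is trivial on `ℤ_p` but not on `p⁻¹ ℤ_p`. -/
def IsUnramified (ψ : AddChar ℚ_[p] ℂ) : Prop :=
  (∀ x : ℚ_[p], ‖x‖ ≤ 1 → ψ x = 1) ∧ ∃ x : ℚ_[p], ‖x‖ ≤ p ∧ ψ x ≠ 1

/-- A subspace of functions on `G` that is stable under right translation. -/
def IsStable (W : Submodule ℂ (G p → ℂ)) : Prop := ∀ g : G p, ∀ w ∈ W, translate g w ∈ W

/-- `W` is the Whittaker model, with respect to `ψ`, of a generic irreducible smooth representation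
of `G`: an irreducible subrepresentation (under right translation) of the smooth induction of the
character `n ↦ ψ(n₁₂ + n₂₃)` of the unipotent radical of the Borel subgroup. -/
structure IsWhittakerModel (ψ : AddChar ℚ_[p] ℂ) (W : Submodule ℂ (G p → ℂ)) : Prop where
  equivariant : ∀ w ∈ W, ∀ n : G p, InUnipotent n → ∀ g : G p,
    w (n * g) = ψ (mat n 0 1 + mat n 1 2) * w g
  smooth : ∀ w ∈ W, ∃ H : Subgroup (G p), IsOpen (H : Set (G p)) ∧ IsInvariant H w
  stable : IsStable W
  ne_bot : W ≠ ⊥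
  irreducible : ∀ V : Submodule ℂ (G p → ℂ), V ≤ W → IsStable V → V = ⊥ ∨ V = W

/-- The value at `b` in the Borel subgroup, with diagonal `(x, y, z / y, z / x)`, of the character
`δ_B^{1/2} · (χ₁ × χ₂ ⋊ ρ)`. Here `(χ₁ × χ₂ ⋊ ρ)(b) = χ₁(x) χ₂(y) ρ(z)`, for unramified characters
`χ₁, χ₂, ρ` of `ℚ_p^×` with values `a₁, a₂, s` at `p`, and `δ_B^{1/2}(b) = |x² y| |z|^{-3/2}`. -/
noncomputable def inducingCharacter (a₁ a₂ s : ℂ) (b : G p) : ℂ :=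
  let x := (mat b 0 0).valuation
  let y := (mat b 1 1).valuation
  let z := (mat b 0 0 * mat b 3 3).valuation
  ((Real.sqrt p : ℝ) : ℂ) ^ (3 * z - 4 * x - 2 * y) * (a₁ ^ x * a₂ ^ y * s ^ z)

/-- `φ` is the spherical vector, with value `1` at the identity, of the normalised induction from
the Borel subgroup of `χ₁ × χ₂ ⋊ ρ`, where `χ₁, χ₂, ρ` are unramified with values `a₁, a₂, s`
at `p`. (By the Iwasawa decomposition, the condition determines `φ`.) -/
def IsSphericalSection (a₁ a₂ s : ℂ) (φ : G p → ℂ) : Prop :=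
  ∀ b : G p, InBorel b → ∀ k ∈ K p, φ (b * k) = inducingCharacter a₁ a₂ s b

/-- `(α, β, γ, δ)` are the Hecke parameters (for the weights `r₁, r₂`) of the unramified
representation `W`: they are `p^{(r₁ + r₂ + 3)/2}` times its spin Satake parameters, ordered such
that `α δ = β γ`. That is, the spherical Hecke algebra acts on the `GSp₄(ℤ_p)`-invariants of `W` in
the same way as on the spherical vector of the induction of `χ₁ × χ₂ ⋊ ρ`, where the unramified
characters are given by `χ₁(p) = γ / α`, `χ₂(p) = β / α`, `ρ(p) = p^{-(r₁ + r₂ + 3)/2} α`. -/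
structure HasHeckeParameters (W : Submodule ℂ (G p → ℂ)) (r₁ r₂ : ℕ) (α β γ δ : ℂ) : Prop where
  ne_zero : α ≠ 0 ∧ β ≠ 0 ∧ γ ≠ 0 ∧ δ ≠ 0
  mul_eq : α * δ = β * γ
  eigenvalues : ∃ φ : G p → ℂ,
    IsSphericalSection (γ / α) (β / α) (α / ((Real.sqrt p : ℝ) : ℂ) ^ (r₁ + r₂ + 3)) φ ∧
    ∀ g : G p, ∀ w ∈ W, IsInvariant (K p) w →
      doubleCosetOp (K p) (K p) g w = doubleCosetOp (K p) (K p) g φ 1 • w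

/-- `w` is the normalised spherical Whittaker function in `W`. -/
def IsNormalisedSpherical (W : Submodule ℂ (G p → ℂ)) (w : G p → ℂ) : Prop :=
  w ∈ W ∧ IsInvariant (K p) w ∧ w 1 = 1

/-- `w` is a `Kl(p)`-invariant vector in `W`, is an eigenvector of `U_{2,Kl}` with eigenvalue
`α β / p^{r₂ + 1}`, and is normalised to take the value `1` at the identity. -/
def IsNormalisedKlingen (W : Submodule ℂ (G p → ℂ)) (r₁ r₂ : ℕ) (α β : ℂ) (w : G p → ℂ) : Prop :=
  w ∈ W ∧ IsInvariant (Kl p) w ∧ U2Kl r₁ w = (α * β / (p : ℂ) ^ (r₂ + 1)) • w ∧ w 1 = 1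

end Local

end KlingenTrace

namespace KlingenTrace

/-! ### Symplectic similitude matrices over a commutative ring -/

section General

variable {R : Type*} [CommRing R]

/-! Put `t = diag(p², p, p, 1)`, let `a, b, c, d` be the Hecke parameters divided by `√p ^ (r₁ + r₂
+ 3)`, and `ω = ad`. Let `U = opU` be translation by `t` followed by averaging over `Q`, the
integral points of the Klingen parabolic. On `Kl(p)`-invariants `U_{2,Kl}` is `p ^ (r₁ + 4) U`
(`U2Kl_eq`), and the prescribed eigenvalue becomes `p² U = ab`. Averages replace sums over cosets
throughout, so that operators can be composed without composing coset representatives.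

The eigenvector is found in the cyclic module `ℂ[U] w` of the spherical vector `w`. As `t` is the
scalar `p` times `diag(p, 1, 1, p⁻¹)`, the vector `U ^ k w` is `ω ^ k` times the `Q`-average of
`diag(p ^ k, 1, 1, p ^ (-k)) w` (`opU_pow`). Explicit representatives of the two spherical Hecke
operators give linear recursions for the values of a functional on torus translates of `w`
(`recursion_one`, `recursion_two`), which are used for three kinds of functionals. For functionals
factoring through the `Q`-average, they show that `p² U` on `w` is killed by the quartic with roots
`ab, ac, bd, cd` (`quartic_opU`); leaving out the factor of `ab` yields the eigenvector `eigenvec`.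
For evaluation at `1`, the vanishing of Whittaker functions off the dominant cone supplies initial
values, and `eigenvec` takes the value `a² b³ (a + c)`, nonzero as `α + γ ≠ 0` (`evalOne_eigenvec`).
For functionals factoring through the `K`-average, Weyl symmetry supplies initial values. The trace
is `p³ + p² + p + 1` times this average, and `avgK_eigenvec` makes it `ab(a + c)(pb - c)(pa - d)(pb
- d) w`. Dividing the last value by the previous one gives the formula.

For uniqueness, irreducibility makes every vector of `W` a combination of translates of `w`. Put `D
= p² ω⁻¹ U + 1`. The recursion of the first Hecke operator shows that a power of `U`, followed by a
power of `D`, carries the `Q`-average of any such vector into `ℂ[U] w`. On the eigenspace in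
question `U` and `D` are the scalars `ab / p²` and `(a + c) / c`, again nonzero, so the eigenvector
itself lies in `ℂ[U] w` (`mem_cyclic_of_eigenvector`), where eigenspaces are at most lines
(`eigenvector_unique`). -/

theorem GSp4.ext_mat {g h : GSp4 R} (hgh : mat g = mat h) : g = h :=
  Subtype.ext (Units.ext hgh)

theorem J_mul_J : J R * J R = -1 := by
  ext i j
  fin_cases i <;> fin_cases j <;> simp [J, Matrix.mul_apply, Fin.sum_univ_four]

/-- A symplectic similitude from its matrix and its similitude factor. -/
def ofMatrix (A : Matrix (Fin 4) (Fin 4) R) (c : Rˣ) (h : Aᵀ * J R * A = (c : R) • J R) :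
    GSp4 R :=
  have hl : (((c⁻¹ : Rˣ) : R) • (-(J R * Aᵀ * J R))) * A = 1 := by
    have h1 : J R * Aᵀ * J R * A = J R * (Aᵀ * J R * A) := by simp only [Matrix.mul_assoc]
    simp [h1, h, J_mul_J, smul_smul]
  ⟨⟨A, ((c⁻¹ : Rˣ) : R) • (-(J R * Aᵀ * J R)), mul_eq_one_comm.mp hl, hl⟩, c, h⟩

@[simp] theorem mat_ofMatrix (A : Matrix (Fin 4) (Fin 4) R) (c : Rˣ) (h) :
    mat (ofMatrix A c h) = A := rfl

/-- The similitude factor. -/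
def sim (g : GSp4 R) : R :=
  mat g 0 0 * mat g 3 3 + mat g 1 0 * mat g 2 3 - mat g 2 0 * mat g 1 3 - mat g 3 0 * mat g 0 3

theorem transpose_mul_J_mul (g : GSp4 R) (i j : Fin 4) :
    ((mat g)ᵀ * J R * mat g) i j = mat g 0 i * mat g 3 j + mat g 1 i * mat g 2 j
      - mat g 2 i * mat g 1 j - mat g 3 i * mat g 0 j := by
  simp [Matrix.mul_apply, Fin.sum_univ_four, J]
  ring

theorem sim_spec (g : GSp4 R) : IsUnit (sim g) ∧ (mat g)ᵀ * J R * mat g = sim g • J R := by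
  obtain ⟨c, hc⟩ := g.2
  have h := transpose_mul_J_mul g 0 3
  have hs : sim g = c := by
    rw [sim, ← h]
    change ((mat g)ᵀ * J R * mat g) = _ at hc
    rw [hc]; simp [J]
  exact ⟨hs ▸ c.isUnit, hs ▸ hc⟩

theorem sim_isUnit (g : GSp4 R) : IsUnit (sim g) := (sim_spec g).1

theorem symplectic_relation (g : GSp4 R) (i j : Fin 4) :
    mat g 0 i * mat g 3 j + mat g 1 i * mat g 2 j
      - mat g 2 i * mat g 1 j - mat g 3 i * mat g 0 j = sim g * J R i j := by
  rw [← transpose_mul_J_mul, (sim_spec g).2]; simp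

theorem sim_eq_of (g : GSp4 R) {c : R}
    (h : (mat g)ᵀ * J R * mat g = c • J R) : sim g = c := by
  have h0 := transpose_mul_J_mul g 0 3
  rw [sim, ← h0, h]; simp [J]

theorem sim_ofMatrix (A : Matrix (Fin 4) (Fin 4) R) (c : Rˣ) (h) : sim (ofMatrix A c h) = c :=
  sim_eq_of _ h

theorem sim_mul (g h : GSp4 R) : sim (g * h) = sim g * sim h := by
  refine sim_eq_of _ ?_
  calc (mat (g * h))ᵀ * J R * mat (g * h)
      = (mat h)ᵀ * ((mat g)ᵀ * J R * mat g) * mat h := by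
        simp only [mat_mul, Matrix.transpose_mul, Matrix.mul_assoc]
    _ = _ := by rw [(sim_spec g).2, Matrix.mul_smul, Matrix.smul_mul, (sim_spec h).2, smul_smul]

theorem mat_map {S : Type*} [CommRing S] (f : R →+* S) (g : GSp4 R) :
    mat (GSp4.map f g) = (mat g).map f := rfl

theorem sim_map {S : Type*} [CommRing S] (f : R →+* S) (g : GSp4 R) :
    sim (GSp4.map f g) = f (sim g) := by
  simp [sim, mat_map]

/-- The upper triangular unipotent element with the given coordinates. -/
def unip (b c d e : R) : GSp4 R :=
  ofMatrix !![1, b, c + b * e, d; 0, 1, e, c; 0, 0, 1, -b; 0, 0, 0, 1] 1 (by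
    ext i j
    fin_cases i <;> fin_cases j <;> simp [J, Matrix.mul_apply, Fin.sum_univ_four] <;> ring)

/-- The lower triangular element of the Heisenberg group with bottom row `(d, c, b, 1)`. -/
def lowHeis (b c d : R) : GSp4 R :=
  ofMatrix !![1, 0, 0, 0; -b, 1, 0, 0; c, 0, 1, 0; d, c, b, 1] 1 (by
    ext i j
    fin_cases i <;> fin_cases j <;> simp [J, Matrix.mul_apply, Fin.sum_univ_four]
    ring)

/-- The embedding of `SL₂` in the Klingen Levi subgroup. -/
def midSL (a b c d : R) (h : a * d - b * c = 1) : GSp4 R :=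
  ofMatrix !![1, 0, 0, 0; 0, a, b, 0; 0, c, d, 0; 0, 0, 0, 1] 1 (by
    have h' : d * a - b * c = 1 := by rw [← h]; ring
    ext i j
    fin_cases i <;> fin_cases j <;> simp [J, Matrix.mul_apply, Fin.sum_univ_four] <;>
      first | linear_combination h | linear_combination -h | ring)

/-- The embedding of `SL₂` as long root subgroup in the corners. -/
def outSL (a b c d : R) (h : a * d - b * c = 1) : GSp4 R :=
  ofMatrix !![a, 0, 0, b; 0, 1, 0, 0; 0, 0, 1, 0; c, 0, 0, d] 1 (by
    ext i j
    fin_cases i <;> fin_cases j <;> simp [J, Matrix.mul_apply, Fin.sum_univ_four] <;>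
      first | linear_combination h | linear_combination -h | ring)

/-- The Weyl element interchanging the first two and the last two coordinates. -/
def swapW : GSp4 R :=
  ofMatrix !![0, 1, 0, 0; 1, 0, 0, 0; 0, 0, 0, 1; 0, 0, 1, 0] 1 (by
    ext i j
    fin_cases i <;> fin_cases j <;> simp [J, Matrix.mul_apply, Fin.sum_univ_four])

/-- The diagonal element with entries `(x, y, z / y, z / x)`. -/
def diagG (x y z : Rˣ) : GSp4 R :=
  ofMatrix !![(x : R), 0, 0, 0; 0, y, 0, 0; 0, 0, ↑(z * y⁻¹), 0; 0, 0, 0, ↑(z * x⁻¹)] z (by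
    have hx := x.mul_inv; have hy := y.mul_inv
    ext i j
    fin_cases i <;> fin_cases j <;> simp [J, Matrix.mul_apply, Fin.sum_univ_four] <;> grind)

theorem unip_mul (b c d e b' c' d' e' : R) :
    unip b c d e * unip b' c' d' e' =
      unip (b + b') (c + c' - e * b') (d + d' + b * c' - (c + b * e) * b') (e + e') := by
  apply GSp4.ext_mat
  rw [mat_mul]
  ext i j
  fin_cases i <;> fin_cases j <;> simp [unip, Matrix.mul_apply, Fin.sum_univ_four] <;> ring

theorem unip_zero : unip (0 : R) 0 0 0 = 1 := by
  apply GSp4.ext_mat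
  ext i j
  fin_cases i <;> fin_cases j <;> simp [unip, mat_one]

theorem diagG_mul (x y z x' y' z' : Rˣ) :
    diagG x y z * diagG x' y' z' = diagG (x * x') (y * y') (z * z') := by
  apply GSp4.ext_mat
  rw [mat_mul]
  ext i j
  fin_cases i <;> fin_cases j <;>
    simp [diagG, Matrix.mul_apply, Fin.sum_univ_four, mul_comm, mul_left_comm, mul_assoc]

theorem diagG_one : diagG (1 : Rˣ) 1 1 = 1 := by
  apply GSp4.ext_mat
  ext i j
  fin_cases i <;> fin_cases j <;> simp [diagG, mat_one]

theorem diagG_mul_unip (x y z : Rˣ) (b c d e : R) :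
    diagG x y z * unip b c d e =
      unip (x * ↑y⁻¹ * b) (x * y * ↑z⁻¹ * c) (x * x * ↑z⁻¹ * d) (y * y * ↑z⁻¹ * e)
        * diagG x y z := by
  apply GSp4.ext_mat
  rw [mat_mul, mat_mul]
  have hx := x.mul_inv; have hy := y.mul_inv; have hz := z.mul_inv
  ext i j
  fin_cases i <;> fin_cases j <;>
    simp [diagG, unip, Matrix.mul_apply, Fin.sum_univ_four] <;> grind

end General

end KlingenTrace

namespace KlingenTrace

/-! ### Integrality criteria for `K` and `Kl(p)`, and the torus -/

section Padic

variable (p : ℕ) [Fact p.Prime]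

/-- The ring `ℤ_p` inside `ℚ_p`. -/
def ints : Subring ℚ_[p] := PadicInt.subring p

variable {p}

theorem mem_ints {x : ℚ_[p]} : x ∈ ints p ↔ ‖x‖ ≤ 1 := Iff.rfl

theorem prime_mem_ints : (p : ℚ_[p]) ∈ ints p := natCast_mem _ p

theorem mem_K_iff {g : G p} : g ∈ K p ↔ (∀ i j, mat g i j ∈ ints p) ∧ ‖sim g‖ = 1 := by
  constructor
  · rintro ⟨k, rfl⟩
    refine ⟨fun i j => (mat k i j).2, ?_⟩
    rw [sim_map]
    exact PadicInt.isUnit_iff.mp (sim_isUnit k)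
  · rintro ⟨h1, h2⟩
    let A : Matrix (Fin 4) (Fin 4) ℤ_[p] := fun i j => ⟨mat g i j, h1 i j⟩
    let s : ℤ_[p] := ⟨sim g, h2.le⟩
    have hu : IsUnit s := PadicInt.isUnit_iff.mpr h2
    have hA : Aᵀ * J ℤ_[p] * A = ((hu.unit : ℤ_[p]ˣ) : ℤ_[p]) • J ℤ_[p] := by
      have hm : A.map (algebraMap ℤ_[p] ℚ_[p]) = mat g := rfl
      have ht : Aᵀ.map (algebraMap ℤ_[p] ℚ_[p]) = (mat g)ᵀ := rfl
      have hinj : Function.Injective (algebraMap ℤ_[p] ℚ_[p]) := Subtype.val_injective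
      apply Matrix.map_injective hinj
      beta_reduce
      rw [Matrix.map_mul, Matrix.map_mul, ht, J_map, hm, (sim_spec g).2,
        ← J_map (algebraMap ℤ_[p] ℚ_[p])]
      ext i j
      simp
      left; rfl
    exact ⟨ofMatrix A hu.unit hA, GSp4.ext_mat rfl⟩

theorem toZMod_eq_zero_iff {x : ℤ_[p]} : PadicInt.toZMod x = 0 ↔ ‖(x : ℚ_[p])‖ < 1 := by
  rw [← RingHom.mem_ker, PadicInt.ker_toZMod, PadicInt.maximalIdeal_eq_span_p,
    ← PadicInt.norm_def, PadicInt.norm_lt_one_iff_dvd, Ideal.mem_span_singleton]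

theorem mem_Kl_iff {g : G p} : g ∈ Kl p ↔ g ∈ K p ∧ ‖mat g 1 0‖ < 1 ∧ ‖mat g 2 0‖ < 1 ∧
    ‖mat g 3 0‖ < 1 ∧ ‖mat g 3 1‖ < 1 ∧ ‖mat g 3 2‖ < 1 := by
  constructor
  · rintro ⟨k, ⟨h1, h2, h3, h4, h5⟩, rfl⟩
    rw [mat_map, Matrix.map_apply, toZMod_eq_zero_iff] at h1 h2 h3 h4 h5
    exact ⟨⟨k, rfl⟩, h1, h2, h3, h4, h5⟩
  · rintro ⟨⟨k, rfl⟩, h1, h2, h3, h4, h5⟩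
    refine ⟨k, ⟨?_, ?_, ?_, ?_, ?_⟩, rfl⟩ <;>
      rw [mat_map, Matrix.map_apply, toZMod_eq_zero_iff] <;> assumption

theorem Kl_le_K : Kl p ≤ K p := fun _ h => (mem_Kl_iff.mp h).1

theorem ofMatrix_mem_K {A : Matrix (Fin 4) (Fin 4) ℚ_[p]} {c : ℚ_[p]ˣ} {h}
    (hA : ∀ i j, A i j ∈ ints p) (hc : ‖(c : ℚ_[p])‖ = 1) : ofMatrix A c h ∈ K p :=
  mem_K_iff.mpr ⟨hA, by rw [sim_ofMatrix]; exact hc⟩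

theorem forall_fin_four {P : Fin 4 → Prop} : (∀ i, P i) ↔ P 0 ∧ P 1 ∧ P 2 ∧ P 3 := by
  simp [Fin.forall_fin_succ]

theorem unip_mem_K_iff {b c d e : ℚ_[p]} :
    unip b c d e ∈ K p ↔ b ∈ ints p ∧ c ∈ ints p ∧ d ∈ ints p ∧ e ∈ ints p := by
  constructor
  · intro h
    have h1 := (mem_K_iff.mp h).1
    exact ⟨h1 0 1, h1 1 3, h1 0 3, h1 1 2⟩
  · rintro ⟨hb, hc, hd, he⟩
    refine ofMatrix_mem_K ?_ (by simp)
    have := add_mem hc (mul_mem hb he)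
    have := neg_mem hb
    simp only [forall_fin_four]
    simp [*]

theorem lowHeis_mem_K {b c d : ℚ_[p]} (hb : b ∈ ints p) (hc : c ∈ ints p) (hd : d ∈ ints p) :
    lowHeis b c d ∈ K p := by
  refine ofMatrix_mem_K ?_ (by simp)
  have := neg_mem hb
  simp only [forall_fin_four]
  simp [*]

theorem midSL_mem_K {a b c d : ℚ_[p]} (h) (ha : a ∈ ints p) (hb : b ∈ ints p) (hc : c ∈ ints p)
    (hd : d ∈ ints p) : midSL a b c d h ∈ K p := by
  refine ofMatrix_mem_K ?_ (by simp)
  simp only [forall_fin_four]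
  simp [*]

theorem outSL_mem_K {a b c d : ℚ_[p]} (h) (ha : a ∈ ints p) (hb : b ∈ ints p) (hc : c ∈ ints p)
    (hd : d ∈ ints p) : outSL a b c d h ∈ K p := by
  refine ofMatrix_mem_K ?_ (by simp)
  simp only [forall_fin_four]
  simp [*]

theorem swapW_mem_K : (swapW : G p) ∈ K p := by
  refine ofMatrix_mem_K ?_ (by simp)
  simp only [forall_fin_four]
  simp

theorem diagG_mem_K {x y z : ℚ_[p]ˣ} (hx : ‖(x : ℚ_[p])‖ = 1) (hy : ‖(y : ℚ_[p])‖ = 1)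
    (hz : ‖(z : ℚ_[p])‖ = 1) : diagG x y z ∈ K p := by
  refine ofMatrix_mem_K ?_ hz
  simp only [forall_fin_four]
  simp [mem_ints, hx, hy, hz]

variable (p) in
/-- The uniformiser as a unit of `ℚ_p`. -/
noncomputable def unif : ℚ_[p]ˣ := Units.mk0 (p : ℚ_[p]) (p_ne_zero p)

variable (p) in
/-- The torus element `diag(p ^ x, p ^ y, p ^ (z - y), p ^ (z - x))`. -/
noncomputable def tor (x y z : ℤ) : G p := diagG (unif p ^ x) (unif p ^ y) (unif p ^ z)

theorem tor_mul (x y z x' y' z' : ℤ) :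
    tor p x y z * tor p x' y' z' = tor p (x + x') (y + y') (z + z') := by
  simp [tor, diagG_mul, _root_.zpow_add]

theorem tor_zero : tor p 0 0 0 = 1 := by simp [tor, diagG_one]

theorem tor_inv (x y z : ℤ) : (tor p x y z)⁻¹ = tor p (-x) (-y) (-z) := by
  rw [inv_eq_iff_mul_eq_one, tor_mul]; simp [tor_zero]

theorem tor_mul_unip (x y z : ℤ) (b c d e : ℚ_[p]) :
    tor p x y z * unip b c d e =
      unip ((p : ℚ_[p]) ^ (x - y) * b) ((p : ℚ_[p]) ^ (x + y - z) * c)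
        ((p : ℚ_[p]) ^ (2 * x - z) * d) ((p : ℚ_[p]) ^ (2 * y - z) * e) * tor p x y z := by
  have hp := p_ne_zero p
  rw [tor, diagG_mul_unip]
  congr 2 <;> congr 1 <;> simp [unif, zpow_sub₀ hp, zpow_add₀ hp, two_mul, div_eq_mul_inv]

theorem mat_tor (x y z : ℤ) : mat (tor p x y z) =
    !![(p : ℚ_[p]) ^ x, 0, 0, 0; 0, (p : ℚ_[p]) ^ y, 0, 0; 0, 0, (p : ℚ_[p]) ^ (z - y), 0;
      0, 0, 0, (p : ℚ_[p]) ^ (z - x)] := by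
  have hp := p_ne_zero p
  simp [tor, diagG, unif, zpow_sub₀ hp, div_eq_mul_inv]

theorem mat_unip {R : Type*} [CommRing R] (b c d e : R) : mat (unip b c d e) =
    !![1, b, c + b * e, d; 0, 1, e, c; 0, 0, 1, -b; 0, 0, 0, 1] := rfl

theorem sim_tor (x y z : ℤ) : sim (tor p x y z) = (p : ℚ_[p]) ^ z := by
  rw [tor, diagG, sim_ofMatrix]; simp [unif]

theorem tKl_eq : tKl p = tor p 2 1 2 := by
  apply GSp4.ext_mat
  rw [mat_tor]
  ext i j
  fin_cases i <;> fin_cases j <;>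
    simp [tKl, mat, Matrix.GeneralLinearGroup.mkOfDetNeZero, zpow_ofNat, Matrix.diagonal]

theorem norm_zpow_mul (n : ℤ) (x : ℚ_[p]) : ‖(p : ℚ_[p]) ^ n * x‖ = (p : ℝ) ^ (-n) * ‖x‖ := by
  rw [norm_mul, Padic.norm_p_zpow]

theorem zpow_mul_mem_ints {n : ℤ} (hn : 0 ≤ n) {x : ℚ_[p]} (hx : x ∈ ints p) :
    (p : ℚ_[p]) ^ n * x ∈ ints p := by
  lift n to ℕ using hn
  rw [zpow_natCast]
  exact mul_mem (pow_mem prime_mem_ints n) hx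

end Padic

end KlingenTrace

namespace KlingenTrace

/-! ### The Iwasawa decomposition -/

section Iwasawa

variable {p : ℕ} [Fact p.Prime]

theorem mat_mul_apply {R : Type*} [CommRing R] (g h : GSp4 R) (i j : Fin 4) :
    mat (g * h) i j = mat g i 0 * mat h 0 j + mat g i 1 * mat h 1 j + mat g i 2 * mat h 2 j
      + mat g i 3 * mat h 3 j := by
  rw [mat_mul, Matrix.mul_apply, Fin.sum_univ_four]

/-- The stabiliser of a line also stabilises its symplectic orthogonal, so the conditions on the
bottom row imply those on the first column. -/
theorem mem_klingenParabolic_of_row {F : Type*} [Field F] {g : GSp4 F} (h0 : mat g 3 0 = 0)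
    (h1 : mat g 3 1 = 0) (h2 : mat g 3 2 = 0) : g ∈ klingenParabolic F := by
  have hs := (sim_isUnit g).ne_zero
  have r01 := symplectic_relation g 0 1
  have r02 := symplectic_relation g 0 2
  have r12 := symplectic_relation g 1 2
  simp only [h0, h1, h2, J, of_apply, cons_val', cons_val_zero, cons_val_one, cons_val] at r01 r02 r12
  refine ⟨?_, ?_, h0, h1, h2⟩
  · apply (mul_eq_zero.mp _).resolve_right hs
    linear_combination (-mat g 1 0) * r12 - mat g 1 2 * r01 + mat g 1 1 * r02
  · apply (mul_eq_zero.mp _).resolve_right hs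
    linear_combination (-mat g 2 0) * r12 - mat g 2 2 * r01 + mat g 2 1 * r02

theorem norm_div_le_one {a b : ℚ_[p]} (h : ‖a‖ ≤ ‖b‖) : a / b ∈ ints p := by
  rw [mem_ints, norm_div]
  exact div_le_one_of_le₀ h (norm_nonneg _)

theorem exists_mul_mem_klingenParabolic_of_le {g : G p} (hg : mat g 3 3 ≠ 0)
    (h : ∀ j, ‖mat g 3 j‖ ≤ ‖mat g 3 3‖) : ∃ k ∈ K p, g * k ∈ klingenParabolic ℚ_[p] := by
  refine ⟨lowHeis (-(mat g 3 2 / mat g 3 3)) (-(mat g 3 1 / mat g 3 3)) (-(mat g 3 0 / mat g 3 3)),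
    lowHeis_mem_K ?_ ?_ ?_, mem_klingenParabolic_of_row ?_ ?_ ?_⟩
  any_goals exact neg_mem (norm_div_le_one (h _))
  all_goals
    rw [mat_mul_apply]
    simp [lowHeis]
    field_simp
    ring

/-- Pivoting: a Weyl element moves the largest entry of the bottom row to the corner, and an
integral lower Heisenberg element clears the rest of the row. -/
theorem exists_mul_mem_klingenParabolic (g : G p) : ∃ k ∈ K p, g * k ∈ klingenParabolic ℚ_[p] := by
  have key : ∀ s ∈ K p, (mat (g * s) 3 3 ≠ 0 ∧ ∀ j, ‖mat (g * s) 3 j‖ ≤ ‖mat (g * s) 3 3‖) →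
      ∃ k ∈ K p, g * k ∈ klingenParabolic ℚ_[p] := by
    rintro s hs ⟨h1, h2⟩
    obtain ⟨k, hk, hk'⟩ := exists_mul_mem_klingenParabolic_of_le h1 h2
    exact ⟨s * k, mul_mem hs hk, by rwa [← mul_assoc]⟩
  obtain ⟨j, hj⟩ := Finite.exists_max fun j => ‖mat g 3 j‖
  have hne : mat g 3 j ≠ 0 := by
    intro h0
    have hz : ∀ i, mat g 3 i = 0 := fun i => by
      have := hj i
      rw [h0, norm_zero] at this
      exact norm_le_zero_iff.mp this
    have h1 : mat (g * g⁻¹) 3 3 = 1 := by rw [mul_inv_cancel, mat_one]; simp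
    rw [mat_mul_apply] at h1
    simp [hz] at h1
  have hm : (midSL 0 1 (-1) 0 (by norm_num) : G p) ∈ K p :=
    midSL_mem_K _ (zero_mem _) (one_mem _) (neg_mem (one_mem _)) (zero_mem _)
  have ho : (outSL 0 1 (-1) 0 (by norm_num) : G p) ∈ K p :=
    outSL_mem_K _ (zero_mem _) (one_mem _) (neg_mem (one_mem _)) (zero_mem _)
  have h0 := hj 0; have h1 := hj 1; have h2 := hj 2; have h3 := hj 3
  fin_cases j
  · refine key _ ho ⟨?_, forall_fin_four.mpr ⟨?_, ?_, ?_, ?_⟩⟩ <;>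
      simp [mat_mul_apply, outSL] <;> assumption
  · refine key _ (mul_mem hm swapW_mem_K) ⟨?_, forall_fin_four.mpr ⟨?_, ?_, ?_, ?_⟩⟩ <;>
      simp [mat_mul_apply, midSL, swapW] <;> assumption
  · refine key _ swapW_mem_K ⟨?_, forall_fin_four.mpr ⟨?_, ?_, ?_, ?_⟩⟩ <;>
      simp [mat_mul_apply, swapW] <;> assumption
  · refine key _ (one_mem _) ⟨?_, forall_fin_four.mpr ⟨?_, ?_, ?_, ?_⟩⟩ <;> simp <;> assumption

theorem inBorel_of {R : Type*} [CommRing R] {g : GSp4 R} (h10 : mat g 1 0 = 0)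
    (h20 : mat g 2 0 = 0) (h21 : mat g 2 1 = 0) (h30 : mat g 3 0 = 0) (h31 : mat g 3 1 = 0)
    (h32 : mat g 3 2 = 0) : InBorel g := by
  simp only [InBorel, forall_fin_four]
  simp [h10, h20, h21, h30, h31, h32]

/-- The same pivoting, for the `SL₂` in the Klingen Levi subgroup. -/
theorem exists_mul_inBorel (g : G p) : ∃ k ∈ K p, InBorel (g * k) := by
  obtain ⟨k, hk, hg⟩ := exists_mul_mem_klingenParabolic g
  have key : ∀ s ∈ K p, s ∈ klingenParabolic ℚ_[p] → mat (g * k * s) 2 1 = 0 →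
      ∃ k ∈ K p, InBorel (g * k) := by
    intro s hs hs' h0
    refine ⟨k * s, mul_mem hk hs, ?_⟩
    obtain ⟨h1, h2, h3, h4, h5⟩ := mul_mem hg hs'
    rw [← mul_assoc]
    exact inBorel_of h1 h2 h0 h3 h4 h5
  by_cases hle : ‖mat (g * k) 2 1‖ ≤ ‖mat (g * k) 2 2‖
  · refine key (midSL 1 0 (-(mat (g * k) 2 1 / mat (g * k) 2 2)) 1 (by ring))
      (midSL_mem_K _ (one_mem _) (zero_mem _) (neg_mem (norm_div_le_one hle)) (one_mem _))
      (by simp [klingenParabolic, midSL]) ?_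
    by_cases h0 : mat (g * k) 2 2 = 0
    · rw [h0, norm_zero, norm_le_zero_iff] at hle
      rw [mat_mul_apply]; simp [midSL, hle, h0]
    · rw [mat_mul_apply]; simp [midSL]; field_simp; ring
  · push Not at hle
    have h0 : mat (g * k) 2 1 ≠ 0 := by
      intro h; rw [h, norm_zero] at hle; exact absurd hle (norm_nonneg _).not_gt
    refine key (midSL (mat (g * k) 2 2 / mat (g * k) 2 1) 1 (-1) 0 (by ring))
      (midSL_mem_K _ (norm_div_le_one hle.le) (one_mem _) (neg_mem (one_mem _)) (zero_mem _))
      (by simp [klingenParabolic, midSL]) ?_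
    rw [mat_mul_apply]; simp [midSL]; field_simp; ring

theorem exists_eq_unip_mul_diagG {F : Type*} [Field F] {g : GSp4 F} (hg : InBorel g) :
    ∃ b c d e : F, ∃ x y z : Fˣ, g = unip b c d e * diagG x y z := by
  have hs := (sim_isUnit g).ne_zero
  have h10 := hg 1 0 (by decide)
  have h20 := hg 2 0 (by decide)
  have h21 := hg 2 1 (by decide)
  have h30 := hg 3 0 (by decide)
  have h31 := hg 3 1 (by decide)
  have h32 := hg 3 2 (by decide)
  have r03 := symplectic_relation g 0 3
  have r12 := symplectic_relation g 1 2
  have r13 := symplectic_relation g 1 3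
  have r23 := symplectic_relation g 2 3
  simp only [h10, h20, h21, h30, h31, h32, J, of_apply, cons_val', cons_val_zero, cons_val_one,
    cons_val, mul_one, mul_zero, zero_mul, add_zero, zero_add, sub_zero] at r03 r12 r13 r23
  have n0 : mat g 0 0 ≠ 0 := fun h => hs (by rw [← r03, h, zero_mul])
  have n3 : mat g 3 3 ≠ 0 := fun h => hs (by rw [← r03, h, mul_zero])
  have n1 : mat g 1 1 ≠ 0 := fun h => hs (by rw [← r12, h, zero_mul])
  have n2 : mat g 2 2 ≠ 0 := fun h => hs (by rw [← r12, h, mul_zero])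
  refine ⟨-(mat g 2 3 / mat g 3 3), mat g 1 3 / mat g 3 3, mat g 0 3 / mat g 3 3,
    mat g 1 2 / mat g 2 2, Units.mk0 _ n0, Units.mk0 _ n1, Units.mk0 _ hs, GSp4.ext_mat ?_⟩
  ext i j
  rw [mat_mul_apply]
  fin_cases i <;> fin_cases j <;> simp [unip, diagG, h10, h20, h21, h30, h31, h32] <;>
    field_simp <;> grind

theorem diagG_eq_tor_mul (x y z : ℚ_[p]ˣ) : ∃ k ∈ K p,
    diagG x y z = tor p (x : ℚ_[p]).valuation (y : ℚ_[p]).valuation (z : ℚ_[p]).valuation * k := by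
  have hn : ∀ u : ℚ_[p]ˣ, ‖(((unif p) ^ (-(u : ℚ_[p]).valuation) * u : ℚ_[p]ˣ) : ℚ_[p])‖ = 1 := by
    intro u
    have hp : (0 : ℝ) < p := by exact_mod_cast (Fact.out : p.Prime).pos
    rw [Units.val_mul, Units.val_zpow_eq_zpow_val, unif, Units.val_mk0, norm_zpow_mul,
      Padic.norm_eq_zpow_neg_valuation u.ne_zero, ← zpow_add₀ hp.ne']
    simp
  refine ⟨_, diagG_mem_K (hn x) (hn y) (hn z), ?_⟩
  rw [tor, diagG_mul]
  simp

/-- The Iwasawa decomposition. -/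
theorem iwasawa (g : G p) : ∃ b c d e : ℚ_[p], ∃ x y z : ℤ, ∃ k ∈ K p,
    g = unip b c d e * tor p x y z * k := by
  obtain ⟨k, hk, hg⟩ := exists_mul_inBorel g
  obtain ⟨b, c, d, e, x, y, z, h⟩ := exists_eq_unip_mul_diagG hg
  obtain ⟨k', hk', h'⟩ := diagG_eq_tor_mul x y z
  refine ⟨b, c, d, e, (x : ℚ_[p]).valuation, (y : ℚ_[p]).valuation, (z : ℚ_[p]).valuation,
    k' * k⁻¹, mul_mem hk' (inv_mem hk), ?_⟩
  rw [← mul_assoc, mul_assoc (unip b c d e), ← h', ← h, mul_inv_cancel_right]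

end Iwasawa

end KlingenTrace

namespace KlingenTrace

/-! ### Residues, and cosets of `K` in upper triangular coordinates -/

section Cosets

variable {p : ℕ} [Fact p.Prime]

variable (p) in
/-- The maximal ideal of `ℤ_p`, as a subgroup of `ℚ_p`. -/
def maxId : AddSubgroup ℚ_[p] where
  carrier := {x | ‖x‖ < 1}
  zero_mem' := by simp
  add_mem' := fun {a b} ha hb =>
    (Padic.nonarchimedean a b).trans_lt (max_lt ha hb)
  neg_mem' := fun {a} ha => by simpa using ha

theorem mem_maxId {x : ℚ_[p]} : x ∈ maxId p ↔ ‖x‖ < 1 := Iff.rfl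

theorem mul_mem_maxId {x y : ℚ_[p]} (hx : x ∈ ints p) (hy : y ∈ maxId p) : x * y ∈ maxId p := by
  rw [mem_maxId, norm_mul]
  exact mul_lt_one_of_nonneg_of_lt_one_right hx (norm_nonneg _) hy

theorem mem_ints_of_mem_maxId {x : ℚ_[p]} (hx : x ∈ maxId p) : x ∈ ints p :=
  mem_ints.mpr (mem_maxId.mp hx).le

theorem prime_inv_mul_mem_ints {x : ℚ_[p]} : (p : ℚ_[p])⁻¹ * x ∈ ints p ↔ x ∈ maxId p := by
  have hp : (0 : ℝ) < p := by exact_mod_cast (Fact.out : p.Prime).pos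
  rw [mem_ints, mem_maxId, norm_mul, norm_inv, Padic.norm_p, inv_inv]
  constructor
  · intro h
    have h1 : (1 : ℝ) < p := by exact_mod_cast (Fact.out : p.Prime).one_lt
    by_contra! h2
    nlinarith
  · intro h
    have h2 := (Padic.norm_lt_pow_iff_norm_le_pow_sub_one x 0).mp (by simpa using h)
    rw [zero_sub, _root_.zpow_neg_one] at h2
    calc (p : ℝ) * ‖x‖ ≤ p * (p : ℝ)⁻¹ := by gcongr
      _ = 1 := mul_inv_cancel₀ hp.ne'

theorem prime_mem_maxId : (p : ℚ_[p]) ∈ maxId p := by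
  rw [← prime_inv_mul_mem_ints, inv_mul_cancel₀ (p_ne_zero p)]
  exact one_mem _

theorem maxId_prime {x y : ℚ_[p]} (hx : x ∈ ints p) (hy : y ∈ ints p) (h : x * y ∈ maxId p) :
    x ∈ maxId p ∨ y ∈ maxId p := by
  by_contra! h'
  simp only [mem_maxId, not_lt, mem_ints, norm_mul] at *
  nlinarith [le_antisymm hx h'.1, le_antisymm hy h'.2]

theorem mem_maxId_of_sq {x : ℚ_[p]} (hx : x ∈ ints p) (h : x * x ∈ maxId p) : x ∈ maxId p :=
  (maxId_prime hx hx h).elim id id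

theorem inv_mem_ints {x : ℚ_[p]} (h' : x ∉ maxId p) : x⁻¹ ∈ ints p := by
  rw [mem_maxId, not_lt] at h'
  rw [mem_ints, norm_inv]
  exact inv_le_one_of_one_le₀ h'

theorem one_notMem_maxId : (1 : ℚ_[p]) ∉ maxId p := by simp [mem_maxId]

theorem eq_of_residue {m : ℕ} {a b : Fin (p ^ m)}
    (h : ((p : ℚ_[p]) ^ m)⁻¹ * ((b : ℕ) - (a : ℕ)) ∈ ints p) : a = b := by
  have hp : (0 : ℝ) < p := by exact_mod_cast (Fact.out : p.Prime).pos
  rw [mem_ints, norm_mul, norm_inv, norm_pow, Padic.norm_p, inv_pow, inv_inv,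
    ← le_inv_mul_iff₀ (by positivity), mul_one] at h
  have h1 : ‖(((b : ℕ) - (a : ℕ) : ℤ) : ℚ_[p])‖ ≤ (p : ℝ) ^ (-m : ℤ) := by
    rw [_root_.zpow_neg, zpow_natCast]; push_cast; exact h
  rw [Padic.norm_int_le_pow_iff_dvd] at h1
  have h2 : ((a : ℕ) : ℤ) ≡ ((b : ℕ) : ℤ) [ZMOD ((p ^ m : ℕ) : ℤ)] :=
    Int.modEq_iff_dvd.mpr (by exact_mod_cast h1)
  have h3 := Int.natCast_modEq_iff.mp h2
  exact Fin.ext (Nat.ModEq.eq_of_lt_of_lt h3 a.2 b.2)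

theorem exists_residue (m : ℕ) {x : ℚ_[p]} (hx : x ∈ ints p) :
    ∃ a : Fin (p ^ m), ((p : ℚ_[p]) ^ m)⁻¹ * ((a : ℕ) - x) ∈ ints p := by
  let y : ℤ_[p] := ⟨x, hx⟩
  refine ⟨⟨y.appr m, y.appr_lt m⟩, ?_⟩
  obtain ⟨t, ht⟩ := Ideal.mem_span_singleton.mp (y.appr_spec m)
  have ht' : x - (y.appr m : ℕ) = (p : ℚ_[p]) ^ m * t := by
    have := congrArg (fun z : ℤ_[p] => (z : ℚ_[p])) ht
    simpa only [PadicInt.coe_sub, PadicInt.coe_natCast, PadicInt.coe_mul, PadicInt.coe_pow] using this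
  have hp := p_ne_zero p
  have : ((p : ℚ_[p]) ^ m)⁻¹ * ((y.appr m : ℕ) - x) = -t := by
    rw [← neg_sub, ht']; field_simp
  simp only [this]
  exact neg_mem t.2

theorem eq_of_residue_one {a b : Fin p}
    (h : (p : ℚ_[p])⁻¹ * ((b : ℕ) - (a : ℕ)) ∈ ints p) : a = b := by
  have := eq_of_residue (p := p) (m := 1) (a := a.cast (pow_one p).symm)
    (b := b.cast (pow_one p).symm) (by simpa using h)
  simpa [Fin.ext_iff] using this

theorem exists_residue_one {x : ℚ_[p]} (hx : x ∈ ints p) :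
    ∃ a : Fin p, (p : ℚ_[p])⁻¹ * ((a : ℕ) - x) ∈ ints p := by
  obtain ⟨a, ha⟩ := exists_residue 1 hx
  exact ⟨a.cast (pow_one p), by simpa using ha⟩

theorem tor_conj_unip (x y z : ℤ) (b c d e : ℚ_[p]) :
    (tor p x y z)⁻¹ * unip b c d e * tor p x y z =
      unip ((p : ℚ_[p]) ^ (y - x) * b) ((p : ℚ_[p]) ^ (z - x - y) * c)
        ((p : ℚ_[p]) ^ (z - 2 * x) * d) ((p : ℚ_[p]) ^ (z - 2 * y) * e) := by
  rw [tor_inv, tor_mul_unip, mul_assoc, tor_mul]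
  simp only [neg_add_cancel, tor_zero, mul_one]
  congr 3 <;> ring

/-- The similitude factor forces `z = 0`; then `p ^ x` and `p ^ (-x)` are both integral diagonal
entries, and likewise for `y`. -/
theorem unip_mul_tor_mem_K {b c d e : ℚ_[p]} {x y z : ℤ} (h : unip b c d e * tor p x y z ∈ K p) :
    x = 0 ∧ y = 0 ∧ z = 0 := by
  have hp : (1 : ℝ) < p := by exact_mod_cast (Fact.out : p.Prime).one_lt
  obtain ⟨h1, h2⟩ := mem_K_iff.mp h
  have hpos : ∀ n : ℤ, (p : ℚ_[p]) ^ n ∈ ints p → 0 ≤ n := by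
    intro n hn
    rw [mem_ints, Padic.norm_p_zpow] at hn
    have := (zpow_le_one_iff_right₀ hp).mp hn
    omega
  rw [sim_mul, sim_tor, unip, sim_ofMatrix, Units.val_one, one_mul, Padic.norm_p_zpow] at h2
  have hz : z = 0 := by
    have := (zpow_eq_one_iff_right₀ (by positivity) hp.ne').mp h2
    omega
  have e0 := hpos x (by simpa [mat_mul_apply, mat_tor, mat_unip] using h1 0 0)
  have e1 := hpos y (by simpa [mat_mul_apply, mat_tor, mat_unip] using h1 1 1)
  have e2 := hpos (z - y) (by simpa [mat_mul_apply, mat_tor, mat_unip] using h1 2 2)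
  have e3 := hpos (z - x) (by simpa [mat_mul_apply, mat_tor, mat_unip] using h1 3 3)
  omega

theorem unip_inv_mul_unip (b c d e b' c' d' e' : ℚ_[p]) :
    (unip b c d e)⁻¹ * unip b' c' d' e' =
      unip (b' - b) (c' - c + e * (b' - b))
        (d' - d - b * (c' - c + e * (b' - b)) + (c + b * e) * (b' - b)) (e' - e) := by
  rw [inv_mul_eq_iff_eq_mul, unip_mul]
  congr 1 <;> ring

theorem coset_eq_iff {b c d e b' c' d' e' : ℚ_[p]} {x y z : ℤ} :
    ((unip b c d e * tor p x y z : G p) : G p ⧸ K p) = (unip b' c' d' e' * tor p x y z : G p) ↔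
      (p : ℚ_[p]) ^ (y - x) * (b' - b) ∈ ints p ∧
      (p : ℚ_[p]) ^ (z - x - y) * (c' - c + e * (b' - b)) ∈ ints p ∧
      (p : ℚ_[p]) ^ (z - 2 * x) *
        (d' - d - b * (c' - c + e * (b' - b)) + (c + b * e) * (b' - b)) ∈ ints p ∧
      (p : ℚ_[p]) ^ (z - 2 * y) * (e' - e) ∈ ints p := by
  rw [QuotientGroup.eq, ← unip_mem_K_iff, ← tor_conj_unip, ← unip_inv_mul_unip]
  simp only [_root_.mul_inv_rev, mul_assoc]

theorem type_eq_of_coset_eq {b c d e b' c' d' e' : ℚ_[p]} {x y z x' y' z' : ℤ}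
    (h : ((unip b c d e * tor p x y z : G p) : G p ⧸ K p) =
      (unip b' c' d' e' * tor p x' y' z' : G p)) : x' = x ∧ y' = y ∧ z' = z := by
  rw [QuotientGroup.eq] at h
  have : (unip b c d e * tor p x y z)⁻¹ * (unip b' c' d' e' * tor p x' y' z') =
      (tor p x y z)⁻¹ * ((unip b c d e)⁻¹ * unip b' c' d' e') * tor p x y z *
        ((tor p x y z)⁻¹ * tor p x' y' z') := by group
  rw [this, unip_inv_mul_unip, tor_conj_unip, tor_inv, tor_mul] at h
  have := unip_mul_tor_mem_K h
  omega

theorem mem_orbit_K_iff {g h : G p} : ((h : G p) : G p ⧸ K p) ∈ MulAction.orbit (K p) (g : G p ⧸ K p) ↔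
    ∃ k₁ ∈ K p, ∃ k₂ ∈ K p, h = k₁ * g * k₂ := by
  constructor
  · rintro ⟨k, hk⟩
    have hk' : ((k.1 * g : G p) : G p ⧸ K p) = h := hk
    rw [QuotientGroup.eq] at hk'
    exact ⟨k, k.2, _, hk', by group⟩
  · rintro ⟨k₁, h1, k₂, h2, rfl⟩
    refine ⟨⟨k₁, h1⟩, ?_⟩
    change ((k₁ * g : G p) : G p ⧸ K p) = _
    rw [QuotientGroup.eq]
    simpa [mul_assoc] using h2

theorem mul_mem_ints {g h : G p} (hg : ∀ i j, mat g i j ∈ ints p) (hh : ∀ i j, mat h i j ∈ ints p)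
    (i j : Fin 4) : mat (g * h) i j ∈ ints p := by
  rw [mat_mul, Matrix.mul_apply]
  exact sum_mem fun l _ => mul_mem (hg _ _) (hh _ _)

theorem swapW_mul_tor (x y z : ℤ) : swapW * tor p x y z * swapW = tor p y x z := by
  apply GSp4.ext_mat
  rw [mat_mul, mat_mul, mat_tor, mat_tor]
  ext i j
  fin_cases i <;> fin_cases j <;> simp [swapW, Matrix.mul_apply, Fin.sum_univ_four]

variable (p) in
/-- The Weyl element of the Klingen Levi subgroup. -/
noncomputable def midW : G p := midSL 0 1 (-1) 0 (by norm_num)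

theorem midW_mem_K : midW p ∈ K p :=
  midSL_mem_K _ (zero_mem _) (one_mem _) (neg_mem (one_mem _)) (zero_mem _)

theorem midW_mul_tor (x y z : ℤ) : midW p * tor p x y z = tor p x (z - y) z * midW p := by
  apply GSp4.ext_mat
  rw [mat_mul, mat_mul, mat_tor, mat_tor]
  ext i j
  fin_cases i <;> fin_cases j <;> simp [midW, midSL, Matrix.mul_apply, Fin.sum_univ_four]

theorem midSL_mul_tor (x y z : ℤ) (t : ℚ_[p]) : midSL 1 0 t 1 (by ring) * tor p x y z =
    tor p x y z * midSL 1 0 ((p : ℚ_[p]) ^ (2 * y - z) * t) 1 (by ring) := by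
  have hp := p_ne_zero p
  apply GSp4.ext_mat
  rw [mat_mul, mat_mul, mat_tor]
  ext i j
  fin_cases i <;> fin_cases j <;> simp [midSL, Matrix.mul_apply, Fin.sum_univ_four]
  rw [← mul_assoc, ← zpow_add₀ hp, mul_comm]
  congr 2
  ring

/-- The Bruhat decomposition in `SL₂` with respect to the lower triangular Borel subgroup. For large
`s` the lower triangular factors are integral. -/
theorem unip_eq_midSL (s : ℚ_[p]ˣ) : unip 0 0 0 (s : ℚ_[p]) =
    midSL 1 0 ((s⁻¹ : ℚ_[p]ˣ) : ℚ_[p]) 1 (by ring) * diagG 1 s 1 * midW p * midSL 1 0 ((s⁻¹ : ℚ_[p]ˣ) : ℚ_[p]) 1 (by ring) := by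
  apply GSp4.ext_mat
  rw [mat_mul, mat_mul, mat_mul]
  ext i j
  fin_cases i <;> fin_cases j <;>
    simp [unip, midW, midSL, diagG, Matrix.mul_apply, Fin.sum_univ_four]

theorem swapW_mul_unip (s : ℚ_[p]) : swapW * unip 0 0 0 s * swapW = unip 0 0 s 0 := by
  apply GSp4.ext_mat
  rw [mat_mul, mat_mul]
  ext i j
  fin_cases i <;> fin_cases j <;> simp [swapW, unip, Matrix.mul_apply, Fin.sum_univ_four]

theorem swapW_mul_swapW : (swapW : G p) * swapW = 1 := by
  simpa [tor_zero] using swapW_mul_tor (p := p) 0 0 0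

theorem exists_norm_one_mul_zpow (s : ℚ_[p]ˣ) : ∃ u : ℚ_[p]ˣ, ‖(u : ℚ_[p])‖ = 1 ∧
    s = unif p ^ (s : ℚ_[p]).valuation * u := by
  refine ⟨unif p ^ (-(s : ℚ_[p]).valuation) * s, ?_, by simp⟩
  have hp : (0 : ℝ) < p := by exact_mod_cast (Fact.out : p.Prime).pos
  rw [Units.val_mul, Units.val_zpow_eq_zpow_val, unif, Units.val_mk0, norm_zpow_mul,
    Padic.norm_eq_zpow_neg_valuation s.ne_zero, ← zpow_add₀ hp.ne']
  simp

theorem midSL_mem_klingenParabolic {R : Type*} [CommRing R] (a b c d : R) (h) :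
    midSL a b c d h ∈ klingenParabolic R := by
  simp [klingenParabolic, midSL]

/-- A non-integral long root element times a torus element lies in the double coset of another
torus element. -/
theorem unip_mul_tor_eq (s : ℚ_[p]ˣ) (hs : ((s⁻¹ : ℚ_[p]ˣ) : ℚ_[p]) ∈ ints p) (x y z : ℤ)
    (hs' : (p : ℚ_[p]) ^ (2 * y - z) * ((s⁻¹ : ℚ_[p]ˣ) : ℚ_[p]) ∈ ints p) :
    ∃ m ∈ K p, m ∈ klingenParabolic ℚ_[p] ∧ ∃ k ∈ K p, unip 0 0 0 (s : ℚ_[p]) * tor p x y z =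
      m * tor p x (z - y + (s : ℚ_[p]).valuation) z * k := by
  have h0 := zero_mem (ints p)
  have h1 := one_mem (ints p)
  obtain ⟨u, hu, hsu⟩ := exists_norm_one_mul_zpow s
  refine ⟨midSL 1 0 _ 1 (by ring), midSL_mem_K _ h1 h0 hs h1, midSL_mem_klingenParabolic _ _ _ _ _,
    diagG 1 u 1 * midW p * midSL 1 0 _ 1 (by ring),
    mul_mem (mul_mem (diagG_mem_K (by simp) hu (by simp)) midW_mem_K)
      (midSL_mem_K _ h1 h0 hs' h1), ?_⟩
  have hd : diagG 1 s 1 * tor p x (z - y) z =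
      tor p x (z - y + (s : ℚ_[p]).valuation) z * diagG 1 u 1 := by
    conv_lhs => rw [hsu]
    have hc : unif p ^ (s : ℚ_[p]).valuation * u * unif p ^ (z - y) =
        unif p ^ (z - y) * unif p ^ (s : ℚ_[p]).valuation * u := by ac_rfl
    simp only [tor, diagG_mul, one_mul, mul_one, hc, _root_.zpow_add]
  rw [unip_eq_midSL, mul_assoc, midSL_mul_tor]
  simp only [mul_assoc]
  rw [← mul_assoc (midW p) (tor p x y z), midW_mul_tor]
  simp only [← mul_assoc]
  rw [mul_assoc _ (diagG 1 s 1), hd]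
  simp only [mul_assoc]

end Cosets

end KlingenTrace

namespace KlingenTrace

/-! ### The double coset of `diag(p, p, 1, 1)` -/

section HeckeOne

variable {p : ℕ} [Fact p.Prime]

theorem finsum_mem_eq_sum_of_bijective {ι X A : Type*} [Fintype ι] [AddCommMonoid A] {s : Set X}
    (r : ι → X) (hinj : Function.Injective r) (hmem : ∀ i, r i ∈ s) (hsurj : ∀ c ∈ s, ∃ i, r i = c)
    (f : X → A) : ∑ᶠ c ∈ s, f c = ∑ i, f (r i) := by
  have hs : s = Set.range r := by
    ext c
    exact ⟨hsurj c, by rintro ⟨i, rfl⟩; exact hmem i⟩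
  rw [hs, finsum_mem_range hinj, finsum_eq_sum_of_fintype]

/-- `h` lies in the double coset `K g K`. -/
def InDoubleCoset (g h : G p) : Prop := ∃ k₁ ∈ K p, ∃ k₂ ∈ K p, h = k₁ * g * k₂

namespace InDoubleCoset

variable {g h : G p}

theorem refl (g : G p) : InDoubleCoset g g := ⟨1, one_mem _, 1, one_mem _, by simp⟩

theorem mul_left {k : G p} (hk : k ∈ K p) (H : InDoubleCoset g h) : InDoubleCoset g (k * h) := by
  obtain ⟨k₁, h1, k₂, h2, rfl⟩ := H
  exact ⟨k * k₁, mul_mem hk h1, k₂, h2, by simp only [mul_assoc]⟩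

theorem mul_right {k : G p} (hk : k ∈ K p) (H : InDoubleCoset g h) : InDoubleCoset g (h * k) := by
  obtain ⟨k₁, h1, k₂, h2, rfl⟩ := H
  exact ⟨k₁, h1, k₂ * k, mul_mem h2 hk, by simp only [mul_assoc]⟩

theorem swap {x y z : ℤ} (H : InDoubleCoset g (tor p x y z)) : InDoubleCoset g (tor p y x z) := by
  rw [← swapW_mul_tor]
  exact (H.mul_left swapW_mem_K).mul_right swapW_mem_K

theorem mid {x y z : ℤ} (H : InDoubleCoset g (tor p x y z)) :
    InDoubleCoset g (tor p x (z - y) z) := by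
  rw [← mul_inv_cancel_right (tor p x (z - y) z) (midW p), ← midW_mul_tor]
  exact (H.mul_left midW_mem_K).mul_right (inv_mem midW_mem_K)

theorem mul_unip {b c d e : ℚ_[p]} (H : InDoubleCoset g h) (hb : b ∈ ints p) (hc : c ∈ ints p)
    (hd : d ∈ ints p) (he : e ∈ ints p) : InDoubleCoset g (unip b c d e * h) :=
  H.mul_left (unip_mem_K_iff.mpr ⟨hb, hc, hd, he⟩)

theorem mem_ints (H : InDoubleCoset g h) (hg : ∀ i j, mat g i j ∈ ints p) (i j : Fin 4) :
    mat h i j ∈ ints p := by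
  obtain ⟨k₁, h1, k₂, h2, rfl⟩ := H
  exact mul_mem_ints (mul_mem_ints (mem_K_iff.mp h1).1 hg) (mem_K_iff.mp h2).1 i j

theorem norm_sim (H : InDoubleCoset g h) : ‖sim h‖ = ‖sim g‖ := by
  obtain ⟨k₁, h1, k₂, h2, rfl⟩ := H
  rw [sim_mul, sim_mul, norm_mul, norm_mul, (mem_K_iff.mp h1).2, (mem_K_iff.mp h2).2, one_mul,
    mul_one]

theorem symm (H : InDoubleCoset g h) : InDoubleCoset h g := by
  obtain ⟨k₁, h1, k₂, h2, rfl⟩ := H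
  exact ⟨k₁⁻¹, inv_mem h1, k₂⁻¹, inv_mem h2, by group⟩

end InDoubleCoset

theorem mat_unip_mul_tor (b c d e : ℚ_[p]) (x y z : ℤ) : mat (unip b c d e * tor p x y z) =
    !![(p : ℚ_[p]) ^ x, b * (p : ℚ_[p]) ^ y, (c + b * e) * (p : ℚ_[p]) ^ (z - y),
        d * (p : ℚ_[p]) ^ (z - x);
      0, (p : ℚ_[p]) ^ y, e * (p : ℚ_[p]) ^ (z - y), c * (p : ℚ_[p]) ^ (z - x);
      0, 0, (p : ℚ_[p]) ^ (z - y), -b * (p : ℚ_[p]) ^ (z - x);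
      0, 0, 0, (p : ℚ_[p]) ^ (z - x)] := by
  rw [mat_mul, mat_tor, mat_unip]
  ext i j
  fin_cases i <;> fin_cases j <;> simp [Matrix.mul_apply, Fin.sum_univ_four]

theorem zpow_mem_ints_iff {n : ℤ} : (p : ℚ_[p]) ^ n ∈ ints p ↔ 0 ≤ n := by
  have hp : (1 : ℝ) < p := by exact_mod_cast (Fact.out : p.Prime).one_lt
  rw [mem_ints, Padic.norm_p_zpow, zpow_le_one_iff_right₀ hp]
  omega

theorem norm_zpow_eq_iff {m n : ℤ} : ‖(p : ℚ_[p]) ^ m‖ = ‖(p : ℚ_[p]) ^ n‖ ↔ m = n := by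
  have hp : (1 : ℝ) < p := by exact_mod_cast (Fact.out : p.Prime).one_lt
  rw [Padic.norm_p_zpow, Padic.norm_p_zpow, zpow_right_inj₀ (by positivity) hp.ne', neg_inj]

/-- Iwasawa representatives of the cosets in an integral double coset. -/
theorem exists_coset_rep {g : G p} {n : ℤ} (hg : ∀ i j, mat g i j ∈ ints p)
    (hs : ‖sim g‖ = ‖(p : ℚ_[p]) ^ n‖) (q : G p ⧸ K p)
    (hq : q ∈ MulAction.orbit (K p) (g : G p ⧸ K p)) :
    ∃ b c d e : ℚ_[p], ∃ x y : ℤ, q = (unip b c d e * tor p x y n : G p) ∧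
      InDoubleCoset g (unip b c d e * tor p x y n) ∧ 0 ≤ x ∧ x ≤ n ∧ 0 ≤ y ∧ y ≤ n ∧
      b * (p : ℚ_[p]) ^ y ∈ ints p ∧ (c + b * e) * (p : ℚ_[p]) ^ (n - y) ∈ ints p ∧
      d * (p : ℚ_[p]) ^ (n - x) ∈ ints p ∧ e * (p : ℚ_[p]) ^ (n - y) ∈ ints p ∧
      c * (p : ℚ_[p]) ^ (n - x) ∈ ints p ∧ b * (p : ℚ_[p]) ^ (n - x) ∈ ints p := by
  obtain ⟨h, rfl⟩ := QuotientGroup.mk_surjective q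
  obtain ⟨b, c, d, e, x, y, z, k, hk, rfl⟩ := iwasawa h
  have hc : ((unip b c d e * tor p x y z * k : G p) : G p ⧸ K p) =
      (unip b c d e * tor p x y z : G p) := by
    rw [eq_comm, QuotientGroup.eq, inv_mul_cancel_left]; exact hk
  rw [hc] at hq ⊢
  have H : InDoubleCoset g (unip b c d e * tor p x y z) := mem_orbit_K_iff.mp hq
  have hz : z = n := by
    rw [← norm_zpow_eq_iff (p := p), ← hs, ← H.norm_sim, sim_mul, sim_tor, unip, sim_ofMatrix,
      Units.val_one, one_mul]
  subst hz
  have hi := H.mem_ints hg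
  rw [mat_unip_mul_tor] at hi
  have h00 := hi 0 0
  have h11 := hi 1 1
  have h22 := hi 2 2
  have h33 := hi 3 3
  have h23 := neg_mem (hi 2 3)
  simp only [of_apply, cons_val', cons_val_zero, cons_val_one, cons_val, zpow_mem_ints_iff,
    neg_mul, neg_neg] at h00 h11 h22 h33 h23
  exact ⟨b, c, d, e, x, y, rfl, H, h00, by omega, h11, by omega, hi 0 1, hi 0 2, hi 0 3, hi 1 2,
    hi 1 3, h23⟩

theorem coset_eq_iff_111 {b c d e b' c' d' e' : ℚ_[p]} :
    ((unip b c d e * tor p 1 1 1 : G p) : G p ⧸ K p) = (unip b' c' d' e' * tor p 1 1 1 : G p) ↔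
      (b' - b) ∈ ints p ∧ (p : ℚ_[p])⁻¹ * (c' - c + e * (b' - b)) ∈ ints p ∧
      (p : ℚ_[p])⁻¹ * (d' - d - b * (c' - c + e * (b' - b)) + (c + b * e) * (b' - b)) ∈ ints p ∧
      (p : ℚ_[p])⁻¹ * (e' - e) ∈ ints p := by
  rw [coset_eq_iff]; norm_num [_root_.zpow_neg_one]

theorem coset_eq_iff_101 {b c d e b' c' d' e' : ℚ_[p]} :
    ((unip b c d e * tor p 1 0 1 : G p) : G p ⧸ K p) = (unip b' c' d' e' * tor p 1 0 1 : G p) ↔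
      (p : ℚ_[p])⁻¹ * (b' - b) ∈ ints p ∧ (c' - c + e * (b' - b)) ∈ ints p ∧
      (p : ℚ_[p])⁻¹ * (d' - d - b * (c' - c + e * (b' - b)) + (c + b * e) * (b' - b)) ∈ ints p ∧
      (p : ℚ_[p]) * (e' - e) ∈ ints p := by
  rw [coset_eq_iff]; norm_num [_root_.zpow_neg_one]

theorem coset_eq_iff_011 {b c d e b' c' d' e' : ℚ_[p]} :
    ((unip b c d e * tor p 0 1 1 : G p) : G p ⧸ K p) = (unip b' c' d' e' * tor p 0 1 1 : G p) ↔
      (p : ℚ_[p]) * (b' - b) ∈ ints p ∧ (c' - c + e * (b' - b)) ∈ ints p ∧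
      (p : ℚ_[p]) * (d' - d - b * (c' - c + e * (b' - b)) + (c + b * e) * (b' - b)) ∈ ints p ∧
      (p : ℚ_[p])⁻¹ * (e' - e) ∈ ints p := by
  rw [coset_eq_iff]; norm_num [_root_.zpow_neg_one]

theorem coset_eq_iff_001 {b c d e b' c' d' e' : ℚ_[p]} :
    ((unip b c d e * tor p 0 0 1 : G p) : G p ⧸ K p) = (unip b' c' d' e' * tor p 0 0 1 : G p) ↔
      (b' - b) ∈ ints p ∧ (p : ℚ_[p]) * (c' - c + e * (b' - b)) ∈ ints p ∧
      (p : ℚ_[p]) * (d' - d - b * (c' - c + e * (b' - b)) + (c + b * e) * (b' - b)) ∈ ints p ∧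
      (p : ℚ_[p]) * (e' - e) ∈ ints p := by
  rw [coset_eq_iff]; norm_num [_root_.zpow_neg_one]

theorem tor_mem_ints {x y z : ℤ} (hx : 0 ≤ x) (hy : 0 ≤ y) (hxz : x ≤ z) (hyz : y ≤ z)
    (i j : Fin 4) : mat (tor p x y z) i j ∈ ints p := by
  rw [mat_tor]
  revert i j
  have h0 := zero_mem (ints p)
  have h1 : (p : ℚ_[p]) ^ x ∈ ints p := zpow_mem_ints_iff.mpr hx
  have h2 : (p : ℚ_[p]) ^ y ∈ ints p := zpow_mem_ints_iff.mpr hy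
  have h3 : (p : ℚ_[p]) ^ (z - x) ∈ ints p := zpow_mem_ints_iff.mpr (by omega)
  have h4 : (p : ℚ_[p]) ^ (z - y) ∈ ints p := zpow_mem_ints_iff.mpr (by omega)
  simp only [forall_fin_four, of_apply, cons_val', cons_val_zero, cons_val_one, cons_val]
  exact ⟨⟨h1, h0, h0, h0⟩, ⟨h0, h2, h0, h0⟩, ⟨h0, h0, h4, h0⟩, ⟨h0, h0, h0, h3⟩⟩

variable (p) in
/-- Representatives of the cosets of `K` in `K diag(p, p, 1, 1) K`. -/
noncomputable def heckeRepOne :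
    (Fin p × Fin p × Fin p) ⊕ (Fin p × Fin p) ⊕ Fin p ⊕ Unit → G p :=
  Sum.elim (fun i => unip 0 ((i.1 : ℕ) : ℚ_[p]) ((i.2.1 : ℕ) : ℚ_[p]) ((i.2.2 : ℕ) : ℚ_[p]) * tor p 1 1 1) <|
    Sum.elim (fun i => unip ((i.1 : ℕ) : ℚ_[p]) 0 ((i.2 : ℕ) : ℚ_[p]) 0 * tor p 1 0 1) <|
    Sum.elim (fun i => unip 0 0 0 ((i : ℕ) : ℚ_[p]) * tor p 0 1 1) fun _ => unip 0 0 0 0 * tor p 0 0 1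

theorem heckeRepOne_injective : Function.Injective fun i => (heckeRepOne p i : G p ⧸ K p) := by
  rintro (⟨c, d, e⟩ | ⟨b, d⟩ | e | _) (⟨c', d', e'⟩ | ⟨b', d'⟩ | e' | _) h
  all_goals
    simp only [heckeRepOne, Sum.elim_inl, Sum.elim_inr] at h
    try (have := type_eq_of_coset_eq h; omega)
  · rw [coset_eq_iff_111] at h
    simp only [sub_self, mul_zero, add_zero, sub_zero, zero_mul] at h
    obtain ⟨-, h1, h2, h3⟩ := h
    rw [eq_of_residue_one h1, eq_of_residue_one h2, eq_of_residue_one h3]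
  · rw [coset_eq_iff_101] at h
    simp only [sub_self, mul_zero, add_zero, sub_zero, zero_mul] at h
    obtain ⟨h1, -, h2, -⟩ := h
    rw [eq_of_residue_one h1, eq_of_residue_one h2]
  · rw [coset_eq_iff_011] at h
    rw [eq_of_residue_one h.2.2.2]
  · rfl

theorem heckeRepOne_mem (i) : InDoubleCoset (tor p 1 1 1) (heckeRepOne p i) := by
  have h111 := InDoubleCoset.refl (tor p 1 1 1)
  have h101 : InDoubleCoset (tor p 1 1 1) (tor p 1 0 1) := by simpa using h111.mid
  have h001 : InDoubleCoset (tor p 1 1 1) (tor p 0 0 1) := by simpa using h101.swap.mid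
  have h0 := zero_mem (ints p)
  have hn : ∀ n : ℕ, (n : ℚ_[p]) ∈ ints p := natCast_mem _
  rcases i with ⟨c, d, e⟩ | ⟨b, d⟩ | e | _
  · exact h111.mul_unip h0 (hn _) (hn _) (hn _)
  · exact h101.mul_unip (hn _) h0 (hn _) h0
  · exact h101.swap.mul_unip h0 h0 h0 (hn _)
  · exact h001.mul_unip h0 h0 h0 h0

/-- Integrality leaves four torus types. In each, the coordinates whose coset condition carries a
factor `p⁻¹` are rounded to residues. The coordinate `d` comes last, since its condition involves
the residues already chosen. -/
theorem heckeRepOne_surjective (q : G p ⧸ K p)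
    (hq : q ∈ MulAction.orbit (K p) ((tor p 1 1 1 : G p) : G p ⧸ K p)) :
    ∃ i, (heckeRepOne p i : G p ⧸ K p) = q := by
  have hp := p_ne_zero p
  have hpi := prime_mem_ints (p := p)
  obtain ⟨b, c, d, e, x, y, rfl, -, hx0, hx1, hy0, hy1, h01, h02, h03, h12, h13, h23⟩ :=
    exists_coset_rep (n := 1) (tor_mem_ints (by decide) (by decide) (by decide) (by decide))
      (by rw [sim_tor]) q hq
  simp only [eq_comm (b := ((unip b c d e * tor p x y 1 : G p) : G p ⧸ K p))]
  interval_cases x <;> interval_cases y <;>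
    norm_num at h01 h02 h03 h12 h13 h23
  · refine ⟨.inr <| .inr <| .inr (), ?_⟩
    simp only [heckeRepOne, Sum.elim_inr]
    rw [coset_eq_iff_001]
    refine ⟨by simpa using h01, ?_, ?_, ?_⟩
    · rw [show (p : ℚ_[p]) * (0 - c + e * (0 - b)) = -((c + b * e) * p) by ring]
      exact neg_mem h02
    · rw [show (p : ℚ_[p]) * (0 - d - b * (0 - c + e * (0 - b)) + (c + b * e) * (0 - b)) =
        -(d * p) by ring]
      exact neg_mem h03
    · rw [show (p : ℚ_[p]) * (0 - e) = -(e * p) by ring]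
      exact neg_mem h12
  · obtain ⟨e', he'⟩ := exists_residue_one h12
    refine ⟨.inr <| .inr <| .inl e', ?_⟩
    simp only [heckeRepOne, Sum.elim_inr, Sum.elim_inl]
    rw [coset_eq_iff_011]
    refine ⟨?_, ?_, ?_, he'⟩
    · rw [show (p : ℚ_[p]) * (0 - b) = -(b * p) by ring]
      exact neg_mem h01
    · rw [show 0 - c + e * (0 - b) = -(c + b * e) by ring]
      exact neg_mem h02
    · rw [show (p : ℚ_[p]) * (0 - d - b * (0 - c + e * (0 - b)) + (c + b * e) * (0 - b)) =
        -(d * p) by ring]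
      exact neg_mem h03
  · obtain ⟨b', hb'⟩ := exists_residue_one h01
    have hγ : 0 - c + e * (b' - b) ∈ ints p := by
      rw [show 0 - c + e * ((b' : ℕ) - b) = -c + (e * p) * ((p : ℚ_[p])⁻¹ * ((b' : ℕ) - b)) by
        field_simp; ring]
      exact add_mem (neg_mem h13) (mul_mem h12 hb')
    have hδ : (c + b * e) * (b' - b) ∈ ints p := by
      rw [show (c + b * e) * ((b' : ℕ) - b) =
        ((c + b * e) * p) * ((p : ℚ_[p])⁻¹ * ((b' : ℕ) - b)) by field_simp]
      exact mul_mem h02 hb'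
    obtain ⟨d', hd'⟩ := exists_residue_one (sub_mem (add_mem h03 (mul_mem h01 hγ)) hδ)
    refine ⟨.inr <| .inl (b', d'), ?_⟩
    simp only [heckeRepOne, Sum.elim_inr, Sum.elim_inl]
    rw [coset_eq_iff_101]
    refine ⟨hb', hγ, ?_, ?_⟩
    · convert hd' using 1; ring
    · rw [show (p : ℚ_[p]) * (0 - e) = -(e * p) by ring]
      exact neg_mem h12
  · have hb : 0 - b ∈ ints p := by simpa using h23
    obtain ⟨c', hc'⟩ := exists_residue_one h02
    obtain ⟨e', he'⟩ := exists_residue_one h12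
    obtain ⟨d', hd'⟩ := exists_residue_one (sub_mem (add_mem h03 (mul_mem h23
      (add_mem (sub_mem (natCast_mem _ (c' : ℕ)) h13) (mul_mem h12 hb)))) (mul_mem h02 hb))
    refine ⟨.inl (c', d', e'), ?_⟩
    simp only [heckeRepOne, Sum.elim_inl]
    rw [coset_eq_iff_111]
    refine ⟨hb, ?_, ?_, he'⟩
    · convert hc' using 1; ring
    · convert hd' using 1; ring

theorem finsum_orbit_tor_111 {A : Type*} [AddCommMonoid A] (f : G p ⧸ K p → A) :
    ∑ᶠ q ∈ MulAction.orbit (K p) ((tor p 1 1 1 : G p) : G p ⧸ K p), f q =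
      ∑ i, f (heckeRepOne p i : G p ⧸ K p) :=
  finsum_mem_eq_sum_of_bijective _ heckeRepOne_injective
    (fun i => mem_orbit_K_iff.mpr (heckeRepOne_mem i)) heckeRepOne_surjective f

end HeckeOne

end KlingenTrace

namespace KlingenTrace

/-! ### The double coset of `diag(p², p, p, 1)` -/

section HeckeTwo

variable {p : ℕ} [Fact p.Prime]

/-- All `2 × 2` minors of `g` are divisible by `p`. -/
def RankLEOne (g : G p) : Prop :=
  ∀ i i' j j', mat g i j * mat g i' j' - mat g i j' * mat g i' j ∈ maxId p

theorem RankLEOne.mul_left {k g : G p} (hg : RankLEOne g) (hk : k ∈ K p) : RankLEOne (k * g) := by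
  intro i i' j j'
  have hi := (mem_K_iff.mp hk).1
  have : mat (k * g) i j * mat (k * g) i' j' - mat (k * g) i j' * mat (k * g) i' j =
      ∑ l, ∑ l', mat k i l * mat k i' l' *
        (mat g l j * mat g l' j' - mat g l j' * mat g l' j) := by
    simp only [mat_mul, Matrix.mul_apply, Finset.sum_mul_sum, ← Finset.sum_sub_distrib]
    refine Finset.sum_congr rfl fun l _ => Finset.sum_congr rfl fun l' _ => ?_
    ring
  rw [this]
  exact sum_mem fun l _ => sum_mem fun l' _ => mul_mem_maxId (mul_mem (hi _ _) (hi _ _)) (hg _ _ _ _)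

theorem RankLEOne.mul_right {k g : G p} (hg : RankLEOne g) (hk : k ∈ K p) :
    RankLEOne (g * k) := by
  intro i i' j j'
  have hi := (mem_K_iff.mp hk).1
  have : mat (g * k) i j * mat (g * k) i' j' - mat (g * k) i j' * mat (g * k) i' j =
      ∑ l, ∑ l', mat k l j * mat k l' j' *
        (mat g i l * mat g i' l' - mat g i l' * mat g i' l) := by
    simp only [mul_sub, Finset.sum_sub_distrib]
    rw [Finset.sum_comm (f := fun l l' => mat k l j * mat k l' j' * (mat g i l' * mat g i' l))]
    simp only [mat_mul, Matrix.mul_apply, Finset.sum_mul_sum, ← Finset.sum_sub_distrib]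
    refine Finset.sum_congr rfl fun l _ => Finset.sum_congr rfl fun l' _ => ?_
    ring
  rw [this]
  exact sum_mem fun l _ => sum_mem fun l' _ => mul_mem_maxId (mul_mem (hi _ _) (hi _ _)) (hg _ _ _ _)

/-- Modulo `p` only the corner entry `1` survives. This rank condition, with primitivity, singles
out the double coset among integral matrices of similitude `p²`. -/
theorem rankLEOne_tor_212 : RankLEOne (tor p 2 1 2) := by
  have h0 := zero_mem (maxId p)
  have h1 := prime_mem_maxId (p := p)
  have h2 : (p : ℚ_[p]) ^ 2 ∈ maxId p := by rw [pow_two]; exact mul_mem_maxId prime_mem_ints h1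
  have h3 : (p : ℚ_[p]) * (p : ℚ_[p]) ∈ maxId p := mul_mem_maxId prime_mem_ints h1
  have h4 : (p : ℚ_[p]) ^ 2 * (p : ℚ_[p]) ∈ maxId p :=
    mul_mem_maxId (mem_ints_of_mem_maxId h2) h1
  have h5 : (p : ℚ_[p]) * (p : ℚ_[p]) ^ 2 ∈ maxId p := mul_mem_maxId prime_mem_ints h2
  intro i i' j j'
  rw [mat_tor]
  revert i i' j j'
  simp only [forall_fin_four, of_apply, cons_val', cons_val_zero, cons_val_one, cons_val]
  norm_num [*]

theorem InDoubleCoset.rankLEOne {g h : G p} (H : InDoubleCoset g h) (hg : RankLEOne g) :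
    RankLEOne h := by
  obtain ⟨k₁, h1, k₂, h2, rfl⟩ := H
  exact (hg.mul_left h1).mul_right h2

theorem InDoubleCoset.mem_maxId {g h : G p} (H : InDoubleCoset g h)
    (hg : ∀ i j, mat g i j ∈ maxId p) (i j : Fin 4) : mat h i j ∈ maxId p := by
  obtain ⟨k₁, h1, k₂, h2, rfl⟩ := H
  rw [mat_mul, Matrix.mul_apply]
  refine sum_mem fun l _ => ?_
  rw [mul_comm]
  refine mul_mem_maxId ((mem_K_iff.mp h2).1 _ _) ?_
  rw [mat_mul, Matrix.mul_apply]
  exact sum_mem fun l _ => mul_mem_maxId ((mem_K_iff.mp h1).1 _ _) (hg _ _)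

theorem coset_eq_iff_212 {b c d e b' c' d' e' : ℚ_[p]} :
    ((unip b c d e * tor p 2 1 2 : G p) : G p ⧸ K p) = (unip b' c' d' e' * tor p 2 1 2 : G p) ↔
      (p : ℚ_[p])⁻¹ * (b' - b) ∈ ints p ∧ (p : ℚ_[p])⁻¹ * (c' - c + e * (b' - b)) ∈ ints p ∧
      ((p : ℚ_[p]) ^ 2)⁻¹ *
        (d' - d - b * (c' - c + e * (b' - b)) + (c + b * e) * (b' - b)) ∈ ints p ∧
      (e' - e) ∈ ints p := by
  rw [coset_eq_iff]
  norm_num [_root_.zpow_neg_one, _root_.zpow_neg]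

theorem coset_eq_iff_122 {b c d e b' c' d' e' : ℚ_[p]} :
    ((unip b c d e * tor p 1 2 2 : G p) : G p ⧸ K p) = (unip b' c' d' e' * tor p 1 2 2 : G p) ↔
      (p : ℚ_[p]) * (b' - b) ∈ ints p ∧ (p : ℚ_[p])⁻¹ * (c' - c + e * (b' - b)) ∈ ints p ∧
      (d' - d - b * (c' - c + e * (b' - b)) + (c + b * e) * (b' - b)) ∈ ints p ∧
      ((p : ℚ_[p]) ^ 2)⁻¹ * (e' - e) ∈ ints p := by
  rw [coset_eq_iff]
  norm_num [_root_.zpow_neg_one, _root_.zpow_neg]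

theorem coset_eq_iff_102 {b c d e b' c' d' e' : ℚ_[p]} :
    ((unip b c d e * tor p 1 0 2 : G p) : G p ⧸ K p) = (unip b' c' d' e' * tor p 1 0 2 : G p) ↔
      (p : ℚ_[p])⁻¹ * (b' - b) ∈ ints p ∧ (p : ℚ_[p]) * (c' - c + e * (b' - b)) ∈ ints p ∧
      (d' - d - b * (c' - c + e * (b' - b)) + (c + b * e) * (b' - b)) ∈ ints p ∧
      (p : ℚ_[p]) ^ 2 * (e' - e) ∈ ints p := by
  rw [coset_eq_iff]
  norm_num [_root_.zpow_neg_one, _root_.zpow_neg]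

theorem coset_eq_iff_012 {b c d e b' c' d' e' : ℚ_[p]} :
    ((unip b c d e * tor p 0 1 2 : G p) : G p ⧸ K p) = (unip b' c' d' e' * tor p 0 1 2 : G p) ↔
      (p : ℚ_[p]) * (b' - b) ∈ ints p ∧ (p : ℚ_[p]) * (c' - c + e * (b' - b)) ∈ ints p ∧
      (p : ℚ_[p]) ^ 2 *
        (d' - d - b * (c' - c + e * (b' - b)) + (c + b * e) * (b' - b)) ∈ ints p ∧
      (e' - e) ∈ ints p := by
  rw [coset_eq_iff]
  norm_num [_root_.zpow_neg_one, _root_.zpow_neg]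

theorem coset_eq_iff_112 {b c d e b' c' d' e' : ℚ_[p]} :
    ((unip b c d e * tor p 1 1 2 : G p) : G p ⧸ K p) = (unip b' c' d' e' * tor p 1 1 2 : G p) ↔
      (b' - b) ∈ ints p ∧ (c' - c + e * (b' - b)) ∈ ints p ∧
      (d' - d - b * (c' - c + e * (b' - b)) + (c + b * e) * (b' - b)) ∈ ints p ∧
      (e' - e) ∈ ints p := by
  rw [coset_eq_iff]
  norm_num

variable (p) in
/-- Nonzero residues modulo `p`. -/
abbrev NonzeroRes : Type := {c : Fin p // (c : ℕ) ≠ 0}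

variable (p) in
/-- Representatives of the cosets of `K` in `K diag(p², p, p, 1) K`. -/
noncomputable def heckeRepTwo :
    (Fin p × Fin p × Fin (p ^ 2)) ⊕ (Fin p × Fin (p ^ 2)) ⊕ Fin p ⊕ Unit ⊕ NonzeroRes p ⊕
      (Fin p × NonzeroRes p) → G p :=
  Sum.elim (fun i => unip ((i.1 : ℕ) : ℚ_[p]) ((i.2.1 : ℕ) : ℚ_[p]) ((i.2.2 : ℕ) : ℚ_[p]) 0
      * tor p 2 1 2) <|
    Sum.elim (fun i => unip 0 ((i.1 : ℕ) : ℚ_[p]) 0 ((i.2 : ℕ) : ℚ_[p]) * tor p 1 2 2) <|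
    Sum.elim (fun i => unip ((i : ℕ) : ℚ_[p]) 0 0 0 * tor p 1 0 2) <|
    Sum.elim (fun _ => unip 0 0 0 0 * tor p 0 1 2) <|
    Sum.elim (fun i => unip 0 0 ((p : ℚ_[p])⁻¹ * ((i.1 : ℕ) : ℚ_[p])) 0 * tor p 1 1 2)
      fun i => unip ((i.1 : ℕ) : ℚ_[p]) 0 0 ((p : ℚ_[p])⁻¹ * ((i.2.1 : ℕ) : ℚ_[p])) * tor p 1 1 2

theorem natCast_notMem_maxId (c : NonzeroRes p) : ((c.1 : ℕ) : ℚ_[p]) ∉ maxId p := by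
  intro h
  rw [← prime_inv_mul_mem_ints] at h
  have hpos : 0 < p := (Fact.out : p.Prime).pos
  have := eq_of_residue_one (p := p) (a := ⟨0, hpos⟩) (b := c.1) (by simpa using h)
  exact c.2 (by rw [← this])

theorem heckeRepTwo_injective : Function.Injective fun i => (heckeRepTwo p i : G p ⧸ K p) := by
  have hp := p_ne_zero p
  rintro (⟨b, c, d⟩ | ⟨c, e⟩ | b | _ | c | ⟨b, c⟩) (⟨b', c', d'⟩ | ⟨c', e'⟩ | b' | _ | c' | ⟨b', c'⟩) h
  all_goals
    simp only [heckeRepTwo, Sum.elim_inl, Sum.elim_inr] at h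
    try (have := type_eq_of_coset_eq h; omega)
  · rw [coset_eq_iff_212] at h
    simp only [mul_zero, add_zero, zero_mul] at h
    obtain ⟨h1, h2, h3, -⟩ := h
    obtain rfl := eq_of_residue_one h1
    obtain rfl := eq_of_residue_one h2
    simp only [sub_self, mul_zero, sub_zero, add_zero] at h3
    rw [eq_of_residue h3]
  · rw [coset_eq_iff_122] at h
    simp only [sub_self, mul_zero, add_zero] at h
    rw [eq_of_residue_one h.2.1, eq_of_residue h.2.2.2]
  · rw [coset_eq_iff_102] at h
    rw [eq_of_residue_one h.1]
  · rfl
  · rw [coset_eq_iff_112] at h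
    simp only [sub_self, mul_zero, add_zero, sub_zero, ← mul_sub] at h
    rw [Subtype.ext (eq_of_residue_one h.2.2.1)]
  · rw [coset_eq_iff_112] at h
    exfalso
    have := h.2.2.2
    rw [sub_zero, prime_inv_mul_mem_ints] at this
    exact natCast_notMem_maxId _ this
  · rw [coset_eq_iff_112] at h
    exfalso
    have := neg_mem h.2.2.2
    rw [neg_sub, sub_zero, prime_inv_mul_mem_ints] at this
    exact natCast_notMem_maxId _ this
  · rw [coset_eq_iff_112] at h
    obtain ⟨-, h2, -, h4⟩ := h
    rw [← mul_sub] at h4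
    obtain rfl := Subtype.ext (eq_of_residue_one h4)
    -- Here `(c / p)(b' - b)` is integral and `c` is a unit, so `p` divides `b' - b`.
    have h5 : (p : ℚ_[p])⁻¹ * ((b' : ℕ) - (b : ℕ)) ∈ ints p := by
      rw [sub_zero, zero_add] at h2
      rw [prime_inv_mul_mem_ints]
      rw [mul_assoc, prime_inv_mul_mem_ints] at h2
      refine (maxId_prime (natCast_mem _ _) (sub_mem (natCast_mem _ _) (natCast_mem _ _))
        h2).resolve_left (natCast_notMem_maxId _)
    rw [eq_of_residue_one h5]

theorem natCast_inv_mem_ints (c : NonzeroRes p) : (((c.1 : ℕ) : ℚ_[p]))⁻¹ ∈ ints p :=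
  inv_mem_ints (natCast_notMem_maxId c)

theorem norm_natCast_eq_one (c : NonzeroRes p) : ‖((c.1 : ℕ) : ℚ_[p])‖ = 1 :=
  le_antisymm (natCast_mem (ints p) _) (not_lt.mp (natCast_notMem_maxId c))

variable (p) in
/-- The unit `c / p` for a nonzero residue `c`. -/
noncomputable def resDiv (c : NonzeroRes p) : ℚ_[p]ˣ :=
  Units.mk0 ((p : ℚ_[p])⁻¹ * ((c.1 : ℕ) : ℚ_[p])) (mul_ne_zero (inv_ne_zero (p_ne_zero p)) (by
    intro h
    have := norm_natCast_eq_one c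
    rw [h, norm_zero] at this
    exact zero_ne_one this))

theorem resDiv_inv_mem_ints (c : NonzeroRes p) :
    (((resDiv p c)⁻¹ : ℚ_[p]ˣ) : ℚ_[p]) ∈ ints p := by
  rw [Units.val_inv_eq_inv_val, resDiv, Units.val_mk0, _root_.mul_inv_rev, inv_inv]
  exact mul_mem (natCast_inv_mem_ints c) prime_mem_ints

theorem valuation_resDiv (c : NonzeroRes p) : (resDiv p c : ℚ_[p]).valuation = -1 := by
  have h1 := norm_natCast_eq_one c
  have h2 : ‖(resDiv p c : ℚ_[p])‖ = p := by
    rw [resDiv, Units.val_mk0, norm_mul, h1, norm_inv, Padic.norm_p, inv_inv, mul_one]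
  rw [Padic.norm_eq_zpow_neg_valuation (resDiv p c).ne_zero] at h2
  have hp : (1 : ℝ) < p := by exact_mod_cast (Fact.out : p.Prime).one_lt
  have := zpow_right_injective₀ (by positivity) hp.ne' (h2.trans (zpow_one _).symm)
  omega

/-- The long root element `1 + (c / p) E₂₃` times a torus element. -/
theorem unip_resDiv_mul_tor (c : NonzeroRes p) {x y z : ℤ} (h : 0 ≤ 2 * y - z) :
    ∃ m ∈ K p, m ∈ klingenParabolic ℚ_[p] ∧ ∃ k ∈ K p,
      unip 0 0 0 ((p : ℚ_[p])⁻¹ * ((c.1 : ℕ) : ℚ_[p])) * tor p x y z =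
      m * tor p x (z - y - 1) z * k := by
  have := unip_mul_tor_eq (resDiv p c) (resDiv_inv_mem_ints c) x y z
    (zpow_mul_mem_ints h (resDiv_inv_mem_ints c))
  rw [valuation_resDiv] at this
  exact this

/-- The first four families come from Weyl conjugates of `diag(p², p, p, 1)`. In the two families
with a denominator, a Bruhat decomposition in the middle `SL₂` turns the type `(1, 1, 2)` into `(1,
0, 2)`. -/
theorem heckeRepTwo_mem (i) : InDoubleCoset (tor p 2 1 2) (heckeRepTwo p i) := by
  have h212 := InDoubleCoset.refl (tor p 2 1 2)
  have h102 : InDoubleCoset (tor p 2 1 2) (tor p 1 0 2) := by simpa using h212.swap.mid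
  have h0 := zero_mem (ints p)
  have hn : ∀ n : ℕ, (n : ℚ_[p]) ∈ ints p := natCast_mem _
  have key : ∀ c : NonzeroRes p, InDoubleCoset (tor p 2 1 2)
      (unip 0 0 0 ((p : ℚ_[p])⁻¹ * ((c.1 : ℕ) : ℚ_[p])) * tor p 1 1 2) := by
    intro c
    obtain ⟨m, hm, -, k, hk, h⟩ := unip_resDiv_mul_tor c (x := 1) (y := 1) (z := 2) (by norm_num)
    rw [h]
    norm_num
    exact (h102.mul_left hm).mul_right hk
  rcases i with ⟨b, c, d⟩ | ⟨c, e⟩ | b | _ | c | ⟨b, c⟩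
  · exact h212.mul_unip (hn _) (hn _) (hn _) h0
  · exact h212.swap.mul_unip h0 (hn _) h0 (hn _)
  · exact h102.mul_unip (hn _) h0 h0 h0
  · exact h102.swap.mul_unip h0 h0 h0 h0
  -- Conjugation by `swapW` exchanges the two long root subgroups.
  · have := ((key c).mul_left swapW_mem_K).mul_right swapW_mem_K
    have h1 : swapW * (unip 0 0 0 ((p : ℚ_[p])⁻¹ * ((c.1 : ℕ) : ℚ_[p])) * tor p 1 1 2) * swapW =
        heckeRepTwo p (.inr <| .inr <| .inr <| .inr <| .inl c) := by
      simp only [heckeRepTwo, Sum.elim_inr, Sum.elim_inl]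
      conv_rhs => rw [← swapW_mul_unip, ← swapW_mul_tor (p := p) 1 1 2]
      simp only [mul_assoc]
      rw [← mul_assoc (swapW : G p) swapW, swapW_mul_swapW, one_mul]
    rwa [h1] at this
  · have := (key c).mul_unip (hn b) h0 h0 h0
    rw [← mul_assoc, unip_mul] at this
    simpa [heckeRepTwo] using this

theorem mul_prime_mem_maxId {x : ℚ_[p]} : x * p ∈ maxId p ↔ x ∈ ints p := by
  rw [← prime_inv_mul_mem_ints, mul_comm x, inv_mul_cancel_left₀ (p_ne_zero p)]

/-- In type `(1, 1, 2)` the matrix is `p` times a unipotent one, and the minors force `b` to be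
integral. After removing `b`, what survives modulo `p` is the block with entries `C, D, E, C`, of
rank one: `C² ≡ DE`. If `E` is a unit, the coset is determined by `E` and `C / E`; otherwise `C ≡
0`, and by primitivity `D` is a unit, which determines the coset. -/
theorem exists_rep_112 {b c d e : ℚ_[p]} (hb : b * p ∈ ints p) (h02 : (c + b * e) * p ∈ ints p)
    (hd : d * p ∈ ints p) (he : e * p ∈ ints p)
    (k1 : b * p * (b * p) ∈ maxId p)
    (k2 : (c + b * e) * p * (c * p) - d * p * (e * p) ∈ maxId p)
    (hprim : ¬ (b * p ∈ maxId p ∧ (c + b * e) * p ∈ maxId p ∧ d * p ∈ maxId p ∧ e * p ∈ maxId p ∧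
      c * p ∈ maxId p)) :
    (∃ b' : Fin p, ∃ c' : NonzeroRes p, ((unip b c d e * tor p 1 1 2 : G p) : G p ⧸ K p) =
      (unip ((b' : ℕ) : ℚ_[p]) 0 0 ((p : ℚ_[p])⁻¹ * ((c'.1 : ℕ) : ℚ_[p])) * tor p 1 1 2 : G p)) ∨
    (∃ c' : NonzeroRes p, ((unip b c d e * tor p 1 1 2 : G p) : G p ⧸ K p) =
      (unip 0 0 ((p : ℚ_[p])⁻¹ * ((c'.1 : ℕ) : ℚ_[p])) 0 * tor p 1 1 2 : G p)) := by
  have hp := p_ne_zero p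
  have hbm := mem_maxId_of_sq hb k1
  have hbi := mul_prime_mem_maxId.mp hbm
  set C := (c + b * e) * p with hC
  set E := e * p with hE
  set D := d * p + C * b with hD
  have hDi : D ∈ ints p := add_mem hd (mul_mem h02 hbi)
  have hCD : C * C - D * E ∈ maxId p := by
    convert k2 using 1; rw [hC, hD, hE]; ring
  have nonzero : ∀ {a : Fin p} {X : ℚ_[p]}, X ∉ maxId p →
      (p : ℚ_[p])⁻¹ * ((a : ℕ) - X) ∈ ints p → (a : ℕ) ≠ 0 := by
    intro a X hX ha h0
    rw [h0, Nat.cast_zero, zero_sub, prime_inv_mul_mem_ints] at ha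
    exact hX (by simpa using neg_mem ha)
  have hbm' : ∀ {t}, (p : ℚ_[p])⁻¹ * t ∈ ints p ↔ t ∈ maxId p := prime_inv_mul_mem_ints
  by_cases hEm : E ∈ maxId p
  · right
    have hCm : C ∈ maxId p := by
      apply mem_maxId_of_sq h02
      have := add_mem hCD (mul_mem_maxId hDi hEm)
      simpa using this
    have hDm : D ∉ maxId p := by
      intro hDm
      refine hprim ⟨hbm, hCm, ?_, hEm, ?_⟩
      · rw [show d * p = D - b * C by rw [hD]; ring]
        exact sub_mem hDm (mul_mem_maxId hbi hCm)
      · rw [show c * p = C - b * E by rw [hC, hE]; ring]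
        exact sub_mem hCm (mul_mem_maxId hbi hEm)
    obtain ⟨c', hc'⟩ := exists_residue_one hDi
    refine ⟨⟨c', nonzero hDm hc'⟩, ?_⟩
    rw [coset_eq_iff_112]
    have hγ : 0 - c + e * (0 - b) ∈ ints p := by
      rw [show 0 - c + e * (0 - b) = (p : ℚ_[p])⁻¹ * (-C) by rw [hC]; field_simp; ring,
        prime_inv_mul_mem_ints]
      exact neg_mem hCm
    refine ⟨by simpa using hbi, hγ, ?_, ?_⟩
    · rw [show (p : ℚ_[p])⁻¹ * ((c' : ℕ) : ℚ_[p]) - d - b * (0 - c + e * (0 - b)) +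
        (c + b * e) * (0 - b) =
        (p : ℚ_[p])⁻¹ * ((c' : ℕ) - D) - b * (0 - c + e * (0 - b)) by
          rw [hD, hC]; field_simp; ring]
      exact sub_mem hc' (mul_mem hbi hγ)
    · rw [show 0 - e = (p : ℚ_[p])⁻¹ * (-E) by rw [hE]; field_simp; ring, prime_inv_mul_mem_ints]
      exact neg_mem hEm
  · left
    have hE0 : E ≠ 0 := fun h => hEm (h ▸ zero_mem _)
    obtain ⟨c', hc'⟩ := exists_residue_one he
    obtain ⟨b', hb'⟩ := exists_residue_one (mul_mem h02 (inv_mem_ints hEm))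
    refine ⟨b', ⟨c', nonzero hEm hc'⟩, ?_⟩
    rw [coset_eq_iff_112]
    have hEC : E * b' - C ∈ maxId p := by
      rw [show E * b' - C = E * (b' - C * E⁻¹) by field_simp]
      exact mul_mem_maxId he (prime_inv_mul_mem_ints.mp hb')
    have hγ : 0 - c + e * (b' - b) ∈ ints p := by
      rw [show 0 - c + e * ((b' : ℕ) - b) = (p : ℚ_[p])⁻¹ * (E * b' - C) by
        rw [hC, hE]; field_simp; ring, prime_inv_mul_mem_ints]
      exact hEC
    refine ⟨sub_mem (natCast_mem _ _) hbi, hγ, ?_, ?_⟩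
    · rw [show 0 - d - b * (0 - c + e * ((b' : ℕ) - b)) + (c + b * e) * ((b' : ℕ) - b) =
        (p : ℚ_[p])⁻¹ * (C * b' - D) - b * (0 - c + e * ((b' : ℕ) - b)) by
          rw [hD, hC]; field_simp; ring]
      refine sub_mem (prime_inv_mul_mem_ints.mpr ?_) (mul_mem hbi hγ)
      refine (maxId_prime he (sub_mem (mul_mem h02 (natCast_mem _ _)) hDi) ?_).resolve_left hEm
      rw [show E * (C * b' - D) = C * (E * b' - C) + (C * C - D * E) by ring]
      exact add_mem (mul_mem_maxId h02 hEC) hCD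
    · rw [show (p : ℚ_[p])⁻¹ * ((c' : ℕ) : ℚ_[p]) - e = (p : ℚ_[p])⁻¹ * ((c' : ℕ) - E) by
        rw [hE]; field_simp]
      exact hc'

theorem heckeRepTwo_surjective (q : G p ⧸ K p)
    (hq : q ∈ MulAction.orbit (K p) ((tor p 2 1 2 : G p) : G p ⧸ K p)) :
    ∃ i, (heckeRepTwo p i : G p ⧸ K p) = q := by
  have hp := p_ne_zero p
  have hpi := prime_mem_ints (p := p)
  obtain ⟨b, c, d, e, x, y, rfl, H, hx0, hx1, hy0, hy1, h01, h02, h03, h12, h13, h23⟩ :=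
    exists_coset_rep (n := 2) (tor_mem_ints (by decide) (by decide) (by decide) (by decide))
      (by rw [sim_tor]) q hq
  simp only [eq_comm (b := ((unip b c d e * tor p x y 2 : G p) : G p ⧸ K p))]
  have hr := H.rankLEOne rankLEOne_tor_212
  -- The entry `1` of `diag(p², p, p, 1)` rules out matrices divisible by `p`, such as those in
  -- `pK`.
  have hprim : ¬ ∀ i j, mat (unip b c d e * tor p x y 2) i j ∈ maxId p := by
    intro h
    have := H.symm.mem_maxId h 3 3
    rw [mat_tor] at this
    exact one_notMem_maxId (by simpa using this)
  have h1 := one_notMem_maxId (p := p)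
  rw [RankLEOne, mat_unip_mul_tor] at hr
  rw [mat_unip_mul_tor] at hprim
  have k0202 := hr 0 2 0 2
  have k0101 := hr 0 1 0 1
  have k1313 := hr 1 3 1 3
  have k2323 := hr 2 3 2 3
  have k1323 := hr 1 3 2 3
  have k0223 := hr 0 2 2 3
  have k0113 := hr 0 1 1 3
  have k0102 := hr 0 1 0 2
  have k0213 := hr 0 2 1 3
  have k0123 := hr 0 1 2 3
  clear hr hq H
  simp only [of_apply, cons_val', cons_val_zero, cons_val_one, cons_val] at k0202 k0101 k1313 k2323
  simp only [of_apply, cons_val', cons_val_zero, cons_val_one, cons_val] at k1323 k0223 k0113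
  simp only [of_apply, cons_val', cons_val_zero, cons_val_one, cons_val] at k0102 k0213 k0123
  interval_cases x <;> interval_cases y <;>
    norm_num at h01 h02 h03 h12 h13 h23 k0202 k0101 k1313 k2323 <;>
    norm_num at k1323 k0223 k0113 k0102 k0213 k0123
  -- In each of the types `(0, 0)`, `(0, 2)`, `(2, 0)`, `(2, 2)` for `(x, y)`, one of these
  -- principal minors equals `1`. Five types remain.
  all_goals try (first | exact absurd k0202 h1 | exact absurd k0101 h1 | exact absurd k1313 h1 |
      exact absurd k2323 h1)
  all_goals clear k0202 k0101 k1313 k2323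
  · refine ⟨.inr <| .inr <| .inr <| .inl (), ?_⟩
    simp only [heckeRepTwo, Sum.elim_inr, Sum.elim_inl]
    rw [coset_eq_iff_012]
    refine ⟨?_, ?_, ?_, ?_⟩
    · rw [show (p : ℚ_[p]) * (0 - b) = -(b * p) by ring]
      exact neg_mem h01
    · rw [show (p : ℚ_[p]) * (0 - c + e * (0 - b)) = -((c + b * e) * p) by ring]
      exact neg_mem h02
    · rw [show (p : ℚ_[p]) ^ 2 * (0 - d - b * (0 - c + e * (0 - b)) + (c + b * e) * (0 - b)) =
        -(d * (p : ℚ_[p]) ^ 2) by ring]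
      exact neg_mem h03
    · simpa using mul_prime_mem_maxId.mp k0102
  · obtain ⟨b', hb'⟩ := exists_residue_one h01
    refine ⟨.inr <| .inr <| .inl b', ?_⟩
    simp only [heckeRepTwo, Sum.elim_inr, Sum.elim_inl]
    rw [coset_eq_iff_102]
    refine ⟨hb', ?_, ?_, ?_⟩
    · rw [show (p : ℚ_[p]) * (0 - c + e * ((b' : ℕ) - b)) =
        -(c * p) + e * (p : ℚ_[p]) ^ 2 * ((p : ℚ_[p])⁻¹ * ((b' : ℕ) - b)) by field_simp; ring]
      exact add_mem (neg_mem h13) (mul_mem h12 hb')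
    · rw [show 0 - d - b * (0 - c + e * ((b' : ℕ) - b)) + (c + b * e) * ((b' : ℕ) - b) =
        (b * c - d) + c * p * ((p : ℚ_[p])⁻¹ * ((b' : ℕ) - b)) by field_simp; ring]
      refine add_mem (mul_prime_mem_maxId.mp ?_) (mul_mem h13 hb')
      convert k0113 using 1; ring
    · rw [show (p : ℚ_[p]) ^ 2 * (0 - e) = -(e * (p : ℚ_[p]) ^ 2) by ring]
      exact neg_mem h12
  · have hprim' : ¬ (b * p ∈ maxId p ∧ (c + b * e) * p ∈ maxId p ∧ d * p ∈ maxId p ∧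
        e * p ∈ maxId p ∧ c * p ∈ maxId p) := by
      rintro ⟨m1, m2, m3, m4, m5⟩
      apply hprim
      have m0 := zero_mem (maxId p)
      have m6 := prime_mem_maxId (p := p)
      have m7 := neg_mem m1
      rw [← neg_mul] at m7
      simp only [forall_fin_four, of_apply, cons_val', cons_val_zero, cons_val_one, cons_val]
      norm_num only [zpow_one]
      simp only [*, and_self]
    rcases exists_rep_112 h01 h02 h03 h12 k0213 k0123 hprim' with ⟨b', c', h⟩ | ⟨c', h⟩
    · exact ⟨.inr <| .inr <| .inr <| .inr <| .inr (b', c'), h⟩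
    · exact ⟨.inr <| .inr <| .inr <| .inr <| .inl c', h⟩
  · have hγ := h02
    have hδ : d + (c + b * e) * b ∈ ints p := by
      rw [← mul_prime_mem_maxId]
      convert neg_mem k0223 using 1; ring
    obtain ⟨c', hc'⟩ := exists_residue_one h02
    obtain ⟨e', he'⟩ := exists_residue 2 h12
    refine ⟨.inr <| .inl (c', e'), ?_⟩
    simp only [heckeRepTwo, Sum.elim_inr, Sum.elim_inl]
    rw [coset_eq_iff_122]
    refine ⟨?_, ?_, ?_, he'⟩
    · rw [show (p : ℚ_[p]) * (0 - b) = -(b * p) by ring]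
      exact neg_mem h23
    · convert hc' using 2; ring
    · rw [show 0 - d - b * ((c' : ℕ) - c + e * (0 - b)) + (c + b * e) * (0 - b) =
        -(d + (c + b * e) * b) - b * p * ((p : ℚ_[p])⁻¹ * ((c' : ℕ) - (c + b * e))) by
          field_simp; ring]
      exact sub_mem (neg_mem hδ) (mul_mem h23 hc')
  · have he := mul_prime_mem_maxId.mp k1323
    obtain ⟨b', hb'⟩ := exists_residue_one h23
    have hβ : (b' : ℕ) - b ∈ ints p := sub_mem (natCast_mem _ _) h23
    obtain ⟨c', hc'⟩ := exists_residue_one (sub_mem h13 (mul_mem he hβ))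
    obtain ⟨d', hd'⟩ := exists_residue 2 (sub_mem (add_mem h03 (mul_mem h23
      (add_mem (sub_mem (natCast_mem _ (c' : ℕ)) h13) (mul_mem he hβ))))
      (mul_mem (add_mem h13 (mul_mem h23 he)) hβ))
    refine ⟨.inl (b', c', d'), ?_⟩
    simp only [heckeRepTwo, Sum.elim_inl]
    rw [coset_eq_iff_212]
    refine ⟨hb', ?_, ?_, by simpa using he⟩
    · convert hc' using 2; ring
    · convert hd' using 2; ring

theorem finsum_orbit_tor_212 {A : Type*} [AddCommMonoid A] (f : G p ⧸ K p → A) :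
    ∑ᶠ q ∈ MulAction.orbit (K p) ((tor p 2 1 2 : G p) : G p ⧸ K p), f q =
      ∑ i, f (heckeRepTwo p i : G p ⧸ K p) :=
  finsum_mem_eq_sum_of_bijective _ heckeRepTwo_injective
    (fun i => mem_orbit_K_iff.mpr (heckeRepTwo_mem i)) heckeRepTwo_surjective f

end HeckeTwo

end KlingenTrace

namespace KlingenTrace

/-! ### Averages over finite orbits -/

section Average

variable {Γ V Y : Type*} [Group Γ] [AddCommGroup V] [Module ℂ V] [DistribMulAction Γ V]
  [SMulCommClass Γ ℂ V] [AddCommGroup Y] [Module ℂ Y]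

/-- The average of `v` over its orbit under `H`. -/
noncomputable def avg (H : Subgroup Γ) (v : V) : V :=
  (Nat.card (MulAction.orbit H v) : ℂ)⁻¹ • ∑ᶠ u : MulAction.orbit H v, (u : V)

/-- An average over an orbit may be computed on any finite transitive set mapping to it. -/
theorem avg_eq_of_transitive (H : Subgroup Γ) {X : Type*} [Finite X] [MulAction H X]
    [MulAction.IsPretransitive H X] (f : X → V) (hf : ∀ (h : H) x, f (h • x) = h • f x) (x₀ : X) :
    avg H (f x₀) = (Nat.card X : ℂ)⁻¹ • ∑ᶠ x, f x := by
  classical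
  have := Fintype.ofFinite X
  have himg : MulAction.orbit H (f x₀) = (Finset.univ.image f : Finset V) := by
    ext u
    simp only [Finset.coe_image, Finset.coe_univ, Set.image_univ, Set.mem_range,
      MulAction.mem_orbit_iff]
    constructor
    · rintro ⟨h, rfl⟩
      exact ⟨h • x₀, hf h x₀⟩
    · rintro ⟨x, rfl⟩
      obtain ⟨h, rfl⟩ := MulAction.exists_smul_eq H x₀ x
      exact ⟨h, (hf h x₀).symm⟩
  set n := (Finset.univ.filter fun x => f x = f x₀).card with hn
  -- By transitivity the group permutes the fibres of `f`, so they all have the same cardinality and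
  -- it cancels in the average.
  have hfib : ∀ u ∈ Finset.univ.image f, (Finset.univ.filter fun x => f x = u).card = n := by
    intro u hu
    obtain ⟨x, -, rfl⟩ := Finset.mem_image.mp hu
    obtain ⟨h, rfl⟩ := MulAction.exists_smul_eq H x₀ x
    symm
    refine Finset.card_bij (fun y _ => h • y) ?_ ?_ ?_
    · intro y hy
      simp only [Finset.mem_filter, Finset.mem_univ, true_and] at hy ⊢
      rw [hf, hf, hy]
    · intro y _ y' _ hyy
      exact smul_left_cancel h hyy
    · intro y hy
      refine ⟨h⁻¹ • y, ?_, smul_inv_smul h y⟩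
      simp only [Finset.mem_filter, Finset.mem_univ, true_and] at hy ⊢
      rw [hf, hy, hf, inv_smul_smul]
  have hpos : n ≠ 0 := by
    rw [hn]
    exact (Finset.card_pos.mpr ⟨x₀, by simp⟩).ne'
  have hcard : Fintype.card X = (Finset.univ.image f).card * n := by
    rw [← Finset.card_univ, Finset.card_eq_sum_card_image f, Finset.sum_congr rfl hfib,
      Finset.sum_const, smul_eq_mul]
  have hsum : ∑ x, f x = (n : ℂ) • ∑ u ∈ Finset.univ.image f, u := by
    rw [Finset.sum_comp (fun u => u) f, Finset.smul_sum]
    refine Finset.sum_congr rfl fun u hu => ?_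
    rw [hfib u hu, Nat.cast_smul_eq_nsmul]
  have h1 : ∑ᶠ u : MulAction.orbit H (f x₀), (u : V) = ∑ u ∈ Finset.univ.image f, u := by
    rw [finsum_set_coe_eq_finsum_mem (f := fun u : V => u), himg, finsum_mem_coe_finset]
  have h2 : Nat.card (MulAction.orbit H (f x₀)) = (Finset.univ.image f).card := by
    rw [himg, Nat.card_coe_set_eq, Set.ncard_coe_finset]
  rw [avg, h1, h2, finsum_eq_sum_of_fintype, hsum, smul_smul, Nat.card_eq_fintype_card, hcard,
    Nat.cast_mul, mul_inv, mul_assoc, inv_mul_cancel₀ (by exact_mod_cast hpos), mul_one]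

theorem finite_orbit_of_le {H H' : Subgroup Γ} (h : H ≤ H') {v : V}
    (hv : (MulAction.orbit H' v).Finite) : (MulAction.orbit H v).Finite := by
  refine hv.subset ?_
  rintro _ ⟨k, rfl⟩
  exact ⟨⟨k.1, h k.2⟩, rfl⟩

theorem avg_eq_of_orbit_eq {H H' : Subgroup Γ} {v v' : V}
    (h : MulAction.orbit H v = MulAction.orbit H' v') : avg H v = avg H' v' := by
  rw [avg, avg, h]

theorem avg_smul_mem {H : Subgroup Γ} {h : Γ} (hh : h ∈ H) (v : V) : avg H (h • v) = avg H v :=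
  avg_eq_of_orbit_eq (MulAction.orbit_smul (⟨h, hh⟩ : H) v)

/-- Values of linear maps on averages. -/
theorem map_avg_eq {H : Subgroup Γ} {v : V} (hv : (MulAction.orbit H v).Finite) (l : V →ₗ[ℂ] Y)
    {c : Y} (hl : ∀ h ∈ H, l (h • v) = c) : l (avg H v) = c := by
  have := hv.to_subtype
  have := Fintype.ofFinite (MulAction.orbit H v)
  have hne : Nonempty (MulAction.orbit H v) := ⟨⟨v, MulAction.mem_orbit_self v⟩⟩
  have hu : ∀ u : MulAction.orbit H v, l u = c := by
    rintro ⟨_, ⟨h, rfl⟩⟩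
    exact hl h h.2
  rw [avg, map_smul, finsum_eq_sum_of_fintype, map_sum, Finset.sum_congr rfl fun u _ => hu u,
    Finset.sum_const, Finset.card_univ, Nat.card_eq_fintype_card, ← Nat.cast_smul_eq_nsmul ℂ,
    smul_smul, inv_mul_cancel₀, one_smul]
  exact_mod_cast Fintype.card_ne_zero

theorem avg_eq_self {H : Subgroup Γ} {v : V} (hv : ∀ h ∈ H, h • v = v) : avg H v = v := by
  have ho : MulAction.orbit H v = {v} := by
    ext u
    constructor
    · rintro ⟨h, rfl⟩; exact hv h h.2
    · rintro rfl; exact MulAction.mem_orbit_self _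
  exact map_avg_eq (by rw [ho]; exact Set.finite_singleton v) LinearMap.id hv

theorem smul_avg {H : Subgroup Γ} (v : V) {h : Γ} (hh : h ∈ H) (hv : (MulAction.orbit H v).Finite) :
    h • avg H v = avg H v := by
  have := hv.to_subtype
  have := Fintype.ofFinite (MulAction.orbit H v)
  rw [avg, smul_comm, finsum_eq_sum_of_fintype, Finset.smul_sum]
  congr 1
  exact Fintype.sum_equiv (MulAction.toPerm (⟨h, hh⟩ : H)) _ _ fun u => rfl

/-- The orbits of `v`, `w` and `v + w` may differ in size; all three averages are computed on the
orbit of the pair `(v, w)`, which maps equivariantly onto each of them. -/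
theorem avg_add {H : Subgroup Γ} {v w : V} (hv : (MulAction.orbit H v).Finite)
    (hw : (MulAction.orbit H w).Finite) : avg H (v + w) = avg H v + avg H w := by
  have hvw : (MulAction.orbit H (v, w)).Finite := by
    refine (hv.prod hw).subset ?_
    rintro _ ⟨h, rfl⟩
    exact ⟨⟨h, rfl⟩, ⟨h, rfl⟩⟩
  have := hvw.to_subtype
  have := Fintype.ofFinite (MulAction.orbit H (v, w))
  let x₀ : MulAction.orbit H (v, w) := ⟨(v, w), MulAction.mem_orbit_self _⟩
  have h1 := avg_eq_of_transitive H (fun x : MulAction.orbit H (v, w) => x.1.1 + x.1.2)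
    (fun h x => (smul_add (h : Γ) x.1.1 x.1.2).symm) x₀
  have h2 := avg_eq_of_transitive H (fun x : MulAction.orbit H (v, w) => x.1.1)
    (fun h x => rfl) x₀
  have h3 := avg_eq_of_transitive H (fun x : MulAction.orbit H (v, w) => x.1.2)
    (fun h x => rfl) x₀
  simp only [finsum_eq_sum_of_fintype] at h1 h2 h3
  rw [h2, h3, ← smul_add, ← Finset.sum_add_distrib]
  exact h1

theorem avg_const_smul {H : Subgroup Γ} {v : V} (hv : (MulAction.orbit H v).Finite) (c : ℂ) :
    avg H (c • v) = c • avg H v := by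
  have := hv.to_subtype
  have := Fintype.ofFinite (MulAction.orbit H v)
  have h1 := avg_eq_of_transitive H (fun x : MulAction.orbit H v => c • x.1)
    (fun h x => (smul_comm (h : Γ) c x.1).symm) ⟨v, MulAction.mem_orbit_self _⟩
  rw [h1, finsum_eq_sum_of_fintype, ← Finset.smul_sum, avg, finsum_eq_sum_of_fintype,
    smul_smul, smul_smul, mul_comm]

/-- Averaging as a linear map, when all orbits are finite. -/
noncomputable def avgL (H : Subgroup Γ) (hfin : ∀ v : V, (MulAction.orbit H v).Finite) :
    V →ₗ[ℂ] V where
  toFun := avg H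
  map_add' v w := avg_add (hfin v) (hfin w)
  map_smul' c v := avg_const_smul (hfin v) c

theorem avg_mem {H : Subgroup Γ} (W : Submodule ℂ V) (hW : ∀ h ∈ H, ∀ w ∈ W, h • w ∈ W) {v : V}
    (hv : v ∈ W) : avg H v ∈ W := by
  refine W.smul_mem _ ?_
  refine finsum_induction (· ∈ W) W.zero_mem (fun _ _ => W.add_mem) ?_
  rintro ⟨_, ⟨h, rfl⟩⟩
  exact hW h h.2 v hv

end Average

/-! ### Functions with finite `K`-orbits, and double coset operators as averages -/

section Functions

variable (p : ℕ) [Fact p.Prime]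

theorem translate_translate {p : ℕ} [Fact p.Prime] (g h : G p) (w : G p → ℂ) :
    translate g (translate h w) = translate (g * h) w := by
  funext x; simp [translate, mul_assoc]

/-- The functions all of whose translates have finite `K`-orbit. -/
def finFns : Submodule ℂ (G p → ℂ) where
  carrier := {v | ∀ g : G p, (Set.range fun k : K p => translate ((k : G p) * g) v).Finite}
  zero_mem' := fun g => (Set.finite_singleton 0).subset (by rintro _ ⟨k, rfl⟩; rfl)
  add_mem' := fun {v w} hv hw g =>
    ((hv g).image2 (· + ·) (hw g)).subset (by rintro _ ⟨k, rfl⟩; exact ⟨_, ⟨k, rfl⟩, _, ⟨k, rfl⟩, rfl⟩)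
  smul_mem' := fun c v hv g =>
    ((hv g).image (c • ·)).subset (by rintro _ ⟨k, rfl⟩; exact ⟨_, ⟨k, rfl⟩, rfl⟩)

variable {p}

theorem translate_mem_finFns {v : G p → ℂ} (hv : v ∈ finFns p) (g : G p) :
    translate g v ∈ finFns p := by
  intro h
  simp only [translate_translate, mul_assoc]
  exact hv (h * g)

noncomputable instance : DistribMulAction (G p) (finFns p) where
  smul g v := ⟨translate g v.1, translate_mem_finFns v.2 g⟩
  one_smul v := Subtype.ext (funext fun x => congrArg v.1 (mul_one x))
  mul_smul g h v := Subtype.ext (translate_translate g h v.1).symm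
  smul_zero g := rfl
  smul_add g v w := rfl

instance : SMulCommClass (G p) ℂ (finFns p) where
  smul_comm _ _ _ := rfl

theorem finite_orbit_finFns (v : finFns p) : (MulAction.orbit (K p) v).Finite := by
  refine Set.Finite.of_finite_image (f := Subtype.val) ?_ Subtype.val_injective.injOn
  refine (v.2 1).subset ?_
  rintro _ ⟨_, ⟨k, rfl⟩, rfl⟩
  exact ⟨k, by simp only [mul_one]; rfl⟩

theorem isInvariant_iff {H : Subgroup (G p)} {v : finFns p} :
    IsInvariant H (v : G p → ℂ) ↔ ∀ h ∈ H, h • v = v :=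
  forall₂_congr fun _ _ => by rw [Subtype.ext_iff]; rfl

theorem smul_eq_of_coset_eq {H : Subgroup (G p)} {v : finFns p} (hv : ∀ h ∈ H, h • v = v)
    {g g' : G p} (h : (g : G p ⧸ H) = g') : g • v = g' • v := by
  rw [QuotientGroup.eq] at h
  have h1 := congrArg (g • ·) (hv _ h)
  simp only [← mul_smul, mul_inv_cancel_left] at h1
  exact h1.symm

/-- Double coset operators in terms of averages. -/
theorem doubleCosetOp_eq_avg {H H' : Subgroup (G p)} {v : finFns p} (hv : ∀ h ∈ H', h • v = v)
    (g : G p) (hfin : (MulAction.orbit H (g : G p ⧸ H')).Finite) :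
    doubleCosetOp H H' g v =
      (Nat.card (MulAction.orbit H (g : G p ⧸ H')) : ℂ) • (avg H (g • v) : finFns p) := by
  have := hfin.to_subtype
  have := Fintype.ofFinite (MulAction.orbit H (g : G p ⧸ H'))
  have hne : Nonempty (MulAction.orbit H (g : G p ⧸ H')) := ⟨⟨g, MulAction.mem_orbit_self _⟩⟩
  let f : MulAction.orbit H (g : G p ⧸ H') → finFns p := fun c => (Quotient.out c.1) • v
  have hout : ∀ c : G p ⧸ H', ((Quotient.out c : G p) : G p ⧸ H') = c := fun c => Quotient.out_eq' c
  have h1 := avg_eq_of_transitive H f (by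
    intro h c
    change Quotient.out ((h : G p) • c.1) • v = (h : G p) • (Quotient.out c.1) • v
    rw [← mul_smul]
    refine smul_eq_of_coset_eq hv ?_
    rw [hout]
    conv_lhs => rw [← hout c.1]
    rfl) ⟨g, MulAction.mem_orbit_self _⟩
  have h2 : f ⟨g, MulAction.mem_orbit_self _⟩ = g • v := smul_eq_of_coset_eq hv (hout _)
  rw [h2] at h1
  rw [h1, finsum_eq_sum_of_fintype, Submodule.coe_smul, smul_smul, mul_inv_cancel₀
    (by rw [Nat.card_eq_fintype_card]; exact_mod_cast Fintype.card_ne_zero), one_smul]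
  funext x
  rw [doubleCosetOp, ← finsum_set_coe_eq_finsum_mem
    (f := fun c : G p ⧸ H' => translate (Quotient.out c) (v : G p → ℂ) x), finsum_eq_sum_of_fintype,
    AddSubmonoidClass.coe_finsetSum, Finset.sum_apply]
  rfl

/-- The double coset operator of a `K`-invariant function as a sum over representatives. -/
theorem doubleCosetOp_K_eq_sum {ι : Type*} [Fintype ι] {g : G p} (r : ι → G p)
    (hr : ∀ f : G p ⧸ K p → ℂ, ∑ᶠ q ∈ MulAction.orbit (K p) (g : G p ⧸ K p), f q =
      ∑ i, f (r i : G p ⧸ K p)) {w : G p → ℂ} (hw : IsInvariant (K p) w) (x : G p) :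
    doubleCosetOp (K p) (K p) g w x = ∑ i, w (x * r i) := by
  rw [doubleCosetOp, hr]
  refine Finset.sum_congr rfl fun i _ => ?_
  have hout : ((Quotient.out (r i : G p ⧸ K p) : G p) : G p ⧸ K p) = r i := Quotient.out_eq' _
  rw [eq_comm, QuotientGroup.eq] at hout
  have h1 := congrFun (hw _ hout) (x * r i)
  simp only [translate, mul_assoc, mul_inv_cancel_left] at h1 ⊢
  exact h1

end Functions

end KlingenTrace

namespace KlingenTrace

/-! ### Finiteness of `K`-orbits of translates -/

section Finiteness

variable {p : ℕ} [Fact p.Prime]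

/-- If `p ^ N` exceeds all products of an entry of `g⁻¹` with an entry of `g`, and `k ≡ 1` modulo `p
^ N`, then `g⁻¹ k g = 1 + g⁻¹ (k - 1) g` is integral. -/
theorem exists_conj_mem_K (g : G p) : ∃ N : ℕ, ∀ κ : GSp4 ℤ_[p],
    GSp4.map (PadicInt.toZModPow (p := p) N) κ = 1 →
      g⁻¹ * GSp4.map (algebraMap ℤ_[p] ℚ_[p]) κ * g ∈ K p := by
  have hp1 : (1 : ℝ) < p := by exact_mod_cast (Fact.out : p.Prime).one_lt
  obtain ⟨m, hm⟩ := Finite.exists_max fun i : (Fin 4 × Fin 4) × (Fin 4 × Fin 4) =>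
    ‖mat g⁻¹ i.1.1 i.1.2 * mat g i.2.1 i.2.2‖
  obtain ⟨N, hN⟩ := pow_unbounded_of_one_lt ‖mat g⁻¹ m.1.1 m.1.2 * mat g m.2.1 m.2.2‖ hp1
  refine ⟨N, fun κ hκ => ?_⟩
  set k := GSp4.map (algebraMap ℤ_[p] ℚ_[p]) κ with hk
  have hkK : k ∈ K p := ⟨κ, rfl⟩
  have hsmall : ∀ a b, ‖(mat k - 1) a b‖ ≤ (p : ℝ) ^ (-N : ℤ) := by
    intro a b
    have h1 := congrArg (fun h => mat h a b) hκ
    simp only [mat_map, Matrix.map_apply, mat_one] at h1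
    have h2 : PadicInt.toZModPow (p := p) N (mat κ a b - (1 : Matrix (Fin 4) (Fin 4) ℤ_[p]) a b)
        = 0 := by
      rw [map_sub, h1, sub_eq_zero]
      by_cases hab : a = b <;> simp [hab, Matrix.one_apply]
    rw [← RingHom.mem_ker, PadicInt.ker_toZModPow, ← PadicInt.norm_le_pow_iff_mem_span_pow] at h2
    have h3 : (mat k - 1) a b =
        ((mat κ a b - (1 : Matrix (Fin 4) (Fin 4) ℤ_[p]) a b : ℤ_[p]) : ℚ_[p]) := by
      rw [PadicInt.coe_sub, Matrix.sub_apply]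
      by_cases hab : a = b <;> simp [hab, Matrix.one_apply] <;> rfl
    rw [h3]; exact h2
  refine mem_K_iff.mpr ⟨fun i j => ?_, ?_⟩
  · have hdec : mat (g⁻¹ * k * g) = mat g⁻¹ * (mat k - 1) * mat g + 1 := by
      have h1 : mat g⁻¹ * mat g = 1 := by rw [← mat_mul, inv_mul_cancel, mat_one]
      rw [mat_mul, mat_mul, Matrix.mul_sub, Matrix.sub_mul, Matrix.mul_one, h1, sub_add_cancel]
    rw [hdec, Matrix.add_apply]
    refine add_mem ?_ (by by_cases hij : i = j <;> simp [Matrix.one_apply, hij])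
    rw [Matrix.mul_apply]
    refine sum_mem fun b _ => ?_
    rw [Matrix.mul_apply, Finset.sum_mul]
    refine sum_mem fun a _ => ?_
    rw [mem_ints, mul_right_comm, norm_mul]
    calc ‖mat g⁻¹ i a * mat g b j‖ * ‖(mat k - 1) a b‖
        ≤ (p : ℝ) ^ N * (p : ℝ) ^ (-N : ℤ) := by
          gcongr
          · exact (hm ((i, a), (b, j))).trans hN.le
          · exact hsmall a b
      _ = 1 := by
          rw [_root_.zpow_neg, zpow_natCast, mul_inv_cancel₀ (by positivity)]
  · rw [sim_mul, sim_mul, mul_right_comm, ← sim_mul, inv_mul_cancel, norm_mul,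
      (mem_K_iff.mp hkK).2, (mem_K_iff.mp (one_mem (K p))).2, one_mul]

/-- `K`-invariant functions have finite `K`-orbits, as do all their translates. -/
theorem mem_finFns_of_isInvariant {w : G p → ℂ} (hw : IsInvariant (K p) w) : w ∈ finFns p := by
  intro g
  obtain ⟨N, hN⟩ := exists_conj_mem_K g
  have : NeZero (p ^ N) := ⟨pow_ne_zero _ (Fact.out : p.Prime).ne_zero⟩
  classical
  -- The translate of `w` by `κ g` depends only on `κ` modulo `p ^ N`, so one lift of each liftable
  -- class in this finite group suffices.
  let F : GSp4 (ZMod (p ^ N)) → G p → ℂ := fun c =>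
    if h : ∃ κ, GSp4.map (PadicInt.toZModPow (p := p) N) κ = c then
      translate (GSp4.map (algebraMap ℤ_[p] ℚ_[p]) h.choose * g) w else 0
  refine (Set.finite_range F).subset ?_
  rintro _ ⟨⟨_, κ, rfl⟩, rfl⟩
  have hex : ∃ κ', GSp4.map (PadicInt.toZModPow (p := p) N) κ' =
      GSp4.map (PadicInt.toZModPow (p := p) N) κ := ⟨κ, rfl⟩
  refine ⟨GSp4.map (PadicInt.toZModPow (p := p) N) κ, ?_⟩
  simp only [F, dif_pos hex]
  have h1 := hN (hex.choose⁻¹ * κ) (by rw [map_mul, map_inv, hex.choose_spec, inv_mul_cancel])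
  have h2 := congrArg (translate (GSp4.map (algebraMap ℤ_[p] ℚ_[p]) hex.choose * g)) (hw _ h1)
  rw [translate_translate] at h2
  rw [← h2, map_mul, map_inv]
  congr 1
  group

end Finiteness

/-! ### The Klingen parahoric, and `U_{2,Kl}` as a `Q`-average -/

section KlingenStructure

variable {p : ℕ} [Fact p.Prime]

variable (p) in
/-- The integral points of the Klingen parabolic subgroup. -/
noncomputable def Q : Subgroup (G p) := K p ⊓ klingenParabolic ℚ_[p]

theorem Q_le_K : Q p ≤ K p := inf_le_left

theorem Q_le_Kl : Q p ≤ Kl p := by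
  rintro g ⟨h1, h2, h3, h4, h5, h6⟩
  rw [mem_Kl_iff, h2, h3, h4, h5, h6]
  simpa using h1

theorem unip_mem_klingenParabolic {R : Type*} [CommRing R] (b c d e : R) :
    unip b c d e ∈ klingenParabolic R := by
  simp [klingenParabolic, unip]

theorem tor_mem_klingenParabolic (x y z : ℤ) : tor p x y z ∈ klingenParabolic ℚ_[p] := by
  refine ⟨?_, ?_, ?_, ?_, ?_⟩ <;> rw [mat_tor] <;> simp

theorem unip_mem_Q {b c d e : ℚ_[p]} (hb : b ∈ ints p) (hc : c ∈ ints p) (hd : d ∈ ints p)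
    (he : e ∈ ints p) : unip b c d e ∈ Q p :=
  ⟨unip_mem_K_iff.mpr ⟨hb, hc, hd, he⟩, unip_mem_klingenParabolic b c d e⟩

theorem midW_mem_Q : midW p ∈ Q p := ⟨midW_mem_K, midSL_mem_klingenParabolic _ _ _ _ _⟩

theorem mat_tor_eq_diagonal (x y z : ℤ) :
    mat (tor p x y z) = diagonal fun i => (p : ℚ_[p]) ^ (![x, y, z - y, z - x] i) := by
  rw [mat_tor]
  ext i j
  fin_cases i <;> fin_cases j <;> simp [Matrix.diagonal]

theorem mat_tor_conj (x y z : ℤ) (g : G p) (i j : Fin 4) :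
    mat (tor p x y z * g * (tor p x y z)⁻¹) i j =
      (p : ℚ_[p]) ^ (![x, y, z - y, z - x] i - ![x, y, z - y, z - x] j) * mat g i j := by
  have h : ![-x, -y, -z - -y, -z - -x] j = -(![x, y, z - y, z - x] j) := by
    fin_cases j <;> simp <;> ring
  rw [tor_inv, mat_mul, mat_mul, mat_tor_eq_diagonal, mat_tor_eq_diagonal, mul_diagonal,
    diagonal_mul, h, mul_right_comm, ← zpow_add₀ (p_ne_zero p), ← sub_eq_add_neg]

/-- Conjugation by `t` multiplies entries above the block diagonal by positive powers of `p`; the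
entries it would divide by `p` vanish on the Klingen parabolic. -/
theorem tor_conj_mem_Q {q : G p} (hq : q ∈ Q p) : tor p 2 1 2 * q * (tor p 2 1 2)⁻¹ ∈ Q p := by
  have hi := (mem_K_iff.mp hq.1).1
  have hs := (mem_K_iff.mp hq.1).2
  have hmem : tor p 2 1 2 * q * (tor p 2 1 2)⁻¹ ∈ klingenParabolic ℚ_[p] :=
    mul_mem (mul_mem (tor_mem_klingenParabolic _ _ _) hq.2) (inv_mem (tor_mem_klingenParabolic _ _ _))
  refine ⟨mem_K_iff.mpr ⟨?_, ?_⟩, hmem⟩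
  · obtain ⟨-, h10, h20, h30, h31, h32⟩ := hq
    have h0 := zero_mem (ints p)
    intro i j
    rw [mat_tor_conj]
    fin_cases i <;> fin_cases j <;>
      first
      | exact zpow_mul_mem_ints (of_decide_eq_true rfl) (hi _ _)
      | simp [h10, h20, h30, h31, h32, h0]
  · rw [sim_mul, sim_mul, mul_right_comm, ← sim_mul, mul_inv_cancel, norm_mul, hs,
      (mem_K_iff.mp (one_mem (K p))).2, one_mul]

theorem lowHeis_mul_tor (b c d : ℚ_[p]) : lowHeis b c d * tor p 2 1 2 =
    tor p 2 1 2 * lowHeis (p * b) (p * c) (p ^ 2 * d) := by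
  have hp := p_ne_zero p
  apply GSp4.ext_mat
  rw [mat_mul, mat_mul, mat_tor]
  ext i j
  fin_cases i <;> fin_cases j <;> norm_num [lowHeis, Matrix.mul_apply, Fin.sum_univ_four] <;>
    simp [zpow_ofNat] <;> ring

theorem lowHeis_mem_Kl {b c d : ℚ_[p]} (hb : b ∈ maxId p) (hc : c ∈ maxId p) (hd : d ∈ maxId p) :
    lowHeis b c d ∈ Kl p := by
  rw [mem_maxId] at hb hc hd
  refine mem_Kl_iff.mpr ⟨lowHeis_mem_K hb.le hc.le hd.le, ?_⟩
  simp [lowHeis, hb, hc, hd]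

/-- The Iwahori factorisation of `Kl(p)`. The corner entry is a unit, because the similitude factor
is one, so the bottom row can be cleared by an element congruent to `1` modulo `p`. -/
theorem exists_eq_mul_lowHeis {k : G p} (hk : k ∈ Kl p) : ∃ q ∈ Q p, ∃ b ∈ maxId p,
    ∃ c ∈ maxId p, ∃ d ∈ maxId p, k = q * lowHeis b c d := by
  obtain ⟨hK, h10, h20, h30, h31, h32⟩ := mem_Kl_iff.mp hk
  obtain ⟨hi, hs⟩ := mem_K_iff.mp hK
  have hu : mat k 3 3 ∉ maxId p := by
    intro h
    have h1 : sim k ∈ maxId p := by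
      have e := symplectic_relation k 0 3
      simp only [J, of_apply, cons_val', cons_val_zero, cons_val, mul_one] at e
      rw [← e]
      refine sub_mem (sub_mem (add_mem (mul_mem_maxId (hi _ _) h) ?_) ?_) ?_ <;> rw [mul_comm]
      · exact mul_mem_maxId (hi _ _) h10
      · exact mul_mem_maxId (hi _ _) h20
      · exact mul_mem_maxId (hi _ _) h30
    rw [mem_maxId, hs] at h1
    exact lt_irrefl _ h1
  have hne : mat k 3 3 ≠ 0 := fun h => hu (h ▸ zero_mem _)
  have hdiv : ∀ x, ‖x‖ < 1 → x / mat k 3 3 ∈ maxId p := by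
    intro x hx
    rw [div_eq_inv_mul]
    exact mul_mem_maxId (inv_mem_ints hu) hx
  have hl := lowHeis_mem_Kl (hdiv _ h32) (hdiv _ h31) (hdiv _ h30)
  have hinv : (lowHeis (mat k 3 2 / mat k 3 3) (mat k 3 1 / mat k 3 3) (mat k 3 0 / mat k 3 3) :
      G p)⁻¹ = lowHeis (-(mat k 3 2 / mat k 3 3)) (-(mat k 3 1 / mat k 3 3))
        (-(mat k 3 0 / mat k 3 3)) := by
    rw [inv_eq_iff_mul_eq_one]
    apply GSp4.ext_mat
    rw [mat_mul, mat_one]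
    ext i j
    fin_cases i <;> fin_cases j <;> simp [lowHeis, Matrix.mul_apply, Fin.sum_univ_four] <;> ring
  refine ⟨k * (lowHeis _ _ _)⁻¹, ⟨mul_mem hK ((K p).inv_mem (Kl_le_K hl)),
    mem_klingenParabolic_of_row ?_ ?_ ?_⟩, _, hdiv _ h32, _, hdiv _ h31, _, hdiv _ h30,
    by rw [inv_mul_cancel_right]⟩
  all_goals
    rw [hinv, mat_mul_apply]
    simp [lowHeis]
    field_simp
    ring

theorem lowHeis_smul_tor_smul {v : finFns p} (hv : ∀ h ∈ Kl p, h • v = v) {b c d : ℚ_[p]}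
    (hb : b ∈ maxId p) (hc : c ∈ maxId p) (hd : d ∈ maxId p) :
    lowHeis b c d • tor p 2 1 2 • v = tor p 2 1 2 • v := by
  rw [← mul_smul, lowHeis_mul_tor, mul_smul, hv]
  exact lowHeis_mem_Kl (mul_mem_maxId prime_mem_ints hb) (mul_mem_maxId prime_mem_ints hc)
    (mul_mem_maxId (pow_mem prime_mem_ints 2) hd)

/-- The lower unipotent factor of `Kl(p)` moves past `t` into `Kl(p)`, and there it fixes `v`. -/
theorem avg_Kl_tor {v : finFns p} (hv : ∀ h ∈ Kl p, h • v = v) :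
    avg (Kl p) (tor p 2 1 2 • v) = avg (Q p) (tor p 2 1 2 • v) := by
  refine avg_eq_of_orbit_eq (Set.Subset.antisymm ?_ ?_)
  · rintro _ ⟨⟨k, hk⟩, rfl⟩
    obtain ⟨q, hq, b, hb, c, hc, d, hd, rfl⟩ := exists_eq_mul_lowHeis hk
    refine ⟨⟨q, hq⟩, ?_⟩
    change q • tor p 2 1 2 • v = (q * lowHeis b c d) • tor p 2 1 2 • v
    rw [mul_smul, lowHeis_smul_tor_smul hv hb hc hd]
  · rintro _ ⟨⟨q, hq⟩, rfl⟩
    exact ⟨⟨q, Q_le_Kl hq⟩, rfl⟩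

/-- The Levi decomposition of `Q`; the Levi factor centralises `t`. -/
theorem exists_eq_unip_mul_levi {q : G p} (hq : q ∈ Q p) : ∃ b ∈ ints p, ∃ c ∈ ints p,
    ∃ d ∈ ints p, ∃ m ∈ Q p, q = unip b c d 0 * m ∧ m * tor p 2 1 2 = tor p 2 1 2 * m := by
  obtain ⟨hK, h10, h20, h30, h31, h32⟩ := id hq
  obtain ⟨hi, hs⟩ := mem_K_iff.mp hK
  have e := symplectic_relation q 0 3
  simp only [J, h10, h20, h30, of_apply, cons_val', cons_val_zero, cons_val, mul_one, zero_mul,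
    add_zero, sub_zero] at e
  have hu : mat q 3 3 ∉ maxId p := by
    intro h
    have h1 : sim q ∈ maxId p := by
      rw [← e]; exact mul_mem_maxId (hi _ _) h
    rw [mem_maxId, hs] at h1
    exact lt_irrefl _ h1
  have hne : mat q 3 3 ≠ 0 := fun h => hu (h ▸ zero_mem _)
  have hdiv : ∀ i, mat q i 3 / mat q 3 3 ∈ ints p := fun i => by
    rw [div_eq_mul_inv]; exact mul_mem (hi _ _) (inv_mem_ints hu)
  set b := -(mat q 2 3 / mat q 3 3) with hb
  set c := mat q 1 3 / mat q 3 3 with hc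
  set d := mat q 0 3 / mat q 3 3 with hd
  have hn : unip b c d 0 ∈ Q p := unip_mem_Q (neg_mem (hdiv _)) (hdiv _) (hdiv _) (zero_mem _)
  have hinv : (unip b c d 0)⁻¹ = unip (-b) (-c) (-d) 0 := by
    rw [inv_eq_iff_mul_eq_one, unip_mul, ← unip_zero]
    congr 1 <;> ring
  have hm : unip (-b) (-c) (-d) 0 * q ∈ Q p := by rw [← hinv]; exact mul_mem (inv_mem hn) hq
  refine ⟨b, neg_mem (hdiv _), c, hdiv _, d, hdiv _, _, hm, by rw [← hinv, mul_inv_cancel_left],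
    ?_⟩
  set m := unip (-b) (-c) (-d) 0 * q with hmdef
  have m03 : mat m 0 3 = 0 := by
    rw [hmdef, mat_mul_apply, hb, hc, hd]; simp [unip]; field_simp; ring
  have m13 : mat m 1 3 = 0 := by
    rw [hmdef, mat_mul_apply, hb, hc, hd]; simp [unip]; field_simp; ring
  have m23 : mat m 2 3 = 0 := by
    rw [hmdef, mat_mul_apply, hb, hc, hd]; simp [unip]; field_simp; ring
  obtain ⟨-, m10, m20, m30, m31, m32⟩ := hm
  have m33 : mat m 3 3 ≠ 0 := by
    rw [hmdef, mat_mul_apply]; simpa [unip] using hne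
  -- Once the last column is cleared above its corner, these relations clear the middle of the first
  -- row.
  have r13 := symplectic_relation m 1 3
  have r23 := symplectic_relation m 2 3
  simp only [J, m03, m13, m23, m31, m32, of_apply, cons_val', cons_val_zero, cons_val_one, cons_val,
    mul_zero, sub_zero, add_zero, mul_eq_zero, m33, or_false] at r13 r23
  clear_value m
  apply GSp4.ext_mat
  rw [mat_mul, mat_mul, mat_tor]
  ext i j
  fin_cases i <;> fin_cases j <;>
    simp [Matrix.mul_apply, Fin.sum_univ_four, m03, m13, m23, m10, m20, m30, m31, m32, r13, r23,
      mul_comm]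

variable (p) in
/-- Representatives of the cosets of `Kl(p)` in `Kl(p) diag(p², p, p, 1) Kl(p)`. -/
noncomputable def klingenRep (i : Fin p × Fin p × Fin (p ^ 2)) : G p :=
  unip ((i.1 : ℕ) : ℚ_[p]) ((i.2.1 : ℕ) : ℚ_[p]) ((i.2.2 : ℕ) : ℚ_[p]) 0 * tor p 2 1 2

theorem klingenRep_injective : Function.Injective fun i => (klingenRep p i : G p ⧸ Kl p) := by
  intro i j h
  have h1 : (klingenRep p i : G p ⧸ K p) = klingenRep p j := by
    rw [QuotientGroup.eq] at h ⊢
    exact Kl_le_K h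
  exact Sum.inl_injective (heckeRepTwo_injective h1)

/-- In `k = n m l` the Levi factor `m` commutes with `t`, and `l` moves past it into `Kl(p)`. Only
the integral Heisenberg element `n` counts, modulo its `t`-conjugates, which gives `p · p · p²`
cosets. -/
theorem klingenRep_bijOn (q : G p ⧸ Kl p) :
    q ∈ MulAction.orbit (Kl p) ((tor p 2 1 2 : G p) : G p ⧸ Kl p) ↔
      ∃ i, (klingenRep p i : G p ⧸ Kl p) = q := by
  constructor
  · rintro ⟨⟨k, hk⟩, rfl⟩
    obtain ⟨q, hq, b, hb, c, hc, d, hd, rfl⟩ := exists_eq_mul_lowHeis hk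
    obtain ⟨b', hb', c', hc', d', hd', m, hm, rfl, hmt⟩ := exists_eq_unip_mul_levi hq
    obtain ⟨b₁, h1⟩ := exists_residue_one hb'
    obtain ⟨c₁, h2⟩ := exists_residue_one hc'
    obtain ⟨d₁, h3⟩ := exists_residue 2 (sub_mem (add_mem hd' (mul_mem hb' (sub_mem
      (natCast_mem _ (c₁ : ℕ)) hc'))) (mul_mem hc' (sub_mem (natCast_mem _ (b₁ : ℕ)) hb')))
    refine ⟨(b₁, c₁, d₁), ?_⟩
    change _ = ((unip b' c' d' 0 * m * lowHeis b c d * tor p 2 1 2 : G p) : G p ⧸ Kl p)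
    rw [mul_assoc, lowHeis_mul_tor, mul_assoc, ← mul_assoc m, hmt]
    have hK : ((unip b' c' d' 0 * tor p 2 1 2 : G p) : G p ⧸ K p) =
        (klingenRep p (b₁, c₁, d₁) : G p) := by
      rw [klingenRep, coset_eq_iff_212]
      refine ⟨h1, ?_, ?_, by simp⟩
      · convert h2 using 2; ring
      · convert h3 using 2; ring
    rw [eq_comm, QuotientGroup.eq]
    rw [QuotientGroup.eq, klingenRep, _root_.mul_inv_rev, mul_assoc, ← mul_assoc (unip _ _ _ _)⁻¹,
      unip_inv_mul_unip, ← mul_assoc, tor_conj_unip] at hK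
    have hKl := Q_le_Kl ⟨hK, unip_mem_klingenParabolic _ _ _ _⟩
    have hl : lowHeis (p * b) (p * c) (p ^ 2 * d) ∈ Kl p :=
      lowHeis_mem_Kl (mul_mem_maxId prime_mem_ints hb) (mul_mem_maxId prime_mem_ints hc)
        (mul_mem_maxId (pow_mem prime_mem_ints 2) hd)
    rw [← tor_conj_unip, ← unip_inv_mul_unip] at hKl
    have := mul_mem (mul_mem (inv_mem hl) (inv_mem (Q_le_Kl hm))) hKl
    convert this using 1
    rw [klingenRep]
    group
  · rintro ⟨⟨b, c, d⟩, rfl⟩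
    have hn : ∀ n : ℕ, (n : ℚ_[p]) ∈ ints p := natCast_mem _
    exact ⟨⟨unip (b : ℕ) (c : ℕ) (d : ℕ) 0, Q_le_Kl (unip_mem_Q (hn _) (hn _) (hn _) (zero_mem _))⟩,
      rfl⟩

theorem orbit_Kl_eq_range : MulAction.orbit (Kl p) ((tor p 2 1 2 : G p) : G p ⧸ Kl p) =
    Set.range fun i => (klingenRep p i : G p ⧸ Kl p) :=
  Set.ext klingenRep_bijOn

theorem card_orbit_Kl :
    Nat.card (MulAction.orbit (Kl p) ((tor p 2 1 2 : G p) : G p ⧸ Kl p)) = p ^ 4 := by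
  rw [orbit_Kl_eq_range, Nat.card_range_of_injective klingenRep_injective]
  simp
  ring

/-- `U_{2,Kl}` as an average over the integral points of the Klingen parabolic. -/
theorem U2Kl_eq {v : finFns p} (hv : ∀ h ∈ Kl p, h • v = v) (r : ℕ) :
    U2Kl r (v : G p → ℂ) = ((p : ℂ) ^ (r + 4) • avg (Q p) (tor p 2 1 2 • v) : finFns p) := by
  rw [U2Kl, tKl_eq, doubleCosetOp_eq_avg hv, card_orbit_Kl, avg_Kl_tor hv, Submodule.coe_smul,
    smul_smul, pow_add, Nat.cast_pow]
  rw [orbit_Kl_eq_range]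
  exact Set.finite_range _

end KlingenStructure

end KlingenTrace

namespace KlingenTrace

/-! ### `K / Kl(p)` as the projective space of lines in `𝔽_p⁴` -/

section Flags

variable {p : ℕ} [Fact p.Prime]

/-- Modulo `p`, stabilising the first basis line implies stabilising its symplectic orthogonal. The
top left entry is a unit, since the similitude factor is one. -/
theorem mem_Kl_of_col {k : G p} (hk : k ∈ K p) (h1 : mat k 1 0 ∈ maxId p) (h2 : mat k 2 0 ∈ maxId p)
    (h3 : mat k 3 0 ∈ maxId p) : k ∈ Kl p := by
  obtain ⟨hi, hs⟩ := mem_K_iff.mp hk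
  have hu : mat k 0 0 ∉ maxId p := by
    intro h
    have e := symplectic_relation k 0 3
    simp only [J, of_apply, cons_val', cons_val_zero, cons_val, mul_one] at e
    have h4 : sim k ∈ maxId p := by
      rw [← e, mul_comm, mul_comm (mat k 1 0), mul_comm (mat k 2 0), mul_comm (mat k 3 0)]
      exact sub_mem (sub_mem (add_mem (mul_mem_maxId (hi _ _) h) (mul_mem_maxId (hi _ _) h1))
        (mul_mem_maxId (hi _ _) h2)) (mul_mem_maxId (hi _ _) h3)
    rw [mem_maxId, hs] at h4
    exact lt_irrefl _ h4
  have key : ∀ j : Fin 4, J ℚ_[p] 0 j = 0 → mat k 3 j ∈ maxId p := by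
    intro j hj
    have e := symplectic_relation k 0 j
    rw [hj, mul_zero] at e
    have h4 : mat k 0 0 * mat k 3 j ∈ maxId p := by
      have : mat k 0 0 * mat k 3 j =
          mat k 1 j * mat k 2 0 + mat k 0 j * mat k 3 0 - mat k 2 j * mat k 1 0 := by
        linear_combination e
      rw [this]
      exact sub_mem (add_mem (mul_mem_maxId (hi _ _) h2) (mul_mem_maxId (hi _ _) h3))
        (mul_mem_maxId (hi _ _) h1)
    exact (maxId_prime (hi _ _) (hi _ _) h4).resolve_left hu
  exact mem_Kl_iff.mpr ⟨hk, h1, h2, h3, key 1 (by simp [J]), key 2 (by simp [J])⟩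

/-- Cosets of `Kl(p)` in `K` are distinguished by the line spanned by the first column mod `p`. -/
theorem coset_Kl_eq_iff {r k : G p} (hr : r ∈ K p) (hk : k ∈ K p) :
    (r : G p ⧸ Kl p) = k ↔ ∃ u ∈ ints p, ∀ i, mat k i 0 - u * mat r i 0 ∈ maxId p := by
  rw [QuotientGroup.eq]
  constructor
  · intro h
    obtain ⟨hK, h1, h2, h3, -⟩ := mem_Kl_iff.mp h
    refine ⟨mat (r⁻¹ * k) 0 0, (mem_K_iff.mp hK).1 _ _, fun i => ?_⟩
    have e : mat k i 0 = mat (r * (r⁻¹ * k)) i 0 := by rw [mul_inv_cancel_left]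
    have hi := (mem_K_iff.mp hr).1
    rw [e, mat_mul_apply]
    have := add_mem (add_mem (mul_mem_maxId (hi i 1) h1) (mul_mem_maxId (hi i 2) h2))
      (mul_mem_maxId (hi i 3) h3)
    convert this using 1
    ring
  · rintro ⟨u, hu, h⟩
    have hri := (mem_K_iff.mp (inv_mem hr)).1
    have key : ∀ i, mat (r⁻¹ * k) i 0 - u * (1 : Matrix (Fin 4) (Fin 4) ℚ_[p]) i 0 ∈ maxId p := by
      intro i
      have e : (1 : Matrix (Fin 4) (Fin 4) ℚ_[p]) i 0 = mat (r⁻¹ * r) i 0 := by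
        rw [inv_mul_cancel, mat_one]
      rw [e, mat_mul_apply, mat_mul_apply]
      have := add_mem (add_mem (add_mem (mul_mem_maxId (hri i 0) (h 0)) (mul_mem_maxId (hri i 1) (h 1)))
        (mul_mem_maxId (hri i 2) (h 2))) (mul_mem_maxId (hri i 3) (h 3))
      convert this using 1
      ring
    refine mem_Kl_of_col (mul_mem (inv_mem hr) hk) ?_ ?_ ?_
    · simpa using key 1
    · simpa using key 2
    · simpa using key 3

variable (p) in
/-- Representatives of `K / Kl(p)`. -/
noncomputable def flagRep : (Fin p × Fin p × Fin p) ⊕ (Fin p × Fin p) ⊕ Fin p ⊕ Unit → G p :=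
  Sum.elim (fun i => unip ((i.1 : ℕ) : ℚ_[p]) ((i.2.1 : ℕ) : ℚ_[p]) ((i.2.2 : ℕ) : ℚ_[p]) 0
      * outSL 0 (-1) 1 0 (by norm_num)) <|
    Sum.elim (fun i => unip 0 ((i.1 : ℕ) : ℚ_[p]) 0 ((i.2 : ℕ) : ℚ_[p])
      * (midSL 0 (-1) 1 0 (by norm_num) * swapW)) <|
    Sum.elim (fun i => unip ((i : ℕ) : ℚ_[p]) 0 0 0 * swapW) fun _ => 1

theorem flagRep_mem_K (i) : flagRep p i ∈ K p := by
  have h0 := zero_mem (ints p)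
  have h1 := one_mem (ints p)
  have h1' : (-1 : ℚ_[p]) ∈ ints p := neg_mem h1
  have hn : ∀ n : ℕ, (n : ℚ_[p]) ∈ ints p := natCast_mem _
  rcases i with ⟨b, c, d⟩ | ⟨c, e⟩ | b | _
  · exact mul_mem (unip_mem_K_iff.mpr ⟨hn _, hn _, hn _, h0⟩) (outSL_mem_K _ h0 h1' h1 h0)
  · exact mul_mem (unip_mem_K_iff.mpr ⟨h0, hn _, h0, hn _⟩)
      (mul_mem (midSL_mem_K _ h0 h1' h1 h0) swapW_mem_K)
  · exact mul_mem (unip_mem_K_iff.mpr ⟨hn _, h0, h0, h0⟩) swapW_mem_K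
  · exact one_mem _

theorem flagRep_col_one (b c d : Fin p) (i : Fin 4) : mat (flagRep p (.inl (b, c, d))) i 0 =
    ![((d : ℕ) : ℚ_[p]), ((c : ℕ) : ℚ_[p]), -((b : ℕ) : ℚ_[p]), 1] i := by
  simp only [flagRep, Sum.elim_inl, mat_mul_apply]
  fin_cases i <;> simp [unip, outSL]

theorem flagRep_col_two (c e : Fin p) (i : Fin 4) : mat (flagRep p (.inr (.inl (c, e)))) i 0 =
    ![((c : ℕ) : ℚ_[p]), ((e : ℕ) : ℚ_[p]), 1, 0] i := by
  simp only [flagRep, Sum.elim_inl, Sum.elim_inr, mat_mul_apply]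
  fin_cases i <;> simp [unip, midSL, swapW]

theorem flagRep_col_three (b : Fin p) (i : Fin 4) : mat (flagRep p (.inr (.inr (.inl b)))) i 0 =
    ![((b : ℕ) : ℚ_[p]), 1, 0, 0] i := by
  simp only [flagRep, Sum.elim_inl, Sum.elim_inr, mat_mul_apply]
  fin_cases i <;> simp [unip, swapW]

theorem flagRep_col_four (u : Unit) (i : Fin 4) : mat (flagRep p (.inr (.inr (.inr u)))) i 0 =
    ![(1 : ℚ_[p]), 0, 0, 0] i := by
  simp only [flagRep, Sum.elim_inr, mat_one]
  fin_cases i <;> simp [Matrix.one_apply]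

theorem residue_eq_of_mul {a b : Fin p} {u : ℚ_[p]} (hu : 1 - u ∈ maxId p)
    (h : ((b : ℕ) : ℚ_[p]) - u * ((a : ℕ) : ℚ_[p]) ∈ maxId p) : a = b := by
  refine eq_of_residue_one (prime_inv_mul_mem_ints.mpr ?_)
  have := sub_mem h (mul_mem_maxId (natCast_mem (ints p) (a : ℕ)) hu)
  convert this using 1
  ring

theorem flagRep_injective : Function.Injective fun i => (flagRep p i : G p ⧸ Kl p) := by
  have h1 := one_notMem_maxId (p := p)
  intro i j h
  obtain ⟨u, hu, h⟩ := (coset_Kl_eq_iff (flagRep_mem_K i) (flagRep_mem_K j)).mp h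
  have hu' : u ∉ maxId p := by
    intro hu'
    have h2 : ∀ l, mat (flagRep p j) l 0 ∈ maxId p := by
      intro l
      have := add_mem (h l) (mul_mem_maxId ((mem_K_iff.mp (flagRep_mem_K i)).1 l 0) hu')
      convert this using 1
      ring
    rcases j with ⟨b, c, d⟩ | ⟨c, e⟩ | b | u'
    · have := h2 3; rw [flagRep_col_one] at this; exact h1 this
    · have := h2 2; rw [flagRep_col_two] at this; exact h1 this
    · have := h2 1; rw [flagRep_col_three] at this; exact h1 this
    · have := h2 0; rw [flagRep_col_four] at this; exact h1 this
  rcases i with ⟨b, c, d⟩ | ⟨c, e⟩ | b | u' <;> rcases j with ⟨b', c', d'⟩ | ⟨c', e'⟩ | b' | u'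
  all_goals
    simp only [flagRep_col_one, flagRep_col_two, flagRep_col_three, flagRep_col_four] at h
    have e0 := h 0
    have e1 := h 1
    have e2 := h 2
    have e3 := h 3
    clear h
    try (exfalso; simp [h1, hu'] at e0 e1 e2 e3; done)
  · have hu1 : 1 - u ∈ maxId p := by simpa using e3
    rw [residue_eq_of_mul hu1 e0, residue_eq_of_mul hu1 e1]
    have e2' : ((b' : ℕ) : ℚ_[p]) - u * ((b : ℕ) : ℚ_[p]) ∈ maxId p := by
      rw [← neg_mem_iff]
      convert e2 using 1
      simp
      ring
    rw [residue_eq_of_mul hu1 e2']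
  · have hu1 : 1 - u ∈ maxId p := by simpa using e2
    rw [residue_eq_of_mul hu1 e0, residue_eq_of_mul hu1 e1]
  · have hu1 : 1 - u ∈ maxId p := by simpa using e1
    rw [residue_eq_of_mul hu1 e0]
  · rfl

theorem exists_residue_mul {x v : ℚ_[p]} (hx : x ∈ ints p) (hv : v ∈ ints p) (hv' : v ∉ maxId p) :
    ∃ a : Fin p, x - v * ((a : ℕ) : ℚ_[p]) ∈ maxId p := by
  obtain ⟨a, ha⟩ := exists_residue_one (mul_mem (inv_mem_ints hv') hx)
  refine ⟨a, ?_⟩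
  have hne : v ≠ 0 := fun h => hv' (h ▸ zero_mem _)
  have := neg_mem (mul_mem_maxId hv (prime_inv_mul_mem_ints.mp ha))
  convert this using 1
  field_simp
  ring

/-- The first column modulo `p` is scaled so that its last nonzero coordinate is `1`; the position
of that coordinate selects the Schubert cell. -/
theorem flagRep_surjective {k : G p} (hk : k ∈ K p) :
    ∃ i, (flagRep p i : G p ⧸ Kl p) = k := by
  have hi : ∀ i, mat k i 0 ∈ ints p := fun i => (mem_K_iff.mp hk).1 i 0
  have h0 := zero_mem (maxId p)
  by_cases h3 : mat k 3 0 ∈ maxId p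
  · by_cases h2 : mat k 2 0 ∈ maxId p
    · by_cases h1 : mat k 1 0 ∈ maxId p
      · refine ⟨.inr (.inr (.inr ())), (coset_Kl_eq_iff (flagRep_mem_K _) hk).mpr
          ⟨_, hi 0, fun i => ?_⟩⟩
        rw [flagRep_col_four]
        fin_cases i <;> simp [h0, h1, h2, h3]
      · obtain ⟨b, hb⟩ := exists_residue_mul (hi 0) (hi 1) h1
        refine ⟨.inr (.inr (.inl b)), (coset_Kl_eq_iff (flagRep_mem_K _) hk).mpr
          ⟨_, hi 1, fun i => ?_⟩⟩
        rw [flagRep_col_three]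
        fin_cases i <;> simp [h0, hb, h2, h3]
    · obtain ⟨c, hc⟩ := exists_residue_mul (hi 0) (hi 2) h2
      obtain ⟨e, he⟩ := exists_residue_mul (hi 1) (hi 2) h2
      refine ⟨.inr (.inl (c, e)), (coset_Kl_eq_iff (flagRep_mem_K _) hk).mpr
        ⟨_, hi 2, fun i => ?_⟩⟩
      rw [flagRep_col_two]
      fin_cases i <;> simp [h0, hc, he, h3]
  · obtain ⟨d, hd⟩ := exists_residue_mul (hi 0) (hi 3) h3
    obtain ⟨c, hc⟩ := exists_residue_mul (hi 1) (hi 3) h3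
    obtain ⟨b, hb⟩ := exists_residue_mul (neg_mem (hi 2)) (hi 3) h3
    have hb' : mat k 2 0 + mat k 3 0 * ((b : ℕ) : ℚ_[p]) ∈ maxId p := by
      rw [← neg_mem_iff]
      convert hb using 1
      ring
    refine ⟨.inl (b, c, d), (coset_Kl_eq_iff (flagRep_mem_K _) hk).mpr ⟨_, hi 3, fun i => ?_⟩⟩
    rw [flagRep_col_one]
    fin_cases i <;> simp [h0, hd, hc, hb']

theorem orbit_K_Kl_eq_range : MulAction.orbit (K p) ((1 : G p) : G p ⧸ Kl p) =
    Set.range fun i => (flagRep p i : G p ⧸ Kl p) := by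
  ext q
  constructor
  · rintro ⟨⟨k, hk⟩, rfl⟩
    obtain ⟨i, hi⟩ := flagRep_surjective hk
    refine ⟨i, hi.trans ?_⟩
    change _ = ((k * 1 : G p) : G p ⧸ Kl p)
    rw [mul_one]
  · rintro ⟨i, rfl⟩
    refine ⟨⟨flagRep p i, flagRep_mem_K i⟩, ?_⟩
    change ((flagRep p i * 1 : G p) : G p ⧸ Kl p) = _
    rw [mul_one]

theorem card_orbit_K_Kl :
    Nat.card (MulAction.orbit (K p) ((1 : G p) : G p ⧸ Kl p)) = p ^ 3 + p ^ 2 + p + 1 := by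
  rw [orbit_K_Kl_eq_range, Nat.card_range_of_injective flagRep_injective]
  simp
  ring

theorem trace_eq {v : finFns p} (hv : ∀ h ∈ Kl p, h • v = v) :
    trace (v : G p → ℂ) = (((p : ℂ) ^ 3 + p ^ 2 + p + 1) • avg (K p) v : finFns p) := by
  rw [trace, doubleCosetOp_eq_avg hv, card_orbit_K_Kl, one_smul, Submodule.coe_smul]
  · push_cast; rfl
  · rw [orbit_K_Kl_eq_range]
    exact Set.finite_range _

end Flags

end KlingenTrace

namespace KlingenTrace

/-! ### Hecke recursions for functionals on torus translates -/

section Recursion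

variable {p : ℕ} [Fact p.Prime] {Y : Type*} [AddCommGroup Y] [Module ℂ Y]

/-- A `K`-invariant eigenvector of the spherical Hecke operators. -/
structure IsHeckeEigen (w : finFns p) (e₁ e₂ ω : ℂ) : Prop where
  inv : ∀ k ∈ K p, k • w = w
  one : ∑ i, heckeRepOne p i • w = e₁ • w
  two : ∑ i, heckeRepTwo p i • w = e₂ • w
  center : tor p 1 1 2 • w = ω • w

/-- `l` is invariant under the integral unipotent elements, on the translates of `w`. -/
def UnipInvariant (w : finFns p) (l : finFns p →ₗ[ℂ] Y) : Prop :=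
  ∀ b ∈ ints p, ∀ c ∈ ints p, ∀ d ∈ ints p, ∀ e ∈ ints p, ∀ g : G p,
    l (unip b c d e • g • w) = l (g • w)

/-- The value of `l` on the translate of `w` by `tor p x y z`. -/
noncomputable def torVal (w : finFns p) (l : finFns p →ₗ[ℂ] Y) (x y z : ℤ) : Y := l (tor p x y z • w)

/-- For dominant exponents, conjugation by the torus element preserves integrality of all four
coordinates. -/
theorem UnipInvariant.tor_smul {w : finFns p} {l : finFns p →ₗ[ℂ] Y} (hl : UnipInvariant w l)
    {x y z : ℤ} (hxy : y ≤ x) (hyz : z ≤ 2 * y) {b c d e : ℚ_[p]} (hb : b ∈ ints p)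
    (hc : c ∈ ints p) (hd : d ∈ ints p) (he : e ∈ ints p) (g : G p) :
    l (tor p x y z • unip b c d e • g • w) = l (tor p x y z • g • w) := by
  rw [← mul_smul, tor_mul_unip, mul_smul, ← mul_smul (tor p x y z) g, hl]
  · exact zpow_mul_mem_ints (by omega) hb
  · exact zpow_mul_mem_ints (by omega) hc
  · exact zpow_mul_mem_ints (by omega) hd
  · exact zpow_mul_mem_ints (by omega) he

theorem UnipInvariant.torVal_eq {w : finFns p} {l : finFns p →ₗ[ℂ] Y} (hl : UnipInvariant w l)
    {x y z : ℤ} (hxy : y ≤ x) (hyz : z ≤ 2 * y) {b c d e : ℚ_[p]} (hb : b ∈ ints p)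
    (hc : c ∈ ints p) (hd : d ∈ ints p) (he : e ∈ ints p) (x' y' z' : ℤ) :
    l (tor p x y z • (unip b c d e * tor p x' y' z') • w) = torVal w l (x + x') (y + y') (z + z') := by
  rw [mul_smul, hl.tor_smul hxy hyz hb hc hd he, ← mul_smul, tor_mul, torVal]

theorem IsHeckeEigen.torVal_center {w : finFns p} {e₁ e₂ ω : ℂ} (h : IsHeckeEigen w e₁ e₂ ω)
    (l : finFns p →ₗ[ℂ] Y) (x y z : ℤ) :
    torVal w l (x + 1) (y + 1) (z + 2) = ω • torVal w l x y z := by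
  rw [torVal, ← tor_mul, mul_smul, h.center, smul_comm, map_smul, torVal]

/-- In the eigenvector equation translated by a dominant torus element, `l` ignores the unipotent
parts of the representatives, so each family contributes one value times its cardinality. -/
theorem IsHeckeEigen.recursion_one {w : finFns p} {e₁ e₂ ω : ℂ} (h : IsHeckeEigen w e₁ e₂ ω)
    {l : finFns p →ₗ[ℂ] Y} (hl : UnipInvariant w l) {x y z : ℤ} (hxy : y ≤ x) (hyz : z ≤ 2 * y) :
    e₁ • torVal w l x y z = (p : ℂ) ^ 3 • torVal w l (x + 1) (y + 1) (z + 1) +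
      (p : ℂ) ^ 2 • torVal w l (x + 1) y (z + 1) + (p : ℂ) • torVal w l x (y + 1) (z + 1) +
      torVal w l x y (z + 1) := by
  have h0 := zero_mem (ints p)
  have hn : ∀ n : ℕ, (n : ℚ_[p]) ∈ ints p := natCast_mem _
  have h1 := congrArg (fun v => l (tor p x y z • v)) h.one
  simp only [smul_comm _ e₁, map_smul, smul_add, map_add, Finset.smul_sum, map_sum, Fintype.sum_sum_type,
    heckeRepOne, Sum.elim_inl, Sum.elim_inr,
    hl.torVal_eq hxy hyz h0 (hn _) (hn _) (hn _), hl.torVal_eq hxy hyz (hn _) h0 (hn _) h0,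
    hl.torVal_eq hxy hyz h0 h0 h0 (hn _), hl.torVal_eq hxy hyz h0 h0 h0 h0, Finset.sum_const,
    Finset.card_univ, Fintype.card_prod, Fintype.card_fin, Fintype.card_unit, add_zero, one_smul,
    ← Nat.cast_smul_eq_nsmul ℂ, Nat.cast_mul, Nat.cast_one] at h1
  rw [torVal, ← h1]
  module

/-- As for the first operator, except that the two families with coordinates `c / p` are not covered
by integral invariance. They remain as sums, to be evaluated differently for Klingen-invariant,
`K`-invariant and Whittaker functionals. -/
theorem IsHeckeEigen.recursion_two {w : finFns p} {e₁ e₂ ω : ℂ} (h : IsHeckeEigen w e₁ e₂ ω)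
    {l : finFns p →ₗ[ℂ] Y} (hl : UnipInvariant w l) {x y z : ℤ} (hxy : y ≤ x) (hyz : z ≤ 2 * y) :
    e₂ • torVal w l x y z = (p : ℂ) ^ 4 • torVal w l (x + 2) (y + 1) (z + 2) +
      (p : ℂ) ^ 3 • torVal w l (x + 1) (y + 2) (z + 2) + (p : ℂ) • torVal w l (x + 1) y (z + 2) +
      torVal w l x (y + 1) (z + 2) +
      ω • ∑ c : NonzeroRes p, l (tor p x y z • unip 0 0 ((p : ℚ_[p])⁻¹ * ((c.1 : ℕ) : ℚ_[p])) 0 • w) +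
      ((p : ℂ) * ω) •
        ∑ c : NonzeroRes p, l (tor p x y z • unip 0 0 0 ((p : ℚ_[p])⁻¹ * ((c.1 : ℕ) : ℚ_[p])) • w) := by
  have h0 := zero_mem (ints p)
  have hn : ∀ n : ℕ, (n : ℚ_[p]) ∈ ints p := natCast_mem _
  have key : ∀ (b : Fin p) (c : NonzeroRes p),
      l (tor p x y z • (unip ((b : ℕ) : ℚ_[p]) 0 0 ((p : ℚ_[p])⁻¹ * ((c.1 : ℕ) : ℚ_[p])) *
        tor p 1 1 2) • w) =
      ω • l (tor p x y z • unip 0 0 0 ((p : ℚ_[p])⁻¹ * ((c.1 : ℕ) : ℚ_[p])) • w) := by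
    intro b c
    have : unip ((b : ℕ) : ℚ_[p]) 0 0 ((p : ℚ_[p])⁻¹ * ((c.1 : ℕ) : ℚ_[p])) =
        unip ((b : ℕ) : ℚ_[p]) 0 0 0 * unip 0 0 0 ((p : ℚ_[p])⁻¹ * ((c.1 : ℕ) : ℚ_[p])) := by
      rw [unip_mul]; simp
    rw [mul_smul, h.center, smul_comm _ ω w, smul_comm _ ω, map_smul, this, mul_smul,
      hl.tor_smul hxy hyz (hn _) h0 h0 h0]
  have key' : ∀ c : NonzeroRes p,
      l (tor p x y z • (unip 0 0 ((p : ℚ_[p])⁻¹ * ((c.1 : ℕ) : ℚ_[p])) 0 * tor p 1 1 2) • w) =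
      ω • l (tor p x y z • unip 0 0 ((p : ℚ_[p])⁻¹ * ((c.1 : ℕ) : ℚ_[p])) 0 • w) := by
    intro c
    rw [mul_smul, h.center, smul_comm _ ω w, smul_comm _ ω, map_smul]
  have h1 := congrArg (fun v => l (tor p x y z • v)) h.two
  simp only [smul_comm _ e₂, map_smul, smul_add, map_add, Finset.smul_sum, map_sum, Fintype.sum_sum_type,
    heckeRepTwo, Sum.elim_inl, Sum.elim_inr, key, key', hl.torVal_eq hxy hyz (hn _) (hn _) (hn _) h0,
    hl.torVal_eq hxy hyz h0 (hn _) h0 (hn _), hl.torVal_eq hxy hyz (hn _) h0 h0 h0,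
    hl.torVal_eq hxy hyz h0 h0 h0 h0, Finset.sum_const, Fintype.sum_prod_type,
    Finset.card_univ, Fintype.card_prod, Fintype.card_fin, Fintype.card_unit, add_zero, one_smul,
    ← Nat.cast_smul_eq_nsmul ℂ, Nat.cast_mul, Nat.cast_one, Nat.cast_pow] at h1
  simp only [← Finset.smul_sum] at h1
  rw [torVal, ← h1]
  module

end Recursion

end KlingenTrace

namespace KlingenTrace

/-! ### Recursions for `Q`-invariant and `K`-invariant functionals -/

section KlingenInvariant

variable {p : ℕ} [Fact p.Prime] {Y : Type*} [AddCommGroup Y] [Module ℂ Y]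
  {w : finFns p} {e₁ e₂ ω : ℂ} {l : finFns p →ₗ[ℂ] Y}

/-- `l` is invariant under `H`, on the translates of `w`. -/
def InvariantUnder (H : Subgroup (G p)) (w : finFns p) (l : finFns p →ₗ[ℂ] Y) : Prop :=
  ∀ h ∈ H, ∀ g : G p, l (h • g • w) = l (g • w)

theorem InvariantUnder.mono {H H' : Subgroup (G p)} (hl : InvariantUnder H' w l) (h : H ≤ H') :
    InvariantUnder H w l := fun k hk => hl k (h hk)

theorem InvariantUnder.unipInvariant (hl : InvariantUnder (Q p) w l) : UnipInvariant w l :=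
  fun _ hb _ hc _ hd _ he g => hl _ (unip_mem_Q hb hc hd he) g

/-- The Weyl element of the Klingen Levi subgroup lies in `Q`, so `l` ignores it on the left; it
also lies in `K`, so `w` absorbs it on the right. -/
theorem torVal_flip (hw : ∀ k ∈ K p, k • w = w) (hl : InvariantUnder (Q p) w l) (x y z : ℤ) :
    torVal w l x (z - y) z = torVal w l x y z := by
  rw [torVal, torVal, ← hl _ midW_mem_Q (tor p x y z), ← mul_smul, midW_mul_tor, mul_smul,
    hw _ midW_mem_K]

theorem torVal_swap (hw : ∀ k ∈ K p, k • w = w) (hl : InvariantUnder (K p) w l) (x y z : ℤ) :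
    torVal w l y x z = torVal w l x y z := by
  rw [torVal, torVal, ← hl _ swapW_mem_K (tor p x y z), ← swapW_mul_tor, mul_smul, mul_smul,
    hw _ swapW_mem_K]

/-- The Bruhat decomposition of the non-integral element in the middle `SL₂` has its left factor in
`Q` and its right factor in `K`. -/
theorem val_unip_e (hw : ∀ k ∈ K p, k • w = w) (hl : InvariantUnder (Q p) w l) (x : ℤ)
    (c : NonzeroRes p) :
    l (tor p x 0 0 • unip 0 0 0 ((p : ℚ_[p])⁻¹ * ((c.1 : ℕ) : ℚ_[p])) • w) =
      torVal w l x (-1) 0 := by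
  obtain ⟨m, hm, hm', k, hk, h⟩ := unip_resDiv_mul_tor c (x := x) (y := 0) (z := 0) (by norm_num)
  rw [← mul_smul, tor_mul_unip]
  simp only [mul_zero, sub_zero, zpow_zero, one_mul]
  rw [h, mul_smul, mul_smul, hw k hk, hl m ⟨hm, hm'⟩, torVal]
  norm_num

/-- For `x ≥ 1` the torus element multiplies the coordinate `c / p` by at least `p²`, which makes it
integral. -/
theorem val_unip_d (hl : UnipInvariant w l) {x : ℤ} (hx : 1 ≤ x) (c : NonzeroRes p) :
    l (tor p x 0 0 • unip 0 0 ((p : ℚ_[p])⁻¹ * ((c.1 : ℕ) : ℚ_[p])) 0 • w) = torVal w l x 0 0 := by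
  have h0 := zero_mem (ints p)
  have h : (p : ℚ_[p]) ^ (2 * x - 0) * ((p : ℚ_[p])⁻¹ * ((c.1 : ℕ) : ℚ_[p])) =
      (p : ℚ_[p]) ^ (2 * x - 1) * ((c.1 : ℕ) : ℚ_[p]) := by
    rw [← mul_assoc, ← _root_.zpow_neg_one, ← zpow_add₀ (p_ne_zero p)]
    congr 2
    ring
  rw [← mul_smul, tor_mul_unip, mul_smul, h]
  simp only [mul_zero]
  exact hl _ h0 _ h0 _ (zpow_mul_mem_ints (by omega) (natCast_mem _ _)) _ h0 _

theorem card_nonzeroRes : (Fintype.card (NonzeroRes p) : ℂ) = p - 1 := by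
  have hpos : 0 < p := (Fact.out : p.Prime).pos
  have : NeZero p := ⟨hpos.ne'⟩
  have h : Fintype.card (NonzeroRes p) = p - 1 := by
    have h1 : Fintype.card {c : Fin p // c ≠ 0} = p - 1 := by
      rw [Fintype.card_subtype_compl, Fintype.card_fin, Fintype.card_subtype_eq]
    rw [← h1]
    refine Fintype.card_congr (Equiv.subtypeEquivRight fun c => ?_)
    rw [Ne, Ne, Fin.ext_iff, Fin.val_zero]
  rw [h, Nat.cast_sub hpos, Nat.cast_one]

theorem klingen_recursion_A (h : IsHeckeEigen w e₁ e₂ ω) (hl : InvariantUnder (Q p) w l) {d : ℤ}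
    (hd : 0 ≤ d) : e₁ • torVal w l d 0 0 =
      ((p : ℂ) ^ 3 + (p : ℂ) ^ 2) • torVal w l (d + 1) 1 1 + ((p : ℂ) + 1) • torVal w l d 1 1 := by
  have h1 := h.recursion_one hl.unipInvariant (x := d) (y := 0) (z := 0) hd (by norm_num)
  have h2 := torVal_flip h.inv hl (d + 1) 0 1
  have h3 := torVal_flip h.inv hl d 0 1
  norm_num at h1 h2 h3
  rw [h1, ← h2, ← h3]
  module

theorem klingen_recursion_B (h : IsHeckeEigen w e₁ e₂ ω) (hl : InvariantUnder (Q p) w l) {d : ℤ}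
    (hd : 0 ≤ d) : e₁ • torVal w l (d + 1) 1 1 =
      ω • ((p : ℂ) ^ 3 • torVal w l (d + 1) 1 0 + (p : ℂ) ^ 2 • torVal w l (d + 1) 0 0 +
        (p : ℂ) • torVal w l d 1 0 + torVal w l d 0 0) := by
  have h1 := h.recursion_one hl.unipInvariant (x := d + 1) (y := 1) (z := 1) (by omega) (by norm_num)
  have h2 := h.torVal_center l (d + 1) 1 0
  have h3 := h.torVal_center l (d + 1) 0 0
  have h4 := h.torVal_center l d 1 0
  have h5 := h.torVal_center l d 0 0
  norm_num at h1 h2 h3 h4 h5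
  rw [h1, h2, h3, h4, h5]
  module

/-- Up to the centre and the flip, the types `(1, 2, 2)` and `(1, 0, 2)` and the `e`-family all give
`torVal w l (d + 1) 1 0`, with total weight `p³ + p + p(p - 1)`. -/
theorem klingen_recursion_C (h : IsHeckeEigen w e₁ e₂ ω) (hl : InvariantUnder (Q p) w l) {d : ℤ}
    (hd : 0 ≤ d) : e₂ • torVal w l (d + 1) 0 0 =
      ω • ((p : ℂ) ^ 4 • torVal w l (d + 2) 0 0 + ((p : ℂ) ^ 3 + (p : ℂ) ^ 2) • torVal w l (d + 1) 1 0 +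
        torVal w l d 0 0 + ((p : ℂ) - 1) • torVal w l (d + 1) 0 0) := by
  have h1 := h.recursion_two hl.unipInvariant (x := d + 1) (y := 0) (z := 0) (by omega) (by norm_num)
  simp only [val_unip_e h.inv hl, val_unip_d hl.unipInvariant (show 1 ≤ d + 1 by omega),
    Finset.sum_const, Finset.card_univ, ← Nat.cast_smul_eq_nsmul ℂ, card_nonzeroRes] at h1
  have h2 := h.torVal_center l (d + 2) 0 0
  have h3 := h.torVal_center l (d + 1) 1 0
  have h4 := h.torVal_center l (d + 1) (-1) 0
  have h5 := h.torVal_center l d 0 0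
  have h6 := torVal_flip h.inv hl (d + 1) (-1) 0
  norm_num [add_assoc] at h1 h2 h3 h4 h5 h6
  rw [h1, h2, h3, h4, h5, h6]
  module

/-- All four torus types are Weyl conjugates, so the four terms at the origin coincide. This is the
initial value missing from the `Q`-invariant recursions. -/
theorem spherical_recursion_A (h : IsHeckeEigen w e₁ e₂ ω) (hl : InvariantUnder (K p) w l) :
    e₁ • torVal w l 0 0 0 = ((p : ℂ) ^ 3 + (p : ℂ) ^ 2 + p + 1) • torVal w l 1 1 1 := by
  have h1 := klingen_recursion_A h (hl.mono Q_le_K) le_rfl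
  have h2 := torVal_swap h.inv hl 1 0 1
  have h3 := torVal_flip h.inv (hl.mono Q_le_K) 1 1 1
  norm_num at h1 h2 h3
  rw [h1, h2, h3]
  module

theorem spherical_val (h : IsHeckeEigen w e₁ e₂ ω) (hl : InvariantUnder (K p) w l) :
    torVal w l 0 1 0 = torVal w l 1 0 0 :=
  torVal_swap h.inv hl 1 0 0

theorem spherical_recursion_C (h : IsHeckeEigen w e₁ e₂ ω) (hl : InvariantUnder (K p) w l) :
    e₂ • torVal w l 0 0 0 =
      (ω * ((p : ℂ) ^ 4 + (p : ℂ) ^ 3 + (p : ℂ) ^ 2 + p)) • torVal w l 1 0 0 := by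
  have hQ := hl.mono Q_le_K
  have h1 := h.recursion_two hQ.unipInvariant (x := 0) (y := 0) (z := 0) le_rfl (by norm_num)
  have key : ∀ c : NonzeroRes p,
      l (tor p 0 0 0 • unip 0 0 ((p : ℚ_[p])⁻¹ * ((c.1 : ℕ) : ℚ_[p])) 0 • w) =
        torVal w l 0 (-1) 0 := by
    intro c
    rw [← val_unip_e h.inv hQ 0 c, ← swapW_mul_unip, tor_zero, one_smul, one_smul, mul_smul,
      mul_smul, h.inv _ swapW_mem_K, hl _ swapW_mem_K]
  simp only [val_unip_e h.inv hQ, key, Finset.sum_const, Finset.card_univ,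
    ← Nat.cast_smul_eq_nsmul ℂ, card_nonzeroRes] at h1
  have h2 := h.torVal_center l 1 0 0
  have h3 := h.torVal_center l 0 1 0
  have h4 := h.torVal_center l 0 (-1) 0
  have h5 := h.torVal_center l (-1) 0 0
  have h6 := torVal_flip h.inv hQ 0 1 0
  have h7 := torVal_swap h.inv hl 0 (-1) 0
  have h8 := spherical_val h hl
  norm_num at h1 h2 h3 h4 h5 h6 h7 h8
  rw [h1, h2, h3, h4, h5, h7, h6, h8]
  module

end KlingenInvariant

end KlingenTrace

namespace KlingenTrace

/-! ### Recursions for Whittaker functions -/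

section Whittaker

variable {p : ℕ} [Fact p.Prime] {w : finFns p} {e₁ e₂ ω : ℂ} {ψ : AddChar ℚ_[p] ℂ}

variable (p) in
/-- Evaluation at the identity. -/
noncomputable def evalOne : finFns p →ₗ[ℂ] ℂ := LinearMap.proj 1 ∘ₗ (finFns p).subtype

theorem evalOne_smul (g : G p) (v : finFns p) : evalOne p (g • v) = (v : G p → ℂ) g :=
  congrArg (v : G p → ℂ) (one_mul g)

/-- `w` transforms under the unipotent radical of the Borel subgroup by the character of `ψ`. -/
def IsEquivariant (ψ : AddChar ℚ_[p] ℂ) (w : finFns p) : Prop :=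
  ∀ n : G p, InUnipotent n → ∀ g : G p,
    (w : G p → ℂ) (n * g) = ψ (mat n 0 1 + mat n 1 2) * (w : G p → ℂ) g

theorem IsEquivariant.unip (hw : IsEquivariant ψ w) (b c d e : ℚ_[p]) (g : G p) :
    (w : G p → ℂ) (unip b c d e * g) = ψ (b + e) * (w : G p → ℂ) g := by
  have h : InUnipotent (KlingenTrace.unip b c d e : G p) := by
    refine ⟨fun i j hij => ?_, fun i => ?_⟩
    · rw [mat_unip]
      fin_cases i <;> fin_cases j <;> simp at hij ⊢
    · rw [mat_unip]
      fin_cases i <;> simp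
  have := hw _ h g
  rwa [mat_unip] at this

theorem IsUnramified.map_eq_one (hψ : IsUnramified ψ) {x : ℚ_[p]} (hx : x ∈ ints p) : ψ x = 1 :=
  hψ.1 x hx

theorem IsEquivariant.unipInvariant (hw : IsEquivariant ψ w) (hψ : IsUnramified ψ) :
    UnipInvariant w (evalOne p) := by
  intro b hb c _ d _ e he g
  rw [← mul_smul, evalOne_smul, evalOne_smul, hw.unip, hψ.map_eq_one (add_mem hb he), one_mul]

theorem evalOne_tor_unip (hw : IsEquivariant ψ w) (x y z : ℤ) (b c d e : ℚ_[p]) :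
    evalOne p (tor p x y z • KlingenTrace.unip b c d e • w) =
      ψ ((p : ℚ_[p]) ^ (x - y) * b + (p : ℚ_[p]) ^ (2 * y - z) * e) *
        torVal w (evalOne p) x y z := by
  rw [← mul_smul, evalOne_smul, tor_mul_unip, hw.unip, torVal, evalOne_smul]

theorem IsUnramified.exists_mem_ints (hψ : IsUnramified ψ) {n : ℤ} (hn : n < 0) :
    ∃ b ∈ ints p, ψ ((p : ℚ_[p]) ^ n * b) ≠ 1 := by
  obtain ⟨x, hx, hx'⟩ := hψ.2
  have hp := p_ne_zero p
  -- Since `‖x‖ ≤ p`, the product `p x` is integral; the exponents are arranged so that the argument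
  -- of `ψ` is `x` again.
  refine ⟨(p : ℚ_[p]) ^ (-n - 1) * (p * x), zpow_mul_mem_ints (by omega) ?_, ?_⟩
  · have : (0 : ℝ) < p := by exact_mod_cast (Fact.out : p.Prime).pos
    rw [mem_ints, norm_mul, Padic.norm_p]
    exact inv_mul_le_one_of_le₀ hx this.le
  · rwa [← mul_assoc, ← zpow_add₀ hp, ← mul_assoc, ← zpow_add_one₀ hp,
      show n + (-n - 1) + 1 = 0 by ring, zpow_zero, one_mul]

/-- An integral unipotent element is absorbed by `w` on the right; moved to the left, it multiplies
the value by some `ψ(p ^ (x - y) b) ≠ 1`. -/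
theorem torVal_eq_zero_of_lt (hK : ∀ k ∈ K p, k • w = w) (hw : IsEquivariant ψ w)
    (hψ : IsUnramified ψ) {x y z : ℤ} (h : x < y) : torVal w (evalOne p) x y z = 0 := by
  obtain ⟨b, hb, hb'⟩ := hψ.exists_mem_ints (show x - y < 0 by omega)
  have h0 := zero_mem (ints p)
  have h1 := evalOne_tor_unip hw x y z b 0 0 0
  rw [hK _ (unip_mem_K_iff.mpr ⟨hb, h0, h0, h0⟩), mul_zero, add_zero] at h1
  by_contra hne
  exact hb' (mul_right_cancel₀ hne (h1.symm.trans (one_mul _).symm))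

theorem torVal_eq_zero_of_two_mul_lt (hK : ∀ k ∈ K p, k • w = w) (hw : IsEquivariant ψ w)
    (hψ : IsUnramified ψ) {x y z : ℤ} (h : 2 * y < z) : torVal w (evalOne p) x y z = 0 := by
  obtain ⟨b, hb, hb'⟩ := hψ.exists_mem_ints (show 2 * y - z < 0 by omega)
  have h0 := zero_mem (ints p)
  have h1 := evalOne_tor_unip hw x y z 0 0 0 b
  rw [hK _ (unip_mem_K_iff.mpr ⟨h0, h0, h0, hb⟩), mul_zero, zero_add] at h1
  by_contra hne
  exact hb' (mul_right_cancel₀ hne (h1.symm.trans (one_mul _).symm))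

/-- A geometric sum whose ratio `ψ(1 / p)` is a nontrivial `p`-th root of unity. -/
theorem IsUnramified.sum_eq_zero (hψ : IsUnramified ψ) :
    ∑ c : Fin p, ψ ((p : ℚ_[p])⁻¹ * ((c : ℕ) : ℚ_[p])) = 0 := by
  have hp := p_ne_zero p
  have hpow : ∀ c : ℕ, ψ ((p : ℚ_[p])⁻¹ * (c : ℚ_[p])) = ψ ((p : ℚ_[p])⁻¹) ^ c := by
    intro c
    rw [mul_comm, ← nsmul_eq_mul, AddChar.map_nsmul_eq_pow]
  have hne : ψ ((p : ℚ_[p])⁻¹) ≠ 1 := by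
    obtain ⟨b, hb, hb'⟩ := hψ.exists_mem_ints (show (-1 : ℤ) < 0 by norm_num)
    intro h
    obtain ⟨a, ha⟩ := exists_residue_one hb
    apply hb'
    have h1 := hψ.map_eq_one (neg_mem ha)
    have h2 := hpow a
    rw [h, one_pow] at h2
    have h3 : (p : ℚ_[p]) ^ (-1 : ℤ) * b =
        (p : ℚ_[p])⁻¹ * ((a : ℕ) : ℚ_[p]) + -((p : ℚ_[p])⁻¹ * (((a : ℕ) : ℚ_[p]) - b)) := by
      rw [_root_.zpow_neg_one]; ring
    rw [h3, AddChar.map_add_eq_mul, h1, h2, one_mul]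
  have h1 := mul_neg_geom_sum (ψ ((p : ℚ_[p])⁻¹)) p
  rw [← hpow, inv_mul_cancel₀ hp, hψ.map_eq_one (one_mem _), sub_self] at h1
  simp only [hpow]
  rw [Fin.sum_univ_eq_sum_range fun c => ψ ((p : ℚ_[p])⁻¹) ^ c]
  exact (mul_eq_zero.mp h1).resolve_left (sub_ne_zero.mpr hne.symm)

theorem IsUnramified.sum_nonzeroRes (hψ : IsUnramified ψ) :
    ∑ c : NonzeroRes p, ψ ((p : ℚ_[p])⁻¹ * ((c.1 : ℕ) : ℚ_[p])) = -1 := by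
  have : NeZero p := ⟨(Fact.out : p.Prime).ne_zero⟩
  have h := hψ.sum_eq_zero
  rw [Fintype.sum_eq_add_sum_subtype_ne _ 0] at h
  have h1 : ∑ c : {c : Fin p // c ≠ 0}, ψ ((p : ℚ_[p])⁻¹ * ((c.1 : ℕ) : ℚ_[p])) =
      ∑ c : NonzeroRes p, ψ ((p : ℚ_[p])⁻¹ * ((c.1 : ℕ) : ℚ_[p])) := by
    refine Fintype.sum_equiv (Equiv.subtypeEquivRight fun c => ?_) _ _ fun c => rfl
    rw [Ne, Ne, Fin.ext_iff, Fin.val_zero]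
  rw [h1, Fin.val_zero, Nat.cast_zero, mul_zero, AddChar.map_zero_eq_one] at h
  linear_combination h

theorem whittaker_recursion_A (h : IsHeckeEigen w e₁ e₂ ω) (hw : IsEquivariant ψ w)
    (hψ : IsUnramified ψ) {d : ℤ} (hd : 0 ≤ d) : e₁ * torVal w (evalOne p) d 0 0 =
      (p : ℂ) ^ 3 * torVal w (evalOne p) (d + 1) 1 1 + p * torVal w (evalOne p) d 1 1 := by
  have h1 := h.recursion_one (hw.unipInvariant hψ) (x := d) (y := 0) (z := 0) hd (by norm_num)
  have h2 := torVal_eq_zero_of_two_mul_lt h.inv hw hψ (x := d + 1) (y := 0) (z := 1) (by norm_num)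
  have h3 := torVal_eq_zero_of_two_mul_lt h.inv hw hψ (x := d) (y := 0) (z := 1) (by norm_num)
  simp only [smul_eq_mul, zero_add, h2, h3] at h1
  rw [h1]
  ring

theorem whittaker_recursion_B (h : IsHeckeEigen w e₁ e₂ ω) (hw : IsEquivariant ψ w)
    (hψ : IsUnramified ψ) {d : ℤ} (hd : 0 ≤ d) : e₁ * torVal w (evalOne p) (d + 1) 1 1 =
      ω * ((p : ℂ) ^ 3 * torVal w (evalOne p) (d + 1) 1 0 +
        (p : ℂ) ^ 2 * torVal w (evalOne p) (d + 1) 0 0 + p * torVal w (evalOne p) d 1 0 +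
        torVal w (evalOne p) d 0 0) := by
  have h1 := h.recursion_one (hw.unipInvariant hψ) (x := d + 1) (y := 1) (z := 1) (by omega)
    (by norm_num)
  have h2 := h.torVal_center (evalOne p) (d + 1) 1 0
  have h3 := h.torVal_center (evalOne p) (d + 1) 0 0
  have h4 := h.torVal_center (evalOne p) d 1 0
  have h5 := h.torVal_center (evalOne p) d 0 0
  norm_num at h1 h2 h3 h4 h5
  rw [h1, h2, h3, h4, h5]
  ring

/-- The coordinate `d` does not enter the character, so the `d`-family counts `p - 1`; the character
sum over the `e`-family is `-1`, with weight `p`. Together they give the coefficient `-1`. -/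
theorem whittaker_recursion_C (h : IsHeckeEigen w e₁ e₂ ω) (hw : IsEquivariant ψ w)
    (hψ : IsUnramified ψ) {d : ℤ} (hd : 0 ≤ d) : e₂ * torVal w (evalOne p) d 0 0 =
      ω * ((p : ℂ) ^ 4 * torVal w (evalOne p) (d + 1) 0 0 +
        (p : ℂ) ^ 3 * torVal w (evalOne p) d 1 0 + torVal w (evalOne p) (d - 1) 0 0 -
        torVal w (evalOne p) d 0 0) := by
  have h1 := h.recursion_two (hw.unipInvariant hψ) (x := d) (y := 0) (z := 0) hd (by norm_num)
  have h2 := h.torVal_center (evalOne p) (d + 1) 0 0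
  have h3 := h.torVal_center (evalOne p) d 1 0
  have h4 := h.torVal_center (evalOne p) (d - 1) 0 0
  have h5 := torVal_eq_zero_of_two_mul_lt h.inv hw hψ (x := d + 1) (y := 0) (z := 2) (by norm_num)
  simp only [evalOne_tor_unip hw, mul_zero, add_zero, sub_zero, zpow_zero, one_mul, zero_add,
    AddChar.map_zero_eq_one, ← Finset.sum_mul, hψ.sum_nonzeroRes, Finset.sum_const,
    Finset.card_univ, ← Nat.cast_smul_eq_nsmul ℂ, card_nonzeroRes] at h1
  norm_num [add_assoc] at h1 h2 h3 h4 h5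
  rw [h1, h2, h3, h4, h5]
  ring

end Whittaker

end KlingenTrace

namespace KlingenTrace

/-! ### Hecke eigenvalues in terms of Satake parameters -/

section Eigenvalues

variable {p : ℕ} [Fact p.Prime] {φ : G p → ℂ} {a b c d : ℂ}

theorem IsSphericalSection.apply_unip_mul_tor {a₁ a₂ s : ℂ} (hφ : IsSphericalSection a₁ a₂ s φ)
    (b c d e : ℚ_[p]) (x y z : ℤ) : φ (unip b c d e * tor p x y z) =
      ((Real.sqrt p : ℝ) : ℂ) ^ (3 * z - 4 * x - 2 * y) * (a₁ ^ x * a₂ ^ y * s ^ z) := by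
  have hp := p_ne_zero p
  have h1 : InBorel (unip b c d e * tor p x y z) := by
    intro i j hij
    rw [mat_unip_mul_tor]
    fin_cases i <;> fin_cases j <;> simp at hij ⊢
  have h2 := hφ _ h1 1 (one_mem _)
  rw [mul_one] at h2
  rw [h2, inducingCharacter]
  simp only [mat_unip_mul_tor, of_apply, cons_val', cons_val_zero, cons_val_one, cons_val]
  rw [← zpow_add₀ hp, Padic.valuation_zpow, Padic.valuation_zpow, Padic.valuation_zpow,
    Padic.valuation_p]
  norm_num

theorem IsSphericalSection.isInvariant {a₁ a₂ s : ℂ} (hφ : IsSphericalSection a₁ a₂ s φ) :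
    IsInvariant (K p) φ := by
  intro k hk
  funext g
  obtain ⟨b, c, d, e, x, y, z, k', hk', rfl⟩ := iwasawa g
  have h1 : InBorel (unip b c d e * tor p x y z) := by
    intro i j hij
    rw [mat_unip_mul_tor]
    fin_cases i <;> fin_cases j <;> simp at hij ⊢
  rw [translate, mul_assoc, hφ _ h1 _ (mul_mem hk' hk), hφ _ h1 _ hk']

theorem commute_tor_112 (g : G p) : Commute g (tor p 1 1 2) := by
  apply GSp4.ext_mat
  rw [mat_mul, mat_mul, mat_tor_eq_diagonal]
  ext i j
  rw [mul_diagonal, diagonal_mul, mul_comm]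
  congr 1
  fin_cases i <;> fin_cases j <;> rfl

theorem finsum_orbit_tor_112 (f : G p ⧸ K p → ℂ) :
    ∑ᶠ q ∈ MulAction.orbit (K p) ((tor p 1 1 2 : G p) : G p ⧸ K p), f q =
      ∑ _i : Unit, f ((tor p 1 1 2 : G p) : G p ⧸ K p) := by
  have h : MulAction.orbit (K p) ((tor p 1 1 2 : G p) : G p ⧸ K p) =
      {((tor p 1 1 2 : G p) : G p ⧸ K p)} := by
    ext q
    constructor
    · rintro ⟨⟨k, hk⟩, rfl⟩
      change ((k * tor p 1 1 2 : G p) : G p ⧸ K p) = _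
      rw [(commute_tor_112 k).eq, eq_comm, QuotientGroup.eq, inv_mul_cancel_left]
      exact hk
    · rintro rfl
      exact MulAction.mem_orbit_self _
  rw [h, finsum_mem_singleton]
  simp

theorem sqrt_sq : ((Real.sqrt p : ℝ) : ℂ) ^ 2 = p := by
  rw [← Complex.ofReal_pow, Real.sq_sqrt (Nat.cast_nonneg p), Complex.ofReal_natCast]

theorem sqrt_ne_zero : ((Real.sqrt p : ℝ) : ℂ) ≠ 0 := by
  have h := sqrt_sq (p := p)
  intro h0
  rw [h0] at h
  exact (Fact.out : p.Prime).ne_zero (by exact_mod_cast (by simpa using h.symm : (p : ℂ) = 0))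

theorem sum_heckeRepOne (hφ : IsSphericalSection (c / a) (b / a) a φ) (ha : a ≠ 0)
    (h : a * d = b * c) :
    ∑ i, φ (heckeRepOne p i) = ((Real.sqrt p : ℝ) : ℂ) ^ 3 * (a + b + c + d) := by
  have hs := sqrt_sq (p := p)
  have hs0 := sqrt_ne_zero (p := p)
  have hd : d = b * c / a := by field_simp; linear_combination h
  simp only [Fintype.sum_sum_type, heckeRepOne, Sum.elim_inl, Sum.elim_inr, hφ.apply_unip_mul_tor,
    Finset.sum_const, Finset.card_univ, Fintype.card_prod, Fintype.card_fin, Fintype.card_unit,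
    nsmul_eq_mul, Nat.cast_mul, ← hs, hd]
  generalize ((Real.sqrt p : ℝ) : ℂ) = s at *
  norm_num [zpow_ofNat]
  field_simp
  ring

/-- Each of the first four families gives `p²` times one of the products `cd, bd, ac, ab`; the last
two have `(p - 1) + p(p - 1) = p² - 1` members of central type. -/
theorem sum_heckeRepTwo (hφ : IsSphericalSection (c / a) (b / a) a φ) (ha : a ≠ 0)
    (h : a * d = b * c) :
    ∑ i, φ (heckeRepTwo p i) =
      (p : ℂ) ^ 2 * (a * b + a * c + b * d + c * d) + ((p : ℂ) ^ 2 - 1) * (a * d) := by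
  have hs := sqrt_sq (p := p)
  have hs0 := sqrt_ne_zero (p := p)
  have hd : d = b * c / a := by field_simp; linear_combination h
  simp only [Fintype.sum_sum_type, heckeRepTwo, Sum.elim_inl, Sum.elim_inr, hφ.apply_unip_mul_tor,
    Finset.sum_const, Finset.card_univ, Fintype.card_prod, Fintype.card_fin, Fintype.card_unit,
    nsmul_eq_mul, Nat.cast_mul, card_nonzeroRes, Nat.cast_pow, ← hs, hd]
  generalize ((Real.sqrt p : ℝ) : ℂ) = s at *
  norm_num [zpow_ofNat]
  field_simp
  ring

theorem isHeckeEigen_of {W : Submodule ℂ (G p → ℂ)} {r₁ r₂ : ℕ} {α β γ δ : ℂ}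
    (hparam : HasHeckeParameters W r₁ r₂ α β γ δ) {w : finFns p} (hw : (w : G p → ℂ) ∈ W)
    (hK : ∀ k ∈ K p, k • w = w) {s : ℂ} (hs : s = ((Real.sqrt p : ℝ) : ℂ) ^ (r₁ + r₂ + 3)) :
    IsHeckeEigen w (((Real.sqrt p : ℝ) : ℂ) ^ 3 * (α / s + β / s + γ / s + δ / s))
      ((p : ℂ) ^ 2 * (α / s * (β / s) + α / s * (γ / s) + β / s * (δ / s) + γ / s * (δ / s)) +
        ((p : ℂ) ^ 2 - 1) * (α / s * (δ / s))) (α / s * (δ / s)) := by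
  obtain ⟨φ, hφ, hev⟩ := hparam.eigenvalues
  obtain ⟨hα, hβ, hγ, hδ⟩ := hparam.ne_zero
  have hs0 : s ≠ 0 := hs ▸ pow_ne_zero _ sqrt_ne_zero
  have hmul : α / s * (δ / s) = β / s * (γ / s) := by
    have := hparam.mul_eq
    field_simp
    exact this
  rw [← hs] at hφ
  have hφ' : IsSphericalSection (γ / s / (α / s)) (β / s / (α / s)) (α / s) φ := by
    rwa [div_div_div_cancel_right₀ hs0, div_div_div_cancel_right₀ hs0]
  have ha : α / s ≠ 0 := div_ne_zero hα hs0
  have hinv : IsInvariant (K p) (w : G p → ℂ) := isInvariant_iff.mpr hK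
  -- The Hecke eigenvalue is the value at `1` of the operator applied to `φ`, hence a sum of values
  -- of `φ` at the representatives.
  have key : ∀ {ι : Type} [Fintype ι] {g : G p} (r : ι → G p)
      (_ : ∀ f : G p ⧸ K p → ℂ, ∑ᶠ q ∈ MulAction.orbit (K p) (g : G p ⧸ K p), f q =
        ∑ i, f (r i : G p ⧸ K p)), ∑ i, r i • w = (∑ i, φ (r i)) • w := by
    intro ι _ g r hr
    have h1 := hev g w hw hinv
    apply Subtype.ext
    funext x
    have h2 := congrFun h1 x
    rw [doubleCosetOp_K_eq_sum r hr hinv, Pi.smul_apply,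
      doubleCosetOp_K_eq_sum r hr hφ.isInvariant] at h2
    simp only [one_mul] at h2
    rw [AddSubmonoidClass.coe_finsetSum, Finset.sum_apply]
    exact h2
  refine ⟨hK, ?_, ?_, ?_⟩
  · rw [key _ finsum_orbit_tor_111, sum_heckeRepOne hφ' ha hmul]
  · rw [key _ finsum_orbit_tor_212, sum_heckeRepTwo hφ' ha hmul]
  · have h1 := key (fun _ : Unit => tor p 1 1 2) finsum_orbit_tor_112
    have h2 := hφ'.apply_unip_mul_tor 0 0 0 0 1 1 2
    rw [unip_zero, one_mul] at h2
    simp only [Finset.univ_unique, Finset.sum_singleton, h2] at h1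
    rw [h1]
    congr 1
    norm_num
    field_simp
    linear_combination -hparam.mul_eq

end Eigenvalues

end KlingenTrace

namespace KlingenTrace

/-! ### Elimination in the recursions -/

section Algebra

variable {q a b c d e₁ e₂ ω : ℂ}

/-- The Hecke eigenvalues in terms of the (normalised) Satake parameters. -/
structure SatakeRelation (q a b c d e₁ e₂ ω : ℂ) : Prop where
  sq : e₁ ^ 2 = q ^ 3 * (a + b + c + d) ^ 2
  two : e₂ = q ^ 2 * (a * b + a * c + b * d + c * d) + (q ^ 2 - 1) * (a * d)
  center : ω = a * d
  mul_eq : a * d = b * c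

/-- Eliminating `B` and `C` leaves a recursion for `A` alone. The eigenvalue `e₁` enters only
through its square, so no square root of `q` is needed. The coefficients are the elementary
symmetric functions of `ab, ac, bd, cd`, simplified by `ad = bc`. -/
theorem SatakeRelation.quartic (h : SatakeRelation q a b c d e₁ e₂ ω) {A B C : ℕ → ℂ}
    (hA : ∀ k, e₁ * A k = (q ^ 3 + q ^ 2) * B (k + 1) + (q + 1) * B k)
    (hB : ∀ k, e₁ * B (k + 1) = ω * (q ^ 3 * C (k + 1) + q ^ 2 * A (k + 1) + q * C k + A k))
    (hC : ∀ k, e₂ * A (k + 1) =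
      ω * (q ^ 4 * A (k + 2) + (q ^ 3 + q ^ 2) * C (k + 1) + A k + (q - 1) * A (k + 1))) :
    (q ^ 2 * ω) ^ 4 * A 4 - (a * b + a * c + b * d + c * d) * ((q ^ 2 * ω) ^ 3 * A 3) +
      ω * (a ^ 2 + b ^ 2 + c ^ 2 + d ^ 2 + 2 * ω) * ((q ^ 2 * ω) ^ 2 * A 2) -
      (a * b + a * c + b * d + c * d) * ω ^ 2 * (q ^ 2 * ω * A 1) + ω ^ 4 * A 0 = 0 := by
  obtain ⟨h1, rfl, rfl, h4⟩ := h
  linear_combination (a * d) ^ 3 * (q * e₁ * hA 2 + q * (q ^ 3 + q ^ 2) * hB 2 +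
    q * (q + 1) * hB 1 - q ^ 4 * hC 2 - 2 * q ^ 2 * hC 1 - hC 0) -
    (a * d) ^ 3 * q * A 2 * h1 + 2 * (a * d) ^ 3 * q ^ 4 * A 2 * h4

/-- The initial values determine `A 1`, `A 2` and `A 3` successively. The relation `hC'` stands for
`hC` at index `-1`, with `A (-1) = 0`. -/
theorem SatakeRelation.whittaker (h : SatakeRelation q a b c d e₁ e₂ ω) {A B C : ℕ → ℂ}
    (hq : q ≠ 0) (hω : ω ≠ 0) (hA0 : A 0 = 1) (hB0 : B 0 = 0) (hC0 : C 0 = 0)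
    (hA : ∀ k, e₁ * A k = q ^ 3 * B (k + 1) + q * B k)
    (hB : ∀ k, e₁ * B (k + 1) = ω * (q ^ 3 * C (k + 1) + q ^ 2 * A (k + 1) + q * C k + A k))
    (hC : ∀ k, e₂ * A (k + 1) =
      ω * (q ^ 4 * A (k + 2) + q ^ 3 * C (k + 1) + A k - A (k + 1)))
    (hC' : e₂ * A 0 = ω * (q ^ 4 * A 1 - A 0)) :
    (q ^ 2 * ω) ^ 3 * A 3 - (a * c + b * d + c * d) * ((q ^ 2 * ω) ^ 2 * A 2) +
      (a * c * (b * d) + a * c * (c * d) + b * d * (c * d)) * (q ^ 2 * ω * A 1) -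
      a * c * (b * d) * (c * d) * A 0 = a ^ 2 * b ^ 3 * (a + c) := by
  obtain ⟨h1, h2, h3, h4⟩ := h
  have hq2 := pow_ne_zero 2 hq
  have hq3 := pow_ne_zero 3 hq
  set S := a + b + c + d with hS
  set σ := a * b + a * c + b * d + c * d with hσ
  have h2' : e₂ + ω = q ^ 2 * (σ + ω) := by rw [h2, h3]; ring
  have x1 : q ^ 2 * ω * A 1 = σ + ω := by
    refine mul_left_cancel₀ hq2 ?_
    linear_combination -hC' + h2' + (e₂ + ω) * hA0
  have y1 : q ^ 3 * B 1 = e₁ := by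
    have := hA 0
    rw [hB0, hA0] at this
    linear_combination -this
  have y1' : e₁ * B 1 = S ^ 2 := by
    refine mul_left_cancel₀ hq3 ?_
    linear_combination e₁ * y1 + h1
  have z1 : ω * q ^ 3 * C 1 = S ^ 2 - q ^ 2 * ω * A 1 - ω := by
    have := hB 0
    rw [hC0, hA0] at this
    linear_combination -this + y1'
  have x2 : (q ^ 2 * ω) ^ 2 * A 2 =
      (σ + ω) * (q ^ 2 * ω * A 1) - ω * (S ^ 2 - q ^ 2 * ω * A 1 - ω) - ω ^ 2 := by
    linear_combination -ω * hC 0 + ω * A 1 * h2' - ω * z1 - ω ^ 2 * hA0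
  have y2 : q ^ 2 * ω * (e₁ * B 2) = S ^ 2 * (q ^ 2 * ω * A 1) - ω * S ^ 2 := by
    refine mul_left_cancel₀ hq ?_
    linear_combination -ω * e₁ * hA 1 + ω * A 1 * h1 - ω * q * y1'
  have z2 : q ^ 5 * ω ^ 2 * C 2 = S ^ 2 * (q ^ 2 * ω * A 1) - ω * S ^ 2 - (q ^ 2 * ω) ^ 2 * A 2 -
      ω * (S ^ 2 - q ^ 2 * ω * A 1 - ω) - ω * (q ^ 2 * ω * A 1) := by
    linear_combination y2 - q ^ 2 * ω * hB 1 - ω * z1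
  have x3 : (q ^ 2 * ω) ^ 3 * A 3 = (σ + ω) * ((q ^ 2 * ω) ^ 2 * A 2) -
      ω * (q ^ 5 * ω ^ 2 * C 2) - ω ^ 2 * (q ^ 2 * ω * A 1) := by
    linear_combination -q ^ 2 * ω ^ 2 * hC 1 + q ^ 2 * ω ^ 2 * A 2 * h2'
  rw [x3, z2, x2, x1, hA0, hσ, hS, h3]
  have ha : a ≠ 0 := by rintro rfl; simp [h3] at hω
  have hd : d = b * c / a := by field_simp; linear_combination h4
  rw [hd]
  field_simp
  ring

/-- The Weyl relations express everything through `A 0`. The factors `n = q³ + q² + q + 1` and `q +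
1` are carried along instead of being divided out; only `q`, which is nonzero, gets cancelled. -/
theorem SatakeRelation.spherical (h : SatakeRelation q a b c d e₁ e₂ ω) {A B C : ℕ → ℂ}
    (hq : q ≠ 0) (hω : ω ≠ 0)
    (hA : ∀ k, e₁ * A k = (q ^ 3 + q ^ 2) * B (k + 1) + (q + 1) * B k)
    (hB : ∀ k, e₁ * B (k + 1) = ω * (q ^ 3 * C (k + 1) + q ^ 2 * A (k + 1) + q * C k + A k))
    (hC : ∀ k, e₂ * A (k + 1) =
      ω * (q ^ 4 * A (k + 2) + (q ^ 3 + q ^ 2) * C (k + 1) + A k + (q - 1) * A (k + 1)))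
    (hA' : e₁ * A 0 = (q ^ 3 + q ^ 2 + q + 1) * B 1) (hB' : C 0 = A 1)
    (hC' : e₂ * A 0 = ω * (q ^ 4 + q ^ 3 + q ^ 2 + q) * A 1) :
    (q ^ 3 + q ^ 2 + q + 1) * ((q ^ 2 * ω) ^ 3 * A 3 -
      (a * c + b * d + c * d) * ((q ^ 2 * ω) ^ 2 * A 2) +
      (a * c * (b * d) + a * c * (c * d) + b * d * (c * d)) * (q ^ 2 * ω * A 1) -
      a * c * (b * d) * (c * d) * A 0) =
    a * b * (a + c) * (q * b - c) * (q * a - d) * (q * b - d) * A 0 := by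
  obtain ⟨h1, h2, h3, h4⟩ := h
  set S := a + b + c + d with hS
  set σ := a * b + a * c + b * d + c * d with hσ
  set n := q ^ 3 + q ^ 2 + q + 1 with hn
  have x1 : n * q * ω * A 1 = e₂ * A 0 := by rw [hn]; linear_combination -hC'
  have y1 : n * (e₁ * B 1) = q ^ 3 * S ^ 2 * A 0 := by
    linear_combination -e₁ * hA' + A 0 * h1
  have z1 : n * ω * q ^ 3 * C 1 = (q ^ 3 * S ^ 2 - (q + 1) * e₂ - n * ω) * A 0 := by
    linear_combination -n * hB 0 + y1 - (q + 1) * x1 - n * ω * q * hB'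
  have x2 : n * q ^ 5 * ω ^ 2 * A 2 = (e₂ ^ 2 - ω * (q + 1) * (q ^ 3 * S ^ 2 - (q + 1) * e₂ - n * ω) -
      q * n * ω ^ 2 - ω * (q - 1) * e₂) * A 0 := by
    linear_combination -n * q * ω * hC 0 + (e₂ - ω * (q - 1)) * x1 - ω * (q + 1) * z1
  have y2 : (q + 1) * n * ω * (e₁ * B 2) = (S ^ 2 * e₂ - (q + 1) * ω * q * S ^ 2) * A 0 := by
    refine mul_left_cancel₀ (pow_ne_zero 3 hq) ?_
    linear_combination -n * ω * q * e₁ * hA 1 + n * ω * q * A 1 * h1 + q ^ 3 * S ^ 2 * x1 -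
      (q + 1) * ω * q * y1
  have z2 : (q + 1) * n * ω ^ 2 * q ^ 6 * C 2 = q ^ 3 * (S ^ 2 * e₂ - (q + 1) * ω * q * S ^ 2) * A 0 -
      (q + 1) * (n * q ^ 5 * ω ^ 2 * A 2) - (q + 1) * q * ω * (n * ω * q ^ 3 * C 1) -
      (q + 1) * q ^ 2 * ω * (n * q * ω * A 1) := by
    linear_combination q ^ 3 * y2 - (q + 1) * n * ω * q ^ 3 * hB 1
  have x3 : n * q ^ 9 * ω ^ 3 * A 3 = (e₂ - ω * (q - 1)) * (n * q ^ 5 * ω ^ 2 * A 2) -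
      ω * q * ((q + 1) * n * ω ^ 2 * q ^ 6 * C 2) - q ^ 4 * ω ^ 2 * (n * q * ω * A 1) := by
    linear_combination -n * q ^ 5 * ω ^ 2 * hC 1
  have ha : a ≠ 0 := by rintro rfl; simp [h3] at hω
  have hd : d = b * c / a := by field_simp; linear_combination h4
  refine mul_left_cancel₀ (pow_ne_zero 3 hq) ?_
  calc _ = n * q ^ 9 * ω ^ 3 * A 3 - (a * c + b * d + c * d) * q ^ 2 * (n * q ^ 5 * ω ^ 2 * A 2) +
      (a * c * (b * d) + a * c * (c * d) + b * d * (c * d)) * q ^ 4 * (n * q * ω * A 1) -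
      q ^ 3 * n * (a * c * (b * d) * (c * d) * A 0) := by ring
    _ = _ := by
      rw [x3, z2, z1, x2, x1, h2, hn, hσ, hS, h3, hd]
      field_simp
      ring

end Algebra

end KlingenTrace

namespace KlingenTrace

/-! ### The operator `U` and the averages over `K` and `Q` -/

section Operators

variable {p : ℕ} [Fact p.Prime] {w : finFns p} {e₁ e₂ ω : ℂ} {ψ : AddChar ℚ_[p] ℂ}

theorem finite_orbit_Q (v : finFns p) : (MulAction.orbit (Q p) v).Finite :=
  finite_orbit_of_le Q_le_K (finite_orbit_finFns v)

variable (p) in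
/-- Averaging over `K`. -/
noncomputable def avgK : finFns p →ₗ[ℂ] finFns p := avgL (K p) finite_orbit_finFns

variable (p) in
/-- Averaging over the integral points of the Klingen parabolic. -/
noncomputable def avgQ : finFns p →ₗ[ℂ] finFns p := avgL (Q p) finite_orbit_Q

variable (p) in
/-- The unnormalised operator `U_{2,Kl}`. -/
noncomputable def opU : finFns p →ₗ[ℂ] finFns p :=
  avgQ p ∘ₗ DistribSMul.toLinearMap ℂ (finFns p) (tor p 2 1 2)

theorem opU_apply (v : finFns p) : opU p v = avgQ p (tor p 2 1 2 • v) := rfl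

theorem avgK_smul {k : G p} (hk : k ∈ K p) (v : finFns p) : avgK p (k • v) = avgK p v :=
  avg_smul_mem hk v

theorem avgQ_smul {k : G p} (hk : k ∈ Q p) (v : finFns p) : avgQ p (k • v) = avgQ p v :=
  avg_smul_mem hk v

theorem avgQ_eq_self {v : finFns p} (hv : ∀ k ∈ Q p, k • v = v) : avgQ p v = v :=
  avg_eq_self hv

theorem avgK_eq_self {v : finFns p} (hv : ∀ k ∈ K p, k • v = v) : avgK p v = v :=
  avg_eq_self hv

theorem avgK_avgQ (v : finFns p) : avgK p (avgQ p v) = avgK p v :=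
  map_avg_eq (finite_orbit_Q v) (avgK p) fun _ hk => avgK_smul (Q_le_K hk) v

/-- `U` absorbs averages. -/
theorem opU_avgQ (v : finFns p) : opU p (avgQ p v) = opU p v := by
  refine map_avg_eq (finite_orbit_Q v) (opU p) fun q hq => ?_
  -- Write `t q = (t q t⁻¹) t`; the first factor lies in `Q` and is absorbed by the outer average.
  rw [opU_apply, opU_apply, ← avgQ_smul (tor_conj_mem_Q hq) (tor p 2 1 2 • v), ← mul_smul,
    ← mul_smul, inv_mul_cancel_right]

theorem invariantUnder_avgK {Y : Type*} [AddCommGroup Y] [Module ℂ Y] (l : finFns p →ₗ[ℂ] Y) :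
    InvariantUnder (K p) w (l ∘ₗ avgK p) := fun k hk g => by
  rw [LinearMap.comp_apply, LinearMap.comp_apply, avgK_smul hk]

theorem invariantUnder_avgQ {Y : Type*} [AddCommGroup Y] [Module ℂ Y] (l : finFns p →ₗ[ℂ] Y) :
    InvariantUnder (Q p) w (l ∘ₗ avgQ p) := fun k hk g => by
  rw [LinearMap.comp_apply, LinearMap.comp_apply, avgQ_smul hk]

/-- The element `t` is central times `diag(p, 1, 1, p⁻¹)`, so `U` raises `x` by one and contributes
`ω`. -/
theorem opU_torVal (h : IsHeckeEigen w e₁ e₂ ω) (x y z : ℤ) :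
    opU p (torVal w (avgQ p) x y z) = ω • torVal w (avgQ p) (x + 1) y z := by
  rw [torVal, opU_avgQ, opU_apply, ← mul_smul, tor_mul, ← h.torVal_center, torVal]
  congr 3 <;> ring

theorem torVal_avgQ_zero (h : IsHeckeEigen w e₁ e₂ ω) : torVal w (avgQ p) 0 0 0 = w := by
  rw [torVal, tor_zero, one_smul, avgQ_eq_self fun k hk => h.inv k (Q_le_K hk)]

theorem opU_pow (h : IsHeckeEigen w e₁ e₂ ω) (k : ℕ) :
    (opU p ^ k) w = ω ^ k • torVal w (avgQ p) k 0 0 := by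
  induction k with
  | zero => simp [torVal_avgQ_zero h]
  | succ k ih =>
    rw [pow_succ', Module.End.mul_apply, ih, map_smul, opU_torVal h, smul_smul, pow_succ]
    push_cast
    rfl

theorem tor_nat (k : ℕ) : tor p k 0 0 = (tor p 2 1 2 * (tor p 1 1 2)⁻¹) ^ k := by
  induction k with
  | zero => simp [tor_zero]
  | succ k ih =>
    rw [pow_succ, ← ih, tor_inv, tor_mul, tor_mul]
    norm_num

/-- Although evaluation at `1` is not `Q`-invariant, it does not see the `Q`-average here: the Levi
part of `q` commutes with the torus element and fixes `w`, and `ψ` is trivial on the unipotent part.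
-/
theorem evalOne_avgQ_tor (h : IsHeckeEigen w e₁ e₂ ω) (hw : IsEquivariant ψ w)
    (hψ : IsUnramified ψ) (k : ℕ) :
    evalOne p (torVal w (avgQ p) k 0 0) = torVal w (evalOne p) k 0 0 := by
  refine map_avg_eq (finite_orbit_Q _) (evalOne p) fun q hq => ?_
  obtain ⟨b, hb, c, hc, d, hd, m, hm, rfl, hmt⟩ := exists_eq_unip_mul_levi hq
  have hcomm : Commute m (tor p k 0 0) := by
    rw [tor_nat]
    exact (Commute.mul_right hmt (commute_tor_112 m).inv_right).pow_right k
  rw [mul_smul, ← mul_smul m, hcomm.eq, mul_smul, h.inv m (Q_le_K hm),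
    hw.unipInvariant hψ b hb c hc d hd 0 (zero_mem _), torVal]

end Operators

/-! ### The eigenvector: its value at `1` and its `K`-average -/

section Eigenvector

variable {p : ℕ} [Fact p.Prime] {w : finFns p} {e₁ e₂ ω a b c d : ℂ} {ψ : AddChar ℚ_[p] ℂ}

variable (p) in
/-- Evaluation at `g`. -/
noncomputable def evalAt (g : G p) : finFns p →ₗ[ℂ] ℂ := LinearMap.proj g ∘ₗ (finFns p).subtype

theorem ext_evalAt {v v' : finFns p} (h : ∀ g, evalAt p g v = evalAt p g v') : v = v' :=
  Subtype.ext (funext h)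

theorem torVal_comp {Y : Type*} [AddCommGroup Y] [Module ℂ Y] (l : finFns p →ₗ[ℂ] Y)
    (m : finFns p →ₗ[ℂ] finFns p) (x y z : ℤ) :
    torVal w (l ∘ₗ m) x y z = l (torVal w m x y z) := rfl

/-- The quartic recursion, tested with evaluation at each `g` after the `Q`-average. The
coefficients are grouped as `(X - ab)` times the cubic with roots `ac, bd, cd`, ready for splitting
off the first factor. -/
theorem quartic_opU (h : IsHeckeEigen w e₁ e₂ ω) (hs : SatakeRelation p a b c d e₁ e₂ ω) :
    ((p : ℂ) ^ 2) ^ 4 • (opU p ^ 4) w -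
      ((a * b + (a * c + b * d + c * d)) * ((p : ℂ) ^ 2) ^ 3) • (opU p ^ 3) w +
      ((a * b * (a * c + b * d + c * d) + (a * c * (b * d) + a * c * (c * d) + b * d * (c * d))) *
        ((p : ℂ) ^ 2) ^ 2) • (opU p ^ 2) w -
      ((a * b * (a * c * (b * d) + a * c * (c * d) + b * d * (c * d)) + a * c * (b * d) * (c * d)) *
        (p : ℂ) ^ 2) • (opU p) w + (a * b * (a * c * (b * d) * (c * d))) • w = 0 := by
  refine ext_evalAt fun g => ?_
  have hl := invariantUnder_avgQ (w := w) (evalAt p g)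
  have := hs.quartic (A := fun k => torVal w (evalAt p g ∘ₗ avgQ p) k 0 0)
    (B := fun k => torVal w (evalAt p g ∘ₗ avgQ p) k 1 1)
    (C := fun k => torVal w (evalAt p g ∘ₗ avgQ p) k 1 0)
    (fun k => by simpa using klingen_recursion_A h hl (Int.natCast_nonneg k))
    (fun k => by simpa using klingen_recursion_B h hl (Int.natCast_nonneg k))
    (fun k => by simpa using klingen_recursion_C h hl (Int.natCast_nonneg k))
  have h1 : opU p w = (opU p ^ 1) w := by rw [pow_one]
  have h0 : w = (opU p ^ 0) w := by simp
  nth_rewrite 5 [h0]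
  rw [h1]
  simp only [opU_pow h, map_add, map_sub, map_smul, map_zero, smul_eq_mul, ← torVal_comp]
  obtain rfl := hs.center
  set A := fun k : ℕ => torVal w (evalAt p g ∘ₗ avgQ p) (k : ℤ) 0 0 with hA
  linear_combination this + ((p : ℂ) ^ 2 * (a * d)) * ((a * b + a * c + b * d + c * d) * (a * d) *
    A 1 - (p : ℂ) ^ 2 * (a * d) * (a ^ 2 + d ^ 2 + 2 * a * d) * A 2) * hs.mul_eq -
    (a * d) ^ 2 * (a * d + b * c) * A 0 * hs.mul_eq

/-- The Klingen eigenvector before normalisation. -/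
noncomputable def eigenvec (w : finFns p) (a b c d : ℂ) : finFns p :=
  ((p : ℂ) ^ 2) ^ 3 • (opU p ^ 3) w - ((a * c + b * d + c * d) * ((p : ℂ) ^ 2) ^ 2) • (opU p ^ 2) w +
    ((a * c * (b * d) + a * c * (c * d) + b * d * (c * d)) * (p : ℂ) ^ 2) • (opU p) w -
    (a * c * (b * d) * (c * d)) • w

theorem opU_eigenvec (h : IsHeckeEigen w e₁ e₂ ω) (hs : SatakeRelation p a b c d e₁ e₂ ω) :
    (p : ℂ) ^ 2 • opU p (eigenvec w a b c d) = (a * b) • eigenvec w a b c d := by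
  rw [← sub_eq_zero, ← quartic_opU h hs, eigenvec]
  simp only [map_add, map_sub, map_smul, ← Module.End.mul_apply, ← pow_succ', ← pow_two]
  module

theorem evalOne_eigenvec (h : IsHeckeEigen w e₁ e₂ ω) (hs : SatakeRelation p a b c d e₁ e₂ ω)
    (hω : ω ≠ 0) (hw : IsEquivariant ψ w) (hψ : IsUnramified ψ) (hw1 : evalOne p w = 1) :
    evalOne p (eigenvec w a b c d) = a ^ 2 * b ^ 3 * (a + c) := by
  have hp : (p : ℂ) ≠ 0 := by exact_mod_cast (Fact.out : p.Prime).ne_zero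
  rw [← hs.whittaker (A := fun k => torVal w (evalOne p) k 0 0)
    (B := fun k => torVal w (evalOne p) k 1 1) (C := fun k => torVal w (evalOne p) k 1 0) hp hω
    (by simpa [torVal, tor_zero] using hw1)
    (torVal_eq_zero_of_lt h.inv hw hψ (by norm_num))
    (torVal_eq_zero_of_lt h.inv hw hψ (by norm_num))
    (fun k => by simpa using whittaker_recursion_A h hw hψ (Int.natCast_nonneg k))
    (fun k => by simpa using whittaker_recursion_B h hw hψ (Int.natCast_nonneg k))
    (fun k => by
      have := whittaker_recursion_C h hw hψ (d := k + 1) (by omega)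
      rw [add_sub_cancel_right, add_assoc (k : ℤ)] at this
      exact_mod_cast this)
    (by
      have := whittaker_recursion_C h hw hψ (d := 0) le_rfl
      rw [torVal_eq_zero_of_lt h.inv hw hψ (x := 0) (y := 1) (z := 0) (by norm_num),
        torVal_eq_zero_of_lt h.inv hw hψ (x := 0 - 1) (y := 0) (z := 0) (by norm_num)] at this
      norm_num at this ⊢
      exact this)]
  have h1 : opU p w = (opU p ^ 1) w := by rw [pow_one]
  have h0 : w = (opU p ^ 0) w := by simp
  rw [eigenvec]
  nth_rewrite 4 [h0]
  rw [h1]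
  simp only [opU_pow h, map_add, map_sub, map_smul, smul_eq_mul, evalOne_avgQ_tor h hw hψ]
  ring

/-- Averaging over `K` absorbs the average over `Q` inside `U ^ k w`, so the `K`-invariant
recursions apply. -/
theorem avgK_eigenvec (h : IsHeckeEigen w e₁ e₂ ω) (hs : SatakeRelation p a b c d e₁ e₂ ω)
    (hω : ω ≠ 0) : ((p : ℂ) ^ 3 + p ^ 2 + p + 1) • avgK p (eigenvec w a b c d) =
      (a * b * (a + c) * (p * b - c) * (p * a - d) * (p * b - d)) • w := by
  have hp : (p : ℂ) ≠ 0 := by exact_mod_cast (Fact.out : p.Prime).ne_zero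
  refine ext_evalAt fun g => ?_
  have hK := invariantUnder_avgK (w := w) (evalAt p g)
  have hl := hK.mono Q_le_K
  have key := hs.spherical (A := fun k => torVal w (evalAt p g ∘ₗ avgK p) k 0 0)
    (B := fun k => torVal w (evalAt p g ∘ₗ avgK p) k 1 1)
    (C := fun k => torVal w (evalAt p g ∘ₗ avgK p) k 1 0) hp hω
    (fun k => by simpa using klingen_recursion_A h hl (Int.natCast_nonneg k))
    (fun k => by simpa using klingen_recursion_B h hl (Int.natCast_nonneg k))
    (fun k => by simpa using klingen_recursion_C h hl (Int.natCast_nonneg k))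
    (by simpa using spherical_recursion_A h hK)
    (by simpa using spherical_val h hK)
    (by simpa using spherical_recursion_C h hK)
  have h1 : opU p w = (opU p ^ 1) w := by rw [pow_one]
  have h2 : ∀ k : ℕ, evalAt p g (avgK p (torVal w (avgQ p) k 0 0)) =
      torVal w (evalAt p g ∘ₗ avgK p) k 0 0 := fun k => by
    rw [torVal, avgK_avgQ]; rfl
  have h0 : evalAt p g w = torVal w (evalAt p g ∘ₗ avgK p) (0 : ℕ) 0 0 := by
    rw [← h2, Nat.cast_zero, torVal_avgQ_zero h, avgK_eq_self h.inv]
  have h0' : evalAt p g (avgK p w) = torVal w (evalAt p g ∘ₗ avgK p) (0 : ℕ) 0 0 := by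
    rw [avgK_eq_self h.inv, h0]
  rw [eigenvec, h1]
  simp only [opU_pow h, map_add, map_sub, map_smul, smul_eq_mul, h2, h0, h0']
  linear_combination key

end Eigenvector

end KlingenTrace

namespace KlingenTrace

/-! ### Cyclic modules and saturation -/

section Cyclic

variable {V : Type*} [AddCommGroup V] [Module ℂ V]

open Polynomial in
/-- The cyclic `ℂ[X]`-submodule generated by `w`. -/
noncomputable def cyclic (T : Module.End ℂ V) (w : V) : Submodule ℂ V :=
  LinearMap.range (LinearMap.applyₗ w ∘ₗ (aeval T : ℂ[X] →ₐ[ℂ] Module.End ℂ V).toLinearMap)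

open Polynomial in
theorem mem_cyclic {T : Module.End ℂ V} {w v : V} :
    v ∈ cyclic T w ↔ ∃ q : ℂ[X], aeval T q w = v := Iff.rfl

open Polynomial in
theorem pow_mem_cyclic (T : Module.End ℂ V) (w : V) (k : ℕ) : (T ^ k) w ∈ cyclic T w :=
  mem_cyclic.mpr ⟨X ^ k, by simp⟩

open Polynomial in
theorem map_mem_cyclic {T : Module.End ℂ V} {w v : V} (hv : v ∈ cyclic T w) : T v ∈ cyclic T w := by
  obtain ⟨q, rfl⟩ := mem_cyclic.mp hv
  exact mem_cyclic.mpr ⟨X * q, by simp⟩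

open Polynomial in
/-- Eigenspaces of a cyclic module are at most one-dimensional. -/
theorem eigenvector_unique {T : Module.End ℂ V} {w v x : V} {μ : ℂ} (hv : v ∈ cyclic T w)
    (hx : x ∈ cyclic T w) (hTv : T v = μ • v) (hTx : T x = μ • x) (hx0 : x ≠ 0) :
    ∃ r : ℂ, v = r • x := by
  obtain ⟨q, rfl⟩ := mem_cyclic.mp hv
  obtain ⟨f, rfl⟩ := mem_cyclic.mp hx
  -- The annihilator of `w`, generated by `m`. An eigenvector represented by `g` satisfies `m ∣ (X -
  -- μ) g`.
  let I : Ideal ℂ[X] :=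
    { carrier := {g | aeval T g w = 0}
      zero_mem' := by simp
      add_mem' := fun {g h} hg hh => by
        simp only [Set.mem_ofPred_eq] at hg hh ⊢
        rw [map_add, LinearMap.add_apply, hg, hh, add_zero]
      smul_mem' := fun g h hh => by
        simp only [Set.mem_ofPred_eq] at hh ⊢
        rw [smul_eq_mul, map_mul, Module.End.mul_apply, hh, map_zero] }
  have hI : ∀ g, g ∈ I ↔ aeval T g w = 0 := fun g => Iff.rfl
  obtain ⟨m, hm⟩ := (IsPrincipalIdealRing.principal I).principal
  have hdvd : ∀ g, g ∈ I ↔ m ∣ g := fun g => by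
    rw [hm, Ideal.submodule_span_eq, Ideal.mem_span_singleton]
  have hmul : ∀ g, T (aeval T g w) = μ • aeval T g w → (X - C μ) * g ∈ I := by
    intro g hg
    rw [hI, map_mul, Module.End.mul_apply, map_sub, aeval_X, aeval_C, LinearMap.sub_apply, hg,
      Module.algebraMap_end_apply, sub_self]
  obtain ⟨a, ha⟩ := (hdvd _).mp (hmul q hTv)
  obtain ⟨b, hb⟩ := (hdvd _).mp (hmul f hTx)
  have hX : (X - C μ : ℂ[X]) ≠ 0 := X_sub_C_ne_zero μ
  -- Otherwise `X - μ` divides `b`, hence `m` divides `f` and `x = 0`.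
  have hbμ : b.eval μ ≠ 0 := by
    intro h
    obtain ⟨h', rfl⟩ := dvd_iff_isRoot.mpr h
    refine hx0 ((hI f).mp ((hdvd f).mpr ⟨h', mul_left_cancel₀ hX ?_⟩))
    rw [hb]; ring
  -- This combination of the cofactors acquires a factor `X - μ`; cancelling it shows that the same
  -- combination of `q` and `f` annihilates `w`.
  have hroot : (C (b.eval μ) * a - C (a.eval μ) * b).IsRoot μ := by
    simp [IsRoot, mul_comm]
  obtain ⟨h', hh⟩ := dvd_iff_isRoot.mpr hroot
  have hmem : C (b.eval μ) * q - C (a.eval μ) * f ∈ I := by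
    refine (hdvd _).mpr ⟨h', mul_left_cancel₀ hX ?_⟩
    linear_combination C (b.eval μ) * ha - C (a.eval μ) * hb + m * hh
  rw [hI] at hmem
  simp only [map_sub, map_mul, aeval_C, LinearMap.sub_apply, Module.End.mul_apply,
    Module.algebraMap_end_apply, sub_eq_zero] at hmem
  refine ⟨(b.eval μ)⁻¹ * a.eval μ, ?_⟩
  rw [mul_smul, ← hmem, smul_smul, inv_mul_cancel₀ hbμ, one_smul]

/-- The vectors that a power of `D` maps to the `D`-stable submodule `M`. -/
def saturation (D : Module.End ℂ V) (M : Submodule ℂ V) (hM : ∀ v ∈ M, D v ∈ M) :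
    Submodule ℂ V where
  carrier := {v | ∃ J : ℕ, (D ^ J) v ∈ M}
  zero_mem' := ⟨0, by simp⟩
  add_mem' := by
    have key : ∀ (k : ℕ) (v : V), v ∈ M → (D ^ k) v ∈ M := by
      intro k
      induction k with
      | zero => simp
      | succ k ih => intro v hv; rw [pow_succ', Module.End.mul_apply]; exact hM _ (ih v hv)
    rintro v v' ⟨i, hi⟩ ⟨j, hj⟩
    refine ⟨i + j, ?_⟩
    rw [map_add]
    refine M.add_mem ?_ ?_
    · rw [add_comm, pow_add]; exact key j _ hi
    · rw [pow_add]; exact key i _ hj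
  smul_mem' := by
    rintro r v ⟨i, hi⟩
    exact ⟨i, by rw [map_smul]; exact M.smul_mem r hi⟩

theorem mem_saturation_of_mem {D : Module.End ℂ V} {M : Submodule ℂ V} {hM : ∀ v ∈ M, D v ∈ M}
    {v : V} (hv : v ∈ M) : v ∈ saturation D M hM := ⟨0, hv⟩

theorem map_mem_saturation_iff {D : Module.End ℂ V} {M : Submodule ℂ V} {hM : ∀ v ∈ M, D v ∈ M}
    {v : V} : D v ∈ saturation D M hM ↔ v ∈ saturation D M hM := by
  constructor
  · rintro ⟨J, hJ⟩
    exact ⟨J + 1, by rwa [pow_succ, Module.End.mul_apply]⟩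
  · rintro ⟨J, hJ⟩
    refine ⟨J, ?_⟩
    rw [← Module.End.mul_apply, ← pow_succ, pow_succ', Module.End.mul_apply]
    exact hM _ hJ

/-- On an eigenvector with nonzero eigenvalue, powers of `D` can be undone. -/
theorem mem_of_mem_saturation {D : Module.End ℂ V} {M : Submodule ℂ V} {hM : ∀ v ∈ M, D v ∈ M}
    {v : V} (hv : v ∈ saturation D M hM) {μ : ℂ} (hμ : μ ≠ 0) (h : D v = μ • v) : v ∈ M := by
  have h1 : ∀ J : ℕ, (D ^ J) v = μ ^ J • v := by
    intro J
    induction J with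
    | zero => simp
    | succ J ih => rw [pow_succ, Module.End.mul_apply, h, map_smul, ih, smul_smul, pow_succ']
  obtain ⟨J, hJ⟩ := hv
  rw [h1] at hJ
  exact (M.smul_mem_iff (pow_ne_zero J hμ)).mp hJ

end Cyclic

end KlingenTrace

namespace KlingenTrace

/-! ### Eigenvectors of `U` lie in the cyclic module of the spherical vector -/

section Saturation

variable {p : ℕ} [Fact p.Prime] {w : finFns p} {e₁ e₂ ω : ℂ}

theorem IsHeckeEigen.torVal_center_zpow {Y : Type*} [AddCommGroup Y] [Module ℂ Y]
    (h : IsHeckeEigen w e₁ e₂ ω) (hω : ω ≠ 0) (l : finFns p →ₗ[ℂ] Y) (x y z m : ℤ) :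
    torVal w l (x + m) (y + m) (z + 2 * m) = ω ^ m • torVal w l x y z := by
  induction m using Int.induction_on with
  | zero => simp
  | succ m ih =>
    have := h.torVal_center l (x + m) (y + m) (z + 2 * m)
    rw [ih, smul_smul, ← zpow_one_add₀ hω] at this
    rw [add_comm (m : ℤ) 1, ← this]
    congr 1 <;> ring
  | pred m ih =>
    have := h.torVal_center l (x + (-m - 1)) (y + (-m - 1)) (z + 2 * (-m - 1))
    rw [zpow_sub_one₀ hω, mul_comm (ω ^ _) ω⁻¹, mul_smul, ← ih, eq_inv_smul_iff₀ hω, ← this]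
    congr 1 <;> ring

/-- The operator `p² ω⁻¹ U + 1`. -/
noncomputable def opD (p : ℕ) [Fact p.Prime] (ω : ℂ) : Module.End ℂ (finFns p) :=
  ((p : ℂ) ^ 2 * ω⁻¹) • opU p + 1

theorem opD_apply (v : finFns p) : opD p ω v = ((p : ℂ) ^ 2 * ω⁻¹) • opU p v + v := rfl

theorem opD_mem_cyclic : ∀ v ∈ cyclic (opU p) w, opD p ω v ∈ cyclic (opU p) w := fun _ hv =>
  Submodule.add_mem _ (Submodule.smul_mem _ _ (map_mem_cyclic hv)) hv

theorem opD_torVal (h : IsHeckeEigen w e₁ e₂ ω) (hω : ω ≠ 0) (x y z : ℤ) :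
    opD p ω (torVal w (avgQ p) x y z) =
      (p : ℂ) ^ 2 • torVal w (avgQ p) (x + 1) y z + torVal w (avgQ p) x y z := by
  rw [opD_apply, opU_torVal h, smul_smul, inv_mul_cancel_right₀ hω]

theorem invariantUnder_avgQ' : InvariantUnder (Q p) w (avgQ p) := fun k hk g => by
  rw [avgQ_smul hk]

/-- The four terms of the first Hecke recursion pair up by `x + 1` and `x`, with coefficients in
ratio `p²`, and each pair is a value of `D = p² ω⁻¹ U + 1`. -/
theorem recursion_opD (h : IsHeckeEigen w e₁ e₂ ω) (hω : ω ≠ 0) {x y z : ℤ} (hxy : y ≤ x)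
    (hyz : z ≤ 2 * y) : e₁ • torVal w (avgQ p) x y z =
      (p : ℂ) • opD p ω (torVal w (avgQ p) x (y + 1) (z + 1)) +
        opD p ω (torVal w (avgQ p) x y (z + 1)) := by
  rw [h.recursion_one invariantUnder_avgQ'.unipInvariant hxy hyz, opD_torVal h hω, opD_torVal h hω]
  module

/-- Averages of dominant translates of `w` lie in the saturation of the module generated by `w`
under `U`. -/
theorem torVal_mem_saturation (h : IsHeckeEigen w e₁ e₂ ω) (hω : ω ≠ 0) (n : ℕ) :
    ∀ x y z : ℤ, y ≤ x → 2 * y - z = n → torVal w (avgQ p) x y z ∈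
      saturation (opD p ω) (cyclic (opU p) w) opD_mem_cyclic := by
  have hp : (p : ℂ) ≠ 0 := by exact_mod_cast (Fact.out : p.Prime).ne_zero
  have hp1 : (p : ℂ) + 1 ≠ 0 := by exact_mod_cast Nat.succ_ne_zero p
  induction n using Nat.strong_induction_on with
  | _ n ih =>
    intro x y z hxy hn
    rcases n with - | - | n
    -- For `2y = z`, up to the centre the average is that of `diag(p ^ k, 1, 1, p ^ (-k)) w`, a
    -- multiple of `U ^ k w`.
    · obtain ⟨k, hk⟩ := Int.eq_ofNat_of_zero_le (sub_nonneg.mpr hxy)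
      have h1 := h.torVal_center_zpow hω (avgQ p) k 0 0 y
      have h2 : torVal w (avgQ p) k 0 0 ∈ cyclic (opU p) w := by
        have := pow_mem_cyclic (opU p) w k
        rwa [opU_pow h, Submodule.smul_mem_iff _ (pow_ne_zero k hω)] at this
      rw [← hk, sub_add_cancel, zero_add, zero_add, hk] at h1
      rw [show z = 2 * y by push_cast at hn; omega, h1]
      exact mem_saturation_of_mem (Submodule.smul_mem _ _ h2)
    -- For `2y - z = 1` the flip identifies the two terms on the right of the recursion, which add
    -- up with the nonzero factor `p + 1`.
    · have h1 := recursion_opD h hω (x := x) (y := y - 1) (z := z - 1) (by omega)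
        (by push_cast at hn; omega)
      have h2 := torVal_flip h.inv invariantUnder_avgQ' x y z
      rw [show z - y = y - 1 by push_cast at hn; omega] at h2
      rw [sub_add_cancel, sub_add_cancel, h2] at h1
      have h3 : e₁ • torVal w (avgQ p) x (y - 1) (z - 1) =
          ((p : ℂ) + 1) • opD p ω (torVal w (avgQ p) x y z) := by rw [h1]; module
      rw [← map_mem_saturation_iff, ← Submodule.smul_mem_iff _ hp1, ← h3]
      exact Submodule.smul_mem _ _ (ih 0 (by omega) _ _ _ (by omega) (by push_cast at hn ⊢; omega))
    -- Here the recursion expresses `D` of the average through averages with smaller `2y - z`;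
    -- membership in the saturation can be tested after applying `D`.
    · have h1 := recursion_opD h hω (x := x) (y := y - 1) (z := z - 1) (by omega)
        (by push_cast at hn; omega)
      rw [sub_add_cancel, sub_add_cancel, ← sub_eq_iff_eq_add] at h1
      rw [← map_mem_saturation_iff, ← Submodule.smul_mem_iff _ hp, ← h1]
      refine Submodule.sub_mem _ (Submodule.smul_mem _ _ ?_) (map_mem_saturation_iff.mpr ?_)
      · exact ih (n + 1) (by omega) _ _ _ (by omega) (by push_cast at hn ⊢; omega)
      · exact ih n (by omega) _ _ _ (by omega) (by push_cast at hn ⊢; omega)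

theorem exists_pow_mul_mem_ints (b : ℚ_[p]) :
    ∃ N₀ : ℕ, ∀ N : ℤ, N₀ ≤ N → (p : ℚ_[p]) ^ N * b ∈ ints p := by
  have hp1 : (1 : ℝ) < p := by exact_mod_cast (Fact.out : p.Prime).one_lt
  have hp0 : (0 : ℝ) < p := by positivity
  obtain ⟨n, hn⟩ := pow_unbounded_of_one_lt ‖b‖ hp1
  refine ⟨n, fun N hN => ?_⟩
  have h1 : (p : ℚ_[p]) ^ (n : ℤ) * b ∈ ints p := by
    rw [mem_ints, norm_mul, norm_zpow, Padic.norm_p, zpow_natCast, inv_pow]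
    exact inv_mul_le_one_of_le₀ hn.le (by positivity)
  have := zpow_mul_mem_ints (sub_nonneg.mpr hN) h1
  rwa [← mul_assoc, ← zpow_add₀ (p_ne_zero p), sub_add_cancel] at this

/-- If `e` is integral, the `Q`-average absorbs it; if its conjugate by the torus is integral, `w`
absorbs that; otherwise the Bruhat decomposition in the middle `SL₂` replaces it by a change of `y`.
The new `y'` is independent of `x` and `m`, so that both can grow afterwards. -/
theorem avgQ_unip_tor (hK : ∀ k ∈ K p, k • w = w) (e : ℚ_[p]) (y z : ℤ) :
    ∃ y' : ℤ, ∀ x m : ℤ, avgQ p (unip 0 0 0 e • tor p x (y + m) (z + 2 * m) • w) =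
      torVal w (avgQ p) x (y' + m) (z + 2 * m) := by
  have h0 := zero_mem (ints p)
  by_cases he : e ∈ ints p
  · refine ⟨y, fun x m => ?_⟩
    rw [avgQ_smul (unip_mem_Q h0 h0 h0 he), torVal]
  by_cases he' : (p : ℚ_[p]) ^ (z - 2 * y) * e ∈ ints p
  · refine ⟨y, fun x m => ?_⟩
    have h1 := tor_conj_unip x (y + m) (z + 2 * m) 0 0 0 e
    rw [show z + 2 * m - 2 * (y + m) = z - 2 * y by ring, mul_zero, mul_zero, mul_zero, mul_assoc,
      inv_mul_eq_iff_eq_mul] at h1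
    rw [← mul_smul, h1, mul_smul, hK _ (unip_mem_K_iff.mpr ⟨h0, h0, h0, he'⟩), torVal]
  · have hne : e ≠ 0 := fun h => he (h ▸ h0)
    refine ⟨z - y + e.valuation, fun x m => ?_⟩
    have hinv : ∀ t : ℚ_[p], t ∉ ints p → t⁻¹ ∈ ints p := by
      intro t ht
      rw [mem_ints, not_le] at ht
      rw [mem_ints, norm_inv]
      exact inv_le_one_of_one_le₀ ht.le
    have h1 := hinv _ he'
    rw [mul_inv, ← _root_.zpow_neg, neg_sub] at h1
    obtain ⟨q, hq, hq', k, hk, hqk⟩ := unip_mul_tor_eq (Units.mk0 e hne)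
      (by simpa using hinv e he) x (y + m) (z + 2 * m)
      (by rw [show 2 * (y + m) - (z + 2 * m) = 2 * y - z by ring]; simpa using h1)
    rw [← mul_smul]
    rw [Units.val_mk0] at hqk
    rw [hqk, mul_smul, mul_smul, hK k hk, avgQ_smul ⟨hq, hq'⟩, torVal]
    congr 3
    ring

theorem opU_pow_avgQ (N : ℕ) (v : finFns p) :
    (opU p ^ N) (avgQ p v) = avgQ p (tor p (2 * N) N (2 * N) • v) := by
  induction N with
  | zero => simp [tor_zero]
  | succ N ih =>
    rw [pow_succ', Module.End.mul_apply, ih, opU_avgQ, opU_apply, ← mul_smul, tor_mul]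
    push_cast
    congr 3 <;> ring

/-- In Iwasawa coordinates, `t ^ N` contracts `b`, `c`, `d` to integers for large `N` and pushes `x`
into the dominant range. It does not contract `e`, which is handled in the Klingen Levi subgroup. -/
theorem opU_pow_mem_saturation (h : IsHeckeEigen w e₁ e₂ ω) (hω : ω ≠ 0) (g : G p) :
    ∃ N₀ : ℕ, ∀ N : ℕ, N₀ ≤ N → (opU p ^ N) (avgQ p (g • w)) ∈
      saturation (opD p ω) (cyclic (opU p) w) opD_mem_cyclic := by
  obtain ⟨b, c, d, e, x, y, z, k, hk, rfl⟩ := iwasawa g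
  obtain ⟨N₁, h1⟩ := exists_pow_mul_mem_ints b
  obtain ⟨N₂, h2⟩ := exists_pow_mul_mem_ints c
  obtain ⟨N₃, h3⟩ := exists_pow_mul_mem_ints d
  obtain ⟨y', hy'⟩ := avgQ_unip_tor h.inv e y z
  refine ⟨N₁ + N₂ + N₃ + (y' - x).natAbs + (z - y' - x).natAbs, fun N hN => ?_⟩
  have e1 : (2 * N - N : ℤ) = N := by ring
  have e2 : (2 * N + N - 2 * N : ℤ) = N := by ring
  have e3 : (2 * (2 * N) - 2 * N : ℤ) = 2 * N := by ring
  have hsplit : ∀ b c d e : ℚ_[p], unip b c d e = unip b c d 0 * unip 0 0 0 e := by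
    intro b c d e; rw [unip_mul]; simp
  rw [opU_pow_avgQ, mul_smul, mul_smul, h.inv k hk, ← mul_smul (tor p _ _ _), tor_mul_unip, e1, e2,
    e3, sub_self, zpow_zero, one_mul, hsplit, mul_smul, mul_smul, avgQ_smul (unip_mem_Q
      (h1 _ (by omega)) (h2 _ (by omega)) (h3 _ (by omega)) (zero_mem _)), ← mul_smul (tor p _ _ _),
    tor_mul, add_comm _ y, add_comm _ z, hy']
  rcases le_total (z + 2 * N) (2 * (y' + N)) with hle | hle
  · obtain ⟨n, hn⟩ := Int.eq_ofNat_of_zero_le (sub_nonneg.mpr hle)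
    exact torVal_mem_saturation h hω n _ _ _ (by omega) hn
  · obtain ⟨n, hn⟩ := Int.eq_ofNat_of_zero_le (sub_nonneg.mpr hle)
    -- On the wrong side of the long root wall, the flip `y ↦ z - y` returns to the dominant side.
    rw [← torVal_flip h.inv invariantUnder_avgQ']
    exact torVal_mem_saturation h hω n _ _ _ (by omega) (by omega)

theorem exists_opU_pow_mem_saturation (h : IsHeckeEigen w e₁ e₂ ω) (hω : ω ≠ 0) {v : finFns p}
    (hv : v ∈ Submodule.span ℂ (Set.range fun g : G p => g • w)) :
    ∃ N₀ : ℕ, ∀ N : ℕ, N₀ ≤ N → (opU p ^ N) (avgQ p v) ∈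
      saturation (opD p ω) (cyclic (opU p) w) opD_mem_cyclic := by
  induction hv using Submodule.span_induction with
  | mem v hv =>
    obtain ⟨g, rfl⟩ := hv
    exact opU_pow_mem_saturation h hω g
  | zero => exact ⟨0, fun N _ => by simp⟩
  | add v v' _ _ ih ih' =>
    obtain ⟨N₁, h1⟩ := ih
    obtain ⟨N₂, h2⟩ := ih'
    refine ⟨N₁ + N₂, fun N hN => ?_⟩
    rw [map_add, map_add]
    exact Submodule.add_mem _ (h1 N (by omega)) (h2 N (by omega))
  | smul r v _ ih =>
    obtain ⟨N₁, h1⟩ := ih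
    refine ⟨N₁, fun N hN => ?_⟩
    rw [map_smul, map_smul]
    exact Submodule.smul_mem _ _ (h1 N hN)

/-- Eigenvectors of `U` in the representation generated by `w` come from the spherical vector. -/
theorem mem_cyclic_of_eigenvector (h : IsHeckeEigen w e₁ e₂ ω) (hω : ω ≠ 0) {v : finFns p}
    (hv : v ∈ Submodule.span ℂ (Set.range fun g : G p => g • w)) (hQ : ∀ k ∈ Q p, k • v = v)
    {μ : ℂ} (hμ : μ ≠ 0) (hμ' : (p : ℂ) ^ 2 * ω⁻¹ * μ + 1 ≠ 0) (hU : opU p v = μ • v) :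
    v ∈ cyclic (opU p) w := by
  obtain ⟨N, hN⟩ := exists_opU_pow_mem_saturation h hω hv
  have h1 := hN N le_rfl
  have h2 : ∀ k : ℕ, (opU p ^ k) v = μ ^ k • v := by
    intro k
    induction k with
    | zero => simp
    | succ k ih => rw [pow_succ, Module.End.mul_apply, hU, map_smul, ih, smul_smul, pow_succ']
  -- As `μ ≠ 0`, the power of `U` can be removed, so `v` itself lies in the saturation; then the
  -- nonzero eigenvalue of `D` removes the powers of `D`.
  rw [avgQ_eq_self hQ, h2, Submodule.smul_mem_iff _ (pow_ne_zero N hμ)] at h1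
  refine mem_of_mem_saturation h1 hμ' ?_
  rw [opD_apply, hU, smul_smul, add_smul, one_smul]

end Saturation

end KlingenTrace

namespace KlingenTrace

/-! ### The eigenvector inside the Whittaker model -/

section Model

variable {p : ℕ} [Fact p.Prime] {w : finFns p} {e₁ e₂ ω a b c d : ℂ}
  {W : Submodule ℂ (G p → ℂ)} {ψ : AddChar ℚ_[p] ℂ}

/-- An irreducible space of functions is generated by each of its non-zero elements. -/
theorem IsWhittakerModel.mem_span (hW : IsWhittakerModel ψ W) (hw : (w : G p → ℂ) ∈ W)
    (hw0 : w ≠ 0) {u : G p → ℂ} (hu : u ∈ W) :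
    ∃ v ∈ Submodule.span ℂ (Set.range fun g : G p => g • w), (v : G p → ℂ) = u := by
  set V := Submodule.span ℂ (Set.range fun g : G p => g • w) with hV
  have hgen : ∀ g : G p, g • w ∈ V := fun g => Submodule.subset_span ⟨g, rfl⟩
  have hVW : V.map (finFns p).subtype ≤ W := by
    rw [Submodule.map_le_iff_le_comap, hV, Submodule.span_le]
    rintro _ ⟨g, rfl⟩
    exact hW.stable g _ hw
  have hstable : IsStable (V.map (finFns p).subtype) := by
    rintro g _ ⟨v, hv, rfl⟩
    refine ⟨g • v, ?_, rfl⟩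
    have hle : V ≤ V.comap (DistribSMul.toLinearMap ℂ (finFns p) g) := by
      rw [hV, Submodule.span_le]
      rintro _ ⟨g', rfl⟩
      change g • g' • w ∈ V
      rw [← mul_smul]
      exact hgen _
    exact hle hv
  rcases hW.irreducible _ hVW hstable with h | h
  · have h1 : (w : G p → ℂ) ∈ V.map (finFns p).subtype :=
      ⟨w, by simpa using hgen 1, rfl⟩
    rw [h, Submodule.mem_bot] at h1
    exact absurd (Subtype.ext h1) hw0
  · rw [← h] at hu
    obtain ⟨v, hv, rfl⟩ := hu
    exact ⟨v, hv, rfl⟩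

/-- By construction `U` averages only over `Q`, but on `Kl(p)`-invariant vectors this equals the
average over `Kl(p)`. -/
theorem smul_opU {v : finFns p} (hv : ∀ k ∈ Kl p, k • v = v) {k : G p} (hk : k ∈ Kl p) :
    k • opU p v = opU p v := by
  have h : opU p v = avg (Kl p) (tor p 2 1 2 • v) := (avg_Kl_tor hv).symm
  rw [h]
  exact smul_avg _ hk (finite_orbit_of_le Kl_le_K (finite_orbit_finFns _))

theorem smul_opU_pow (hw : ∀ k ∈ K p, k • w = w) (n : ℕ) :
    ∀ k ∈ Kl p, k • (opU p ^ n) w = (opU p ^ n) w := by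
  induction n with
  | zero => exact fun k hk => hw k (Kl_le_K hk)
  | succ n ih =>
    intro k hk
    rw [pow_succ', Module.End.mul_apply, smul_opU ih hk]

theorem smul_eigenvec (hw : ∀ k ∈ K p, k • w = w) {k : G p} (hk : k ∈ Kl p) :
    k • eigenvec w a b c d = eigenvec w a b c d := by
  have h1 : k • opU p w = opU p w := by simpa using smul_opU_pow hw 1 k hk
  simp only [eigenvec, smul_add, smul_sub, smul_comm k, smul_opU_pow hw _ k hk, h1,
    hw k (Kl_le_K hk)]

theorem opU_pow_mem (hW : IsStable W) (hw : (w : G p → ℂ) ∈ W) (n : ℕ) :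
    ((opU p ^ n) w : finFns p) ∈ W.comap (finFns p).subtype := by
  induction n with
  | zero => exact hw
  | succ n ih =>
    rw [pow_succ', Module.End.mul_apply]
    have h1 : tor p 2 1 2 • (opU p ^ n) w ∈ W.comap (finFns p).subtype :=
      hW (tor p 2 1 2) ((opU p ^ n) w : finFns p) ih
    have h2 : ∀ g ∈ Q p, ∀ v ∈ W.comap (finFns p).subtype, g • v ∈ W.comap (finFns p).subtype :=
      fun g _ v hv => hW g (v : G p → ℂ) hv
    exact avg_mem _ h2 h1

theorem eigenvec_mem (hW : IsStable W) (hw : (w : G p → ℂ) ∈ W) :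
    eigenvec w a b c d ∈ W.comap (finFns p).subtype := by
  have h1 : opU p w ∈ W.comap (finFns p).subtype := by simpa using opU_pow_mem hW hw 1
  exact sub_mem (add_mem (sub_mem (Submodule.smul_mem _ _ (opU_pow_mem hW hw _))
    (Submodule.smul_mem _ _ (opU_pow_mem hW hw _))) (Submodule.smul_mem _ _ h1))
    (Submodule.smul_mem _ _ hw)

theorem eigenvec_mem_cyclic : eigenvec w a b c d ∈ cyclic (opU p) w := by
  have h1 : opU p w ∈ cyclic (opU p) w := by simpa using pow_mem_cyclic (opU p) w 1
  have h0 : w ∈ cyclic (opU p) w := by simpa using pow_mem_cyclic (opU p) w 0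
  exact sub_mem (add_mem (sub_mem (Submodule.smul_mem _ _ (pow_mem_cyclic _ _ _))
    (Submodule.smul_mem _ _ (pow_mem_cyclic _ _ _))) (Submodule.smul_mem _ _ h1))
    (Submodule.smul_mem _ _ h0)

end Model

end KlingenTrace

/-! ### The theorem -/

open KlingenTrace in
theorem mainTheorem9 (p : ℕ) [Fact p.Prime]
    (ψ : AddChar ℚ_[p] ℂ) (hψ : KlingenTrace.IsUnramified ψ)
    (W : Submodule ℂ (KlingenTrace.G p → ℂ)) (hW : KlingenTrace.IsWhittakerModel ψ W)
    (wsph : KlingenTrace.G p → ℂ) (hwsph : KlingenTrace.IsNormalisedSpherical W wsph)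
    (r₁ r₂ : ℕ) (hr : r₂ ≤ r₁) (α β γ δ : ℂ)
    (hparam : KlingenTrace.HasHeckeParameters W r₁ r₂ α β γ δ)
    (hαγ : α + γ ≠ 0) :
    ∃ wKl : KlingenTrace.G p → ℂ,
      KlingenTrace.IsNormalisedKlingen W r₁ r₂ α β wKl ∧
      (∀ w : KlingenTrace.G p → ℂ,
        KlingenTrace.IsNormalisedKlingen W r₁ r₂ α β w → w = wKl) ∧
      KlingenTrace.trace wKl =
        ((p : ℂ) ^ 3 * (1 - γ / (p * β)) * (1 - δ / (p * α)) * (1 - δ / (p * β))) • wsph := by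
  obtain ⟨hsW, hsK, hs1⟩ := hwsph
  set w : finFns p := ⟨wsph, mem_finFns_of_isInvariant hsK⟩ with hwdef
  have hinv : ∀ k ∈ K p, k • w = w := isInvariant_iff.mp hsK
  have hw1 : evalOne p w = 1 := hs1
  have hw0 : w ≠ 0 := by
    intro h
    rw [h, map_zero] at hw1
    exact zero_ne_one hw1
  have hp : (p : ℂ) ≠ 0 := by exact_mod_cast (Fact.out : p.Prime).ne_zero
  obtain ⟨hα, hβ, hγ, hδ⟩ := hparam.ne_zero
  obtain ⟨s, hs⟩ : ∃ s : ℂ, s = ((Real.sqrt p : ℝ) : ℂ) ^ (r₁ + r₂ + 3) := ⟨_, rfl⟩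
  have hs0 : s ≠ 0 := hs ▸ pow_ne_zero _ sqrt_ne_zero
  have hs2 : s ^ 2 = (p : ℂ) ^ (r₁ + r₂ + 3) := by rw [hs, ← pow_mul, mul_comm, pow_mul, sqrt_sq]
  have hE := isHeckeEigen_of hparam hsW hinv hs
  set a := α / s with ha
  set b := β / s with hb
  set c := γ / s with hc
  set d := δ / s with hd
  have ha0 : a ≠ 0 := div_ne_zero hα hs0
  have hb0 : b ≠ 0 := div_ne_zero hβ hs0
  have hc0 : c ≠ 0 := div_ne_zero hγ hs0
  have hd0 : d ≠ 0 := div_ne_zero hδ hs0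
  have hac : a + c ≠ 0 := by rw [ha, hc, ← add_div]; exact div_ne_zero hαγ hs0
  have hmul : a * d = b * c := by
    have := hparam.mul_eq
    rw [ha, hb, hc, hd]
    field_simp
    exact this
  have hω : a * d ≠ 0 := mul_ne_zero ha0 hd0
  have hS : SatakeRelation p a b c d
      (((Real.sqrt p : ℝ) : ℂ) ^ 3 * (a + b + c + d)) _ _ :=
    ⟨by rw [mul_pow, ← pow_mul, mul_comm 3 2, pow_mul, sqrt_sq (p := p)], rfl, rfl, hmul⟩
  have heq : IsEquivariant ψ w := hW.equivariant w hsW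
  have hκ := evalOne_eigenvec hE hS hω heq hψ hw1
  set x := eigenvec w a b c d with hx
  set κ := a ^ 2 * b ^ 3 * (a + c) with hκdef
  have hκ0 : κ ≠ 0 := mul_ne_zero (mul_ne_zero (pow_ne_zero _ ha0) (pow_ne_zero _ hb0)) hac
  have hx0 : x ≠ 0 := by
    intro h
    rw [h, map_zero] at hκ
    exact hκ0 hκ.symm
  have hxU : opU p x = (a * b / (p : ℂ) ^ 2) • x := by
    have := opU_eigenvec hE hS
    rw [div_eq_inv_mul, mul_smul, ← this, smul_smul, inv_mul_cancel₀ (pow_ne_zero 2 hp), one_smul]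
  have hxK : ∀ k ∈ Kl p, k • κ⁻¹ • x = κ⁻¹ • x := fun k hk => by
    rw [smul_comm, smul_eigenvec hinv hk]
  -- Passing to Satake parameters divides `αβ` by `s² = p ^ (r₁ + r₂ + 3)`.
  have hev : (p : ℂ) ^ (r₁ + 4) * (a * b / (p : ℂ) ^ 2) = α * β / (p : ℂ) ^ (r₂ + 1) := by
    have : a * b = α * β / (p : ℂ) ^ (r₁ + r₂ + 3) := by rw [← hs2, ha, hb]; field_simp
    rw [this]
    field_simp
    ring
  refine ⟨(κ⁻¹ • x : finFns p), ⟨?_, isInvariant_iff.mpr hxK, ?_, ?_⟩, ?_, ?_⟩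
  · exact W.smul_mem _ (eigenvec_mem hW.stable hsW)
  · have h1 : avg (Q p) (tor p 2 1 2 • κ⁻¹ • x) = opU p (κ⁻¹ • x) := rfl
    rw [U2Kl_eq hxK, h1, map_smul, hxU, ← hev, smul_comm κ⁻¹, smul_smul, Submodule.coe_smul]
  · have : evalOne p (κ⁻¹ • x) = 1 := by rw [map_smul, hκ, smul_eq_mul, inv_mul_cancel₀ hκ0]
    exact this
  · rintro u ⟨huW, huK, huU, hu1⟩
    obtain ⟨v, hv, rfl⟩ := hW.mem_span hsW hw0 huW
    have hvK := isInvariant_iff.mp huK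
    have hvU : opU p v = (a * b / (p : ℂ) ^ 2) • v := by
      rw [U2Kl_eq hvK, ← hev, ← Submodule.coe_smul, mul_smul] at huU
      exact smul_right_injective _ (pow_ne_zero _ hp) (Subtype.ext huU)
    have hvM : v ∈ cyclic (opU p) w := by
      refine mem_cyclic_of_eigenvector hE hω hv (fun k hk => hvK k (Q_le_Kl hk))
        (div_ne_zero (mul_ne_zero ha0 hb0) (pow_ne_zero 2 hp)) ?_ hvU
      -- The eigenvalue of `D` on `v`: it is `b / d + 1`, and `b / d = a / c`.
      have : (p : ℂ) ^ 2 * (a * d)⁻¹ * (a * b / (p : ℂ) ^ 2) + 1 = (a + c) / c := by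
        rw [hmul]
        field_simp
      rw [this]
      exact div_ne_zero hac hc0
    obtain ⟨r, hr⟩ := eigenvector_unique hvM eigenvec_mem_cyclic hvU hxU hx0
    have hv1 : evalOne p v = 1 := hu1
    rw [hr, map_smul, hκ, smul_eq_mul] at hv1
    rw [hr, eq_inv_of_mul_eq_one_left hv1]
  · have h1 := avgK_eigenvec hE hS hω
    have h2 : avg (K p) (κ⁻¹ • x) = avgK p (κ⁻¹ • x) := rfl
    have h3 : (p : ℂ) ^ 3 * (1 - γ / (p * β)) * (1 - δ / (p * α)) * (1 - δ / (p * β)) =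
        κ⁻¹ * (a * b * (a + c) * (p * b - c) * (p * a - d) * (p * b - d)) := by
      have e1 : γ / (p * β) = c / (p * b) := by rw [hb, hc]; field_simp
      have e2 : δ / (p * α) = d / (p * a) := by rw [ha, hd]; field_simp
      have e3 : δ / (p * β) = d / (p * b) := by rw [hb, hd]; field_simp
      rw [e1, e2, e3, hκdef]
      clear_value a b c d
      field_simp
    rw [trace_eq hxK, h2, map_smul, smul_comm, h1, smul_smul, ← h3, Submodule.coe_smul]
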